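/- **Setting.** Let $m,n,l\ge 0$ be integers and let $E_m\subseteq\{1,\dots,m\}^2$ be symmetric and contain every $(k,k)$. $P_{E_m}$ denotes the map that replaces the entries of an $m\times m$ matrix outside $E_m$ by $0$ (it is applied blockwise to block rows). Let $\int$ be the integral over the unit circle with respect to the normalized Lebesgue measure, $\langle X,Y\rangle=\operatorname{Re}\operatorname{tr}(XY^*)$, and $\Delta(e^{i\vartheta})=[I_m,\ e^{i\vartheta}I_m,\ \dots,\ e^{in\vartheta}I_m]$. Let $G\in\mathbb R^{l\times m(n+1)}$ and let $\hat R=[\hat R_0,\dots,\hat R_n]$ be a block row of real $m\times m$ matrices with $\hat R_0=\hat R_0^T$ whose symmetric block Toeplitz matrix $T(\hat R)$ (block $(h,k)$ equal to $\hat R_{k-h}$ for $h\le k$ and to $\hat R_{h-k}^T$ for $h>k$) is positive definite. Put $\hat R_{-j}=\hat R_j^T$ and $\hat\Phi_m=\sum_{j=-n}^n e^{-ij\vartheta}\hat R_j$. $\mathcal S_m$ is the set of measurable Hermitian $m\times m$ matrix functions $\Phi$ on the unit circle with $c_1I\preceq\Phi\preceq c_2I$ for some $c_1,c_2>0$; $\mathcal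 Q_{m,n}$ is the set of $\sum_{j=-n}^n e^{-ij\vartheta}R_j$ with $R_j=R_{-j}^T\in\mathbb R^{m\times m}$. Put $$\mathcal V_{E_m}=\{\Sigma\in\mathcal Q_{m,n}:P_{E_m^c}(\Sigma)=0\},\qquad \mathcal V_G=\{\Delta G^THG\Delta^*: H=H^T\in\mathbb R^{l\times l}\},$$ $$\mathcal V_G^+=\{\Delta G^THG\Delta^*: H\in\mathbb R^{l\times l},\ H=H^T\succeq0\}.$$ The elements $\Lambda$ of $\mathcal V_G^+$ satisfy $\Lambda\succeq0$ on the circle. Consider the identification problem $$(\mathrm D)\qquad \min_{\Sigma,\Lambda}\ J(\Sigma,\Lambda)=\int\bigl(-\log\det(\Sigma-\Lambda)+\langle\Sigma-\Lambda,\hat\Phi_m\rangle\bigr)\quad\text{s.t. }\Sigma-\Lambda\succ0,\ \Sigma\in\mathcal V_{E_m},\ \Lambda\in\mathcal V_G^+,$$ and the maximum entropy covariance extension problem $$(\mathrm P)\qquad \max_{\Phi\in\mathcal S_m}\int\log\det\Phi\quad\text{s.t. }P_{E_m}\Bigl(\int\Delta\Phi-\hat R\Bigr)=0,\quad \int G\Delta^*\Phi\Delta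 G^T\succeq G\,T(\hat R)\,G^T,$$ where $\int\Delta\Phi$ is the block row with blocks $\int e^{ij\vartheta}\Phi$, $j=0,\dots,n$. For a real block row $S=[S_0,\dots,S_n]$ with $S_0=S_0^T$ and a real symmetric $H\succeq0$ let $$\mathcal L(\Phi,S,H)=\int\log\det\Phi-\Bigl\langle P_{E_m}\Bigl(\int\Delta\Phi-\hat R\Bigr),S\Bigr\rangle+\Bigl\langle\int G\Delta^*\Phi\Delta G^T-G\,T(\hat R)\,G^T,H\Bigr\rangle,$$ let $g(S,H)=\sup_{\Phi\in\mathcal S_m}\mathcal L(\Phi,S,H)\in(-\infty,+\infty]$, and put $$\Sigma_S=P_{E_m}(S_0)+\tfrac12\sum_{j=1}^n\bigl(e^{-ij\vartheta}P_{E_m}(S_j)+e^{ij\vartheta}P_{E_m}(S_j)^T\bigr),\qquad \Lambda_H=\Delta G^THG\Delta^*.$$ **Theorem.** (P) is a convex optimization problem (its feasible set is convex and its objective is concave there), and (D) is its Lagrange dual, with strong duality, in the following sense. 1. The map $(S,H)\mapsto(\Sigma_S,\Lambda_H)$ is onto $\mathcal V_{E_m}\times\mathcal V_G^+$. 2. If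 $\Sigma_S-\Lambda_H\succ0$ on the circle, then $(\Sigma_S-\Lambda_H)^{-1}\in\mathcal S_m$ is, up to almost everywhere equality, the unique maximum point of $\mathcal L(\cdot,S,H)$ over $\mathcal S_m$, and $g(S,H)=J(\Sigma_S,\Lambda_H)-m$. If $\Sigma_S-\Lambda_H$ is not positive semidefinite at some point of the circle, then $g(S,H)=+\infty$. 3. $(S,H)$ minimizes $g$ over all multipliers if and only if $(\Sigma_S,\Lambda_H)$ is a solution of (D). 4. (P) has a solution $\hat\Phi_m^\circ$, unique up to almost everywhere equality, and there is no duality gap: $$\max(\mathrm P)=\int\log\det\hat\Phi_m^\circ=\inf_{S,\,H\succeq0}g(S,H)=\inf(\mathrm D)-m.$$ 5. If $(\Sigma^\circ,\Lambda^\circ)$ is a solution of (D), then $(\Sigma^\circ-\Lambda^\circ)^{-1}$ is the solution of (P). 6. If $0$ is the only element of $\mathcal V_{E_m}\cap\mathcal V_G^+$ (in particular if $\mathcal V_{E_m}\cap\mathcal V_G=\{0\}$), then (D) has a solution, so that the optimal spectral density is $\hat\Phi_m^\circ=(\Sigma^\circ-\Lambda^\circ)^{-1}$ with $\Sigma^\circ\in\mathcal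 V_{E_m}$, $\Lambda^\circ\in\mathcal V_G$, $\Lambda^\circ\succeq0$ (where $(\Sigma^\circ,\Lambda^\circ)$ is a solution of (D)). -/

import Mathlib

open scoped ComplexOrder
open MeasureTheory

noncomputable section

namespace ARLatent

/-- The unit circle, parametrised by the angle `θ` modulo `2π`. -/
abbrev Circ : Type := AddCircle (2 * Real.pi)

instance factTwoPiPos : Fact (0 < 2 * Real.pi) := ⟨Real.two_pi_pos⟩

/-- The normalized Lebesgue measure on the unit circle. -/
abbrev circMeasure : Measure Circ := AddCircle.haarAddCircle

/-- `expi j θ = e^{i j θ}`. -/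
def expi (j : ℤ) (θ : Circ) : ℂ := fourier j θ

/-- Entrywise complexification of a real matrix. -/
def toC {α β : Type*} (X : Matrix α β ℝ) : Matrix α β ℂ := X.map Complex.ofReal

/-- Entrywise integral of a matrix valued function on the circle. -/
def matInt {α β : Type*} (F : Circ → Matrix α β ℂ) : Matrix α β ℂ :=
  Matrix.of fun a b => ∫ θ, F θ a b ∂circMeasure

/-- The real inner product `Re tr (X Y*)`. -/
def ip {α β : Type*} [Fintype α] [Fintype β] (X Y : Matrix α β ℂ) : ℝ :=
  (Matrix.trace (X * Y.conjTranspose)).re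

open Classical in
/-- The projection `P_E`: the entries with index outside `E` are replaced by zero. -/
def proj {m : ℕ} {K : Type*} [Zero K] (E : Set (Fin m × Fin m))
    (X : Matrix (Fin m) (Fin m) K) : Matrix (Fin m) (Fin m) K :=
  Matrix.of fun k h => if (k, h) ∈ E then X k h else 0

/-- Index type of the rows and columns of `(n+1) × (n+1)` block matrices with `m × m` blocks. -/
abbrev BIdx (m n : ℕ) : Type := Fin (n + 1) × Fin m

/-- The block rows `[Y_0 Y_1 … Y_n]` with real `m × m` blocks and `Y_0` symmetric. -/
def blockRows (m n : ℕ) : Set (Fin (n + 1) → Matrix (Fin m) (Fin m) ℝ) :=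
  {Y | (Y 0).IsSymm}

/-- The block Toeplitz matrix with first block row `Y`:
its block `(h, k)` is `Y_{k-h}` if `h ≤ k`, and `Y_{h-k}ᵀ` if `k < h`. -/
def toep {m n : ℕ} (Y : Fin (n + 1) → Matrix (Fin m) (Fin m) ℝ) :
    Matrix (BIdx m n) (BIdx m n) ℝ :=
  Matrix.of fun p q =>
    if p.1 ≤ q.1 then Y (q.1 - p.1) p.2 q.2 else Y (p.1 - q.1) q.2 p.2

/-- The shift operator `Δ(e^{iθ}) = [I, e^{iθ} I, …, e^{inθ} I]`. -/
def shift (m n : ℕ) (θ : Circ) : Matrix (Fin m) (BIdx m n) ℂ :=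
  Matrix.of fun a p => if a = p.2 then expi (p.1 : ℕ) θ else 0

/-- The matrix pseudo-polynomials `∑_{j=-n}^{n} e^{-ijθ} R_j` with real `R_j = R_{-j}ᵀ`. -/
def pseudoPoly (m n : ℕ) : Set (Circ → Matrix (Fin m) (Fin m) ℂ) :=
  {P | ∃ R : ℤ → Matrix (Fin m) (Fin m) ℝ, (∀ j, R (-j) = (R j).transpose) ∧
    P = fun θ => ∑ j ∈ Finset.Icc (-(n : ℤ)) n, expi (-j) θ • toC (R j)}

/-- `V_E`: the pseudo-polynomials supported on `E`. -/
def VE {m : ℕ} (n : ℕ) (E : Set (Fin m × Fin m)) : Set (Circ → Matrix (Fin m) (Fin m) ℂ) :=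
  {P | P ∈ pseudoPoly m n ∧ ∀ θ, proj Eᶜ (P θ) = 0}

/-- The function `Δ Gᵀ H G Δ*`. -/
def gram {m n l : ℕ} (G : Matrix (Fin l) (BIdx m n) ℝ) (H : Matrix (Fin l) (Fin l) ℝ) :
    Circ → Matrix (Fin m) (Fin m) ℂ :=
  fun θ => shift m n θ * toC (G.transpose * H * G) * (shift m n θ).conjTranspose

/-- `V_G`: the functions `Δ Gᵀ H G Δ*` with `H` real symmetric. -/
def VG {m n l : ℕ} (G : Matrix (Fin l) (BIdx m n) ℝ) :
    Set (Circ → Matrix (Fin m) (Fin m) ℂ) :=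
  {P | ∃ H : Matrix (Fin l) (Fin l) ℝ, H.IsSymm ∧ P = gram G H}

/-- The nonnegative cone of `V_G`: the functions `Δ Gᵀ H G Δ*` with `H` real, `H ⪰ 0`. -/
def VGpos {m n l : ℕ} (G : Matrix (Fin l) (BIdx m n) ℝ) :
    Set (Circ → Matrix (Fin m) (Fin m) ℂ) :=
  {P | ∃ H : Matrix (Fin l) (Fin l) ℝ, H.PosSemidef ∧ P = gram G H}

/-- The family `S_m` of measurable Hermitian matrix valued functions `Φ` on the circle with
`c₁ I ⪯ Φ ⪯ c₂ I` for some `c₁, c₂ > 0`. -/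
def specDens (m : ℕ) : Set (Circ → Matrix (Fin m) (Fin m) ℂ) :=
  {Φ | (∀ a b, Measurable fun θ => Φ θ a b) ∧ (∀ θ, (Φ θ).IsHermitian) ∧
    ∃ c₁ c₂ : ℝ, 0 < c₁ ∧ 0 < c₂ ∧
      ∀ θ, (Φ θ - (c₁ : ℂ) • 1).PosSemidef ∧ ((c₂ : ℂ) • 1 - Φ θ).PosSemidef}

/-- `∫ log det Φ`; for the Hermitian positive definite `Φ θ` the determinant is a positive real. -/
def entropy {m : ℕ} (Φ : Circ → Matrix (Fin m) (Fin m) ℂ) : ℝ :=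
  ∫ θ, Real.log (Φ θ).det.re ∂circMeasure

/-- The `j`-th block `∫ e^{ijθ} Φ` of `∫ Δ Φ`, that is, the `j`-th covariance lag of `Φ`. -/
def lag {m : ℕ} (Φ : Circ → Matrix (Fin m) (Fin m) ℂ) (j : ℕ) : Matrix (Fin m) (Fin m) ℂ :=
  matInt fun θ => expi j θ • Φ θ

/-- `P_E (∫ Δ Φ - R)`, as a block row. -/
def lagGap {m n : ℕ} (E : Set (Fin m × Fin m)) (R : Fin (n + 1) → Matrix (Fin m) (Fin m) ℝ)
    (Φ : Circ → Matrix (Fin m) (Fin m) ℂ) (j : Fin (n + 1)) : Matrix (Fin m) (Fin m) ℂ :=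
  proj E (lag Φ j - toC (R j))

/-- `∫ G Δ* Φ Δ Gᵀ - G T(R) Gᵀ`. -/
def covGap {m n l : ℕ} (G : Matrix (Fin l) (BIdx m n) ℝ)
    (R : Fin (n + 1) → Matrix (Fin m) (Fin m) ℝ)
    (Φ : Circ → Matrix (Fin m) (Fin m) ℂ) : Matrix (Fin l) (Fin l) ℂ :=
  matInt (fun θ => toC G * (shift m n θ).conjTranspose * Φ θ * shift m n θ * (toC G).transpose) -
    toC (G * toep R * G.transpose)

/-- The constraints of the maximum entropy covariance extension problem. -/
def primalFeasible {m n l : ℕ} (E : Set (Fin m × Fin m)) (G : Matrix (Fin l) (BIdx m n) ℝ)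
    (R : Fin (n + 1) → Matrix (Fin m) (Fin m) ℝ) : Set (Circ → Matrix (Fin m) (Fin m) ℂ) :=
  {Φ | Φ ∈ specDens m ∧ (∀ j, lagGap E R Φ j = 0) ∧ (covGap G R Φ).PosSemidef}

/-- `Φ` solves the maximum entropy covariance extension problem. -/
def IsPrimalSolution {m n l : ℕ} (E : Set (Fin m × Fin m)) (G : Matrix (Fin l) (BIdx m n) ℝ)
    (R : Fin (n + 1) → Matrix (Fin m) (Fin m) ℝ) (Φ : Circ → Matrix (Fin m) (Fin m) ℂ) : Prop :=
  Φ ∈ primalFeasible E G R ∧ ∀ Ψ ∈ primalFeasible E G R, entropy Ψ ≤ entropy Φ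

/-- The Lagrangian
`∫ log det Φ - ⟨P_E (∫ Δ Φ - R), S⟩ + ⟨∫ G Δ* Φ Δ Gᵀ - G T(R) Gᵀ, H⟩`. -/
def lagrangian {m n l : ℕ} (E : Set (Fin m × Fin m)) (G : Matrix (Fin l) (BIdx m n) ℝ)
    (R : Fin (n + 1) → Matrix (Fin m) (Fin m) ℝ) (Φ : Circ → Matrix (Fin m) (Fin m) ℂ)
    (S : Fin (n + 1) → Matrix (Fin m) (Fin m) ℝ) (H : Matrix (Fin l) (Fin l) ℝ) : ℝ :=
  entropy Φ - ∑ j, ip (lagGap E R Φ j) (toC (S j)) + ip (covGap G R Φ) (toC H)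

/-- The multipliers `(S, H)`: `S` a block row with `S_0` symmetric, `H` symmetric with `H ⪰ 0`. -/
def multipliers (m n l : ℕ) :
    Set ((Fin (n + 1) → Matrix (Fin m) (Fin m) ℝ) × Matrix (Fin l) (Fin l) ℝ) :=
  {p | p.1 ∈ blockRows m n ∧ p.2.PosSemidef}

/-- The Lagrange dual function: the supremum of the Lagrangian over all `Φ` in `S_m`. -/
def dualFun {m n l : ℕ} (E : Set (Fin m × Fin m)) (G : Matrix (Fin l) (BIdx m n) ℝ)
    (R : Fin (n + 1) → Matrix (Fin m) (Fin m) ℝ)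
    (p : (Fin (n + 1) → Matrix (Fin m) (Fin m) ℝ) × Matrix (Fin l) (Fin l) ℝ) : EReal :=
  ⨆ Φ ∈ specDens m, (lagrangian E G R Φ p.1 p.2 : EReal)

/-- The pseudo-polynomial
`P_E(S_0) + (1/2) ∑_{j=1}^{n} (e^{-ijθ} P_E(S_j) + e^{ijθ} P_E(S_j)ᵀ)` of a multiplier `S`. -/
def sigmaOf {m n : ℕ} (E : Set (Fin m × Fin m)) (S : Fin (n + 1) → Matrix (Fin m) (Fin m) ℝ) :
    Circ → Matrix (Fin m) (Fin m) ℂ :=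
  fun θ => toC (proj E (S 0)) + (1 / 2 : ℂ) • ∑ j : Fin n,
    (expi (-((j : ℕ) + 1 : ℤ)) θ • toC (proj E (S j.succ)) +
      expi ((j : ℕ) + 1 : ℤ) θ • (toC (proj E (S j.succ))).transpose)

/-- The windowed correlogram `∑_{j=-n}^{n} e^{-ijθ} R_j`, where `R_{-j} = R_jᵀ`. -/
def correlogram {m n : ℕ} (R : Fin (n + 1) → Matrix (Fin m) (Fin m) ℝ) :
    Circ → Matrix (Fin m) (Fin m) ℂ :=
  fun θ => toC (R 0) + ∑ j : Fin n,
    (expi (-((j : ℕ) + 1 : ℤ)) θ • toC (R j.succ) +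
      expi ((j : ℕ) + 1 : ℤ) θ • (toC (R j.succ)).transpose)

/-- The objective `∫ (-log det (Σ - Λ) + ⟨Σ - Λ, Φ̂⟩)` of the identification problem. -/
def dualObj {m n : ℕ} (R : Fin (n + 1) → Matrix (Fin m) (Fin m) ℝ)
    (P L : Circ → Matrix (Fin m) (Fin m) ℂ) : ℝ :=
  ∫ θ, (-Real.log (P θ - L θ).det.re + ip (P θ - L θ) (correlogram R θ)) ∂circMeasure

/-- The constraints of the identification problem: `Σ - Λ ≻ 0` on the circle, `Σ ∈ V_E`, and `Λ`
in the nonnegative cone of `V_G`. -/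
def dualFeasible {m n l : ℕ} (E : Set (Fin m × Fin m)) (G : Matrix (Fin l) (BIdx m n) ℝ) :
    Set ((Circ → Matrix (Fin m) (Fin m) ℂ) × (Circ → Matrix (Fin m) (Fin m) ℂ)) :=
  {q | (∀ θ, (q.1 θ - q.2 θ).PosDef) ∧ q.1 ∈ VE n E ∧ q.2 ∈ VGpos G}

/-- `(Σ, Λ)` solves the identification problem. -/
def IsDualSolution {m n l : ℕ} (E : Set (Fin m × Fin m)) (G : Matrix (Fin l) (BIdx m n) ℝ)
    (R : Fin (n + 1) → Matrix (Fin m) (Fin m) ℝ)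
    (q : (Circ → Matrix (Fin m) (Fin m) ℂ) × (Circ → Matrix (Fin m) (Fin m) ℂ)) : Prop :=
  q ∈ dualFeasible E G ∧ ∀ q' ∈ dualFeasible E G, dualObj R q.1 q.2 ≤ dualObj R q'.1 q'.2

/-- The pair `(Σ, Λ)` attached to the multipliers `(S, H)`. -/
def pairOf {m n l : ℕ} (E : Set (Fin m × Fin m)) (G : Matrix (Fin l) (BIdx m n) ℝ)
    (p : (Fin (n + 1) → Matrix (Fin m) (Fin m) ℝ) × Matrix (Fin l) (Fin l) ℝ) :
    (Circ → Matrix (Fin m) (Fin m) ℂ) × (Circ → Matrix (Fin m) (Fin m) ℂ) :=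
  (sigmaOf E p.1, gram G p.2)

end ARLatent

end

namespace ARLatent
open Matrix Filter Topology

section MatrixFacts
variable {ι κ : Type*} [Fintype ι] [Fintype κ]

open scoped MatrixOrder in
theorem exists_factor_of_posSemidef {𝕜 : Type*} [RCLike 𝕜] {A : Matrix ι ι 𝕜}
    (hA : A.PosSemidef) : ∃ B : Matrix ι ι 𝕜, A = Bᴴ * B := by
  classical
  exact CStarAlgebra.nonneg_iff_eq_star_mul_self.mp hA.nonneg

theorem ip_eq_sum (X Y : Matrix ι κ ℂ) :
    ip X Y = ∑ a, ∑ b, (X a b * (starRingEnd ℂ) (Y a b)).re := by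
  simp [ip, Matrix.trace, Matrix.mul_apply]

theorem ip_comm (X Y : Matrix ι κ ℂ) : ip X Y = ip Y X := by
  simp only [ip_eq_sum]
  refine Finset.sum_congr rfl fun a _ => Finset.sum_congr rfl fun b _ => ?_
  simp [Complex.mul_re, mul_comm]

theorem ip_add_left (X X' Y : Matrix ι κ ℂ) : ip (X + X') Y = ip X Y + ip X' Y := by
  simp [ip, Matrix.add_mul]

theorem ip_add_right (X Y Y' : Matrix ι κ ℂ) : ip X (Y + Y') = ip X Y + ip X Y' := by
  simp [ip, Matrix.mul_add]

theorem ip_sub_left (X X' Y : Matrix ι κ ℂ) : ip (X - X') Y = ip X Y - ip X' Y := by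
  simp [ip, Matrix.sub_mul]

theorem ip_sub_right (X Y Y' : Matrix ι κ ℂ) : ip X (Y - Y') = ip X Y - ip X Y' := by
  simp [ip, Matrix.mul_sub]

theorem ip_smul_left (c : ℝ) (X Y : Matrix ι κ ℂ) : ip (c • X) Y = c * ip X Y := by
  simp [ip]

theorem ip_smul_right (c : ℝ) (X Y : Matrix ι κ ℂ) : ip X (c • Y) = c * ip X Y := by
  rw [ip_comm, ip_smul_left, ip_comm]

@[simp] theorem ip_zero_left (Y : Matrix ι κ ℂ) : ip 0 Y = 0 := by simp [ip]

@[simp] theorem ip_zero_right (X : Matrix ι κ ℂ) : ip X 0 = 0 := by simp [ip]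

theorem ip_sum_right {τ : Type*} (s : Finset τ) (X : Matrix ι κ ℂ) (Y : τ → Matrix ι κ ℂ) :
    ip X (∑ j ∈ s, Y j) = ∑ j ∈ s, ip X (Y j) := by
  simp [ip, Matrix.conjTranspose_sum, Matrix.mul_sum, Matrix.trace_sum]

theorem ip_csmul_right (c : ℂ) (X Y : Matrix ι κ ℂ) :
    ip X (c • Y) = ip ((starRingEnd ℂ) c • X) Y := by
  simp [ip]

theorem ip_conjTranspose (X Y : Matrix ι κ ℂ) : ip Xᴴ Yᴴ = ip X Y := by
  rw [ip_comm X Y, ip, ip, Matrix.conjTranspose_conjTranspose, Matrix.trace_mul_comm]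

theorem ip_one_right [DecidableEq ι] (X : Matrix ι ι ℂ) : ip X 1 = X.trace.re := by
  simp [ip]

theorem ip_self_nonneg (X : Matrix ι κ ℂ) : 0 ≤ ip X X := by
  rw [ip_eq_sum]
  refine Finset.sum_nonneg fun a _ => Finset.sum_nonneg fun b _ => ?_
  rw [Complex.mul_conj, Complex.ofReal_re]
  exact Complex.normSq_nonneg _

theorem eq_zero_of_ip_self (X : Matrix ι κ ℂ) (h : ip X X = 0) : X = 0 := by
  rw [ip_eq_sum] at h
  have nn : ∀ a b, 0 ≤ (X a b * (starRingEnd ℂ) (X a b)).re := fun a b => by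
    rw [Complex.mul_conj, Complex.ofReal_re]; exact Complex.normSq_nonneg _
  rw [Finset.sum_eq_zero_iff_of_nonneg fun a _ => Finset.sum_nonneg fun b _ => nn a b] at h
  ext a b
  have h1 := h a (Finset.mem_univ _)
  rw [Finset.sum_eq_zero_iff_of_nonneg fun b _ => nn a b] at h1
  have h2 := h1 b (Finset.mem_univ _)
  rwa [Complex.mul_conj, Complex.ofReal_re, Complex.normSq_eq_zero] at h2

theorem ip_nonneg {X Y : Matrix ι ι ℂ} (hX : X.PosSemidef) (hY : Y.PosSemidef) :
    0 ≤ ip X Y := by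
  obtain ⟨B, rfl⟩ := exists_factor_of_posSemidef hX
  rw [ip, hY.1.eq, Matrix.mul_assoc, Matrix.trace_mul_comm]
  exact (Complex.le_def.1 (hY.mul_mul_conjTranspose_same B).trace_nonneg).1

theorem ip_vecMulVec (X : Matrix ι ι ℂ) (v : ι → ℂ) :
    ip X (vecMulVec v (star v)) = (star v ⬝ᵥ (X *ᵥ v)).re := by
  rw [ip_eq_sum]
  simp only [vecMulVec_apply, dotProduct, mulVec, Complex.re_sum, Finset.mul_sum, Pi.star_apply,
    RCLike.star_def, map_mul, Complex.conj_conj]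
  refine Finset.sum_congr rfl fun a _ => Finset.sum_congr rfl fun b _ => ?_
  congr 1; ring

section Det
variable [DecidableEq ι]

theorem log_det_eq_sum {M : Matrix ι ι ℂ} (hM : M.PosDef) :
    Real.log M.det.re = ∑ i, Real.log (hM.1.eigenvalues i) := by
  have h1 : M.det = ((∏ i, hM.1.eigenvalues i : ℝ) : ℂ) := by
    rw [hM.1.det_eq_prod_eigenvalues]; simp
  rw [h1, Complex.ofReal_re, Real.log_prod]
  exact fun i _ => (hM.eigenvalues_pos i).ne'

theorem trace_re_eq_sum {M : Matrix ι ι ℂ} (hM : M.IsHermitian) :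
    M.trace.re = ∑ i, hM.eigenvalues i := by
  rw [hM.trace_eq_sum_eigenvalues]; simp

theorem log_det_le_trace_sub {M : Matrix ι ι ℂ} (hM : M.PosDef) :
    Real.log M.det.re ≤ M.trace.re - Fintype.card ι := by
  rw [log_det_eq_sum hM, trace_re_eq_sum hM.1, Fintype.card, Finset.cast_card,
    ← Finset.sum_sub_distrib]
  exact Finset.sum_le_sum fun i _ => Real.log_le_sub_one_of_pos (hM.eigenvalues_pos i)

theorem eq_one_of_log_det_eq {M : Matrix ι ι ℂ} (hM : M.PosDef)
    (h : Real.log M.det.re = M.trace.re - Fintype.card ι) : M = 1 := by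
  rw [log_det_eq_sum hM, trace_re_eq_sum hM.1, Fintype.card, Finset.cast_card,
    ← Finset.sum_sub_distrib, Finset.sum_eq_sum_iff_of_le
      fun i _ => Real.log_le_sub_one_of_pos (hM.eigenvalues_pos i)] at h
  have h1 : ∀ i, hM.1.eigenvalues i = 1 := fun i => by
    by_contra hne
    exact absurd (h i (Finset.mem_univ _))
      (Real.log_lt_sub_one_of_pos (hM.eigenvalues_pos i) hne).ne
  have h2 := hM.1.spectral_theorem
  have h3 : (RCLike.ofReal ∘ hM.1.eigenvalues : ι → ℂ) = 1 := by
    ext i; simp [h1 i]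
  rw [h3] at h2
  rw [h2]
  simp

theorem posDef_det_re_pos {M : Matrix ι ι ℂ} (hM : M.PosDef) : 0 < M.det.re :=
  (Complex.lt_def.1 hM.det_pos).1

theorem posDef_det_im {M : Matrix ι ι ℂ} (hM : M.PosDef) : M.det.im = 0 :=
  (Complex.lt_def.1 hM.det_pos).2.symm

theorem log_det_conj {B F : Matrix ι ι ℂ} (hB : B.det ≠ 0) (hF : F.PosDef) :
    Real.log (B * F * Bᴴ).det.re = Real.log (Bᴴ * B).det.re + Real.log F.det.re := by
  have h1 : (B * F * Bᴴ).det = ((Complex.normSq B.det * F.det.re : ℝ) : ℂ) := by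
    rw [det_mul, det_mul, det_conjTranspose, mul_right_comm, RCLike.star_def, Complex.mul_conj,
      Complex.ofReal_mul]
    congr 1
    exact Complex.ext rfl (posDef_det_im hF)
  have h2 : (Bᴴ * B).det = (Complex.normSq B.det : ℂ) := by
    rw [det_mul, det_conjTranspose, mul_comm, RCLike.star_def, Complex.mul_conj]
  rw [h1, h2, Complex.ofReal_re, Complex.ofReal_re, Real.log_mul _ (posDef_det_re_pos hF).ne']
  exact (Complex.normSq_pos.2 hB).ne'

theorem factor_det_ne_zero {Q B : Matrix ι ι ℂ} (hQ : Q.PosDef) (h : Q = Bᴴ * B) :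
    B.det ≠ 0 := by
  intro h0
  have := hQ.det_pos
  rw [h, det_mul, h0, mul_zero] at this
  exact lt_irrefl _ this

/-- Gibbs' inequality for `log det`. -/
theorem log_det_sub_ip_le {Q F : Matrix ι ι ℂ} (hQ : Q.PosDef) (hF : F.PosDef) :
    Real.log F.det.re - ip F Q ≤ -Real.log Q.det.re - Fintype.card ι := by
  obtain ⟨B, hB⟩ := exists_factor_of_posSemidef hQ.posSemidef
  have hdet := factor_det_ne_zero hQ hB
  have hM : (B * F * Bᴴ).PosDef := by
    refine hF.mul_mul_conjTranspose_same ?_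
    exact Matrix.vecMul_injective_of_isUnit ((Matrix.isUnit_iff_isUnit_det _).2 hdet.isUnit)
  have h1 := log_det_le_trace_sub hM
  rw [log_det_conj hdet hF, ← hB] at h1
  have h2 : ip F Q = (B * F * Bᴴ).trace.re := by
    rw [ip, hQ.1.eq, hB, Matrix.mul_assoc B, Matrix.trace_mul_comm B, Matrix.mul_assoc]
  linarith

theorem eq_inv_of_log_det_sub_ip_eq {Q F : Matrix ι ι ℂ} (hQ : Q.PosDef) (hF : F.PosDef)
    (h : Real.log F.det.re - ip F Q = -Real.log Q.det.re - Fintype.card ι) : F = Q⁻¹ := by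
  obtain ⟨B, hB⟩ := exists_factor_of_posSemidef hQ.posSemidef
  have hdet := factor_det_ne_zero hQ hB
  have hM : (B * F * Bᴴ).PosDef := by
    refine hF.mul_mul_conjTranspose_same ?_
    exact Matrix.vecMul_injective_of_isUnit ((Matrix.isUnit_iff_isUnit_det _).2 hdet.isUnit)
  have h2 : ip F Q = (B * F * Bᴴ).trace.re := by
    rw [ip, hQ.1.eq, hB, Matrix.mul_assoc B, Matrix.trace_mul_comm B, Matrix.mul_assoc]
  have h3 := eq_one_of_log_det_eq hM (by rw [log_det_conj hdet hF, ← hB]; linarith)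
  have h4 : F * Bᴴ * B = 1 := by
    rw [Matrix.mul_assoc] at h3
    exact mul_eq_one_comm.1 h3
  rw [Matrix.mul_assoc, ← hB] at h4
  exact (Matrix.inv_eq_left_inv h4).symm

theorem log_det_inv {Q : Matrix ι ι ℂ} (hQ : Q.PosDef) :
    Real.log (Q⁻¹).det.re = -Real.log Q.det.re := by
  have h : Q.det = ((Q.det.re : ℝ) : ℂ) := Complex.ext rfl (posDef_det_im hQ)
  rw [det_nonsing_inv, Ring.inverse_eq_inv', h, ← Complex.ofReal_inv, Complex.ofReal_re,
    Complex.ofReal_re, Real.log_inv]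

theorem ip_inv_self {Q : Matrix ι ι ℂ} (hQ : Q.PosDef) : ip Q⁻¹ Q = Fintype.card ι := by
  rw [ip, hQ.1.eq, Matrix.nonsing_inv_mul _ ((Matrix.isUnit_iff_isUnit_det _).1 hQ.isUnit)]
  simp

/-- The linear upper bound of `log det` at `A`, evaluated at `B`. -/
theorem log_det_le_tangent {A B : Matrix ι ι ℂ} (hA : A.PosDef) (hB : B.PosDef) :
    Real.log B.det.re ≤ Real.log A.det.re + ip (B - A) A⁻¹ := by
  have h := log_det_sub_ip_le hA.inv hB
  rw [log_det_inv hA] at h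
  have h1 := ip_inv_self hA
  rw [ip_comm] at h1
  rw [ip_sub_left, h1]
  linarith

/-- For a unit vector `v`, `tr A⁻¹ ≥ 1 / (v* A v)`. -/
theorem inv_le_trace_inv {A : Matrix ι ι ℂ} (hA : A.PosDef) {v : ι → ℂ}
    (hv : star v ⬝ᵥ v = 1) :
    ((star v ⬝ᵥ (A *ᵥ v)).re)⁻¹ ≤ (A⁻¹).trace.re := by
  have hu : IsUnit A.det := (Matrix.isUnit_iff_isUnit_det _).1 hA.isUnit
  have hv0 : v ≠ 0 := by rintro rfl; simp at hv
  set α := (star v ⬝ᵥ (A⁻¹ *ᵥ v)).re with hα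
  set β := (star v ⬝ᵥ (A *ᵥ v)).re with hβ
  have hαpos : 0 < α := (Complex.lt_def.1 (hA.inv.dotProduct_mulVec_pos hv0)).1
  have hβpos : 0 < β := (Complex.lt_def.1 (hA.dotProduct_mulVec_pos hv0)).1
  have h1 : α ≤ (A⁻¹).trace.re := by
    have hp : (1 - vecMulVec v (star v)).PosSemidef := by
      have hh : (vecMulVec v (star v))ᴴ = vecMulVec v (star v) := by
        rw [conjTranspose_vecMulVec, star_star]
      have hs : vecMulVec v (star v) * vecMulVec v (star v) = vecMulVec v (star v) := by
        rw [vecMulVec_mul_vecMulVec, hv, one_smul]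
      have : 1 - vecMulVec v (star v) =
          (1 - vecMulVec v (star v)) * (1 - vecMulVec v (star v))ᴴ := by
        rw [conjTranspose_sub, conjTranspose_one, hh, sub_mul, mul_sub, mul_sub, hs]; simp
      rw [this]
      exact posSemidef_self_mul_conjTranspose _
    have := ip_nonneg hA.inv.posSemidef hp
    rw [ip_sub_right, ip_one_right, ip_vecMulVec] at this
    linarith
  refine le_trans ?_ h1
  have key : ∀ s : ℝ, 0 ≤ s ^ 2 * α - 2 * s + β := fun s => by
    have h := (Complex.le_def.1
      (hA.posSemidef.dotProduct_mulVec_nonneg ((s : ℂ) • (A⁻¹ *ᵥ v) - v))).1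
    have e1 : A *ᵥ ((s : ℂ) • (A⁻¹ *ᵥ v) - v) = (s : ℂ) • v - A *ᵥ v := by
      rw [mulVec_sub, mulVec_smul, mulVec_mulVec, Matrix.mul_nonsing_inv _ hu, one_mulVec]
    have e2 : star (A⁻¹ *ᵥ v) = star v ᵥ* A⁻¹ := by
      rw [star_mulVec, hA.inv.1.eq]
    rw [e1, star_sub, star_smul, e2] at h
    have e3 : (star v ᵥ* A⁻¹) ⬝ᵥ (A *ᵥ v) = 1 := by
      rw [← dotProduct_mulVec, mulVec_mulVec, Matrix.nonsing_inv_mul _ hu, one_mulVec, hv]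
    have e4 : (star v ᵥ* A⁻¹) ⬝ᵥ v = star v ⬝ᵥ (A⁻¹ *ᵥ v) := by rw [dotProduct_mulVec]
    simp only [sub_dotProduct, dotProduct_sub, smul_dotProduct, dotProduct_smul, e3, e4, hv] at h
    simp at h
    nlinarith
  have h := key α⁻¹
  have : α⁻¹ ^ 2 * α = α⁻¹ := by field_simp
  rw [this] at h
  exact inv_le_of_inv_le₀ hαpos (by linarith)

end Det
end MatrixFacts

section Expi

theorem continuous_expi (j : ℤ) : Continuous (expi j) := (fourier j).continuous

@[simp] theorem expi_zero (θ : Circ) : expi 0 θ = 1 := fourier_zero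

theorem expi_add (i j : ℤ) (θ : Circ) : expi (i + j) θ = expi i θ * expi j θ := fourier_add

theorem conj_expi (j : ℤ) (θ : Circ) : (starRingEnd ℂ) (expi j θ) = expi (-j) θ :=
  fourier_neg.symm

theorem norm_expi (j : ℤ) (θ : Circ) : ‖expi j θ‖ = 1 := by
  rw [expi, fourier_apply, Circle.norm_coe]

theorem integral_expi (j : ℤ) : ∫ θ, expi j θ ∂circMeasure = if j = 0 then 1 else 0 := by
  have h := fourierCoeff_fourier (T := 2 * Real.pi) j
  have h2 := congrFun h 0
  simp only [fourierCoeff, neg_zero, fourier_zero, one_smul] at h2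
  rw [show (fun θ => expi j θ) = fun θ => fourier j θ from rfl, h2]
  by_cases hj : j = 0
  · subst hj; simp
  · simp [hj, Ne.symm hj]

end Expi

section MInt
variable {α β γ : Type*}

/-- Integrability of all entries. -/
def MInt (F : Circ → Matrix α β ℂ) : Prop := ∀ a b, Integrable (fun θ => F θ a b) circMeasure

theorem integrable_of_continuous {E : Type*} [NormedAddCommGroup E] {f : Circ → E}
    (hf : Continuous f) : Integrable f circMeasure :=
  hf.integrable_of_hasCompactSupport (HasCompactSupport.of_compactSpace f)

theorem MInt.of_continuous {F : Circ → Matrix α β ℂ} (hF : Continuous F) : MInt F :=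
  fun a b => integrable_of_continuous (hF.matrix_elem a b)

theorem MInt.smul {F : Circ → Matrix α β ℂ} (c : ℝ) (hF : MInt F) :
    MInt (fun θ => c • F θ) := fun a b => (hF a b).smul c

theorem integrable_continuous_mul {f g : Circ → ℂ} (hf : Continuous f)
    (hg : Integrable g circMeasure) : Integrable (fun θ => f θ * g θ) circMeasure := by
  obtain ⟨C, hC⟩ := (isCompact_range hf).isBounded.exists_norm_le
  exact hg.bdd_mul hf.aestronglyMeasurable
    (Filter.Eventually.of_forall fun θ => hC _ (Set.mem_range_self θ))

theorem MInt.csmul {F : Circ → Matrix α β ℂ} (hF : MInt F) {c : Circ → ℂ} (hc : Continuous c) :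
    MInt (fun θ => c θ • F θ) := fun a b => integrable_continuous_mul hc (hF a b)

theorem MInt.mul_left [Fintype α] {F : Circ → Matrix α β ℂ} (hF : MInt F)
    {A : Circ → Matrix γ α ℂ} (hA : Continuous A) : MInt (fun θ => A θ * F θ) := by
  intro a b
  simp only [Matrix.mul_apply]
  exact integrable_finsetSum _ fun c _ => integrable_continuous_mul (hA.matrix_elem a c) (hF c b)

theorem MInt.mul_right [Fintype β] {F : Circ → Matrix α β ℂ} (hF : MInt F)
    {A : Circ → Matrix β γ ℂ} (hA : Continuous A) : MInt (fun θ => F θ * A θ) := by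
  intro a b
  simp only [Matrix.mul_apply]
  refine integrable_finsetSum _ fun c _ => ?_
  simp only [mul_comm (F _ a c)]
  exact integrable_continuous_mul (hA.matrix_elem c b) (hF a c)

theorem MInt.integrable_ip [Fintype α] [Fintype β] {F A : Circ → Matrix α β ℂ} (hF : MInt F)
    (hA : Continuous A) : Integrable (fun θ => ip (F θ) (A θ)) circMeasure := by
  simp only [ip_eq_sum]
  refine integrable_finsetSum _ fun a _ => integrable_finsetSum _ fun b _ => ?_
  simp only [mul_comm (F _ a b)]
  exact (integrable_continuous_mul (Complex.continuous_conj.comp (hA.matrix_elem a b)) (hF a b)).re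

theorem ip_matInt [Fintype α] [Fintype β] {F : Circ → Matrix α β ℂ} (hF : MInt F)
    (Y : Matrix α β ℂ) : ip (matInt F) Y = ∫ θ, ip (F θ) Y ∂circMeasure := by
  have h1 : ∀ a b, Integrable (fun θ => F θ a b * (starRingEnd ℂ) (Y a b)) circMeasure :=
    fun a b => (hF a b).mul_const _
  have h2 : ∀ a b, Integrable (fun θ => (F θ a b * (starRingEnd ℂ) (Y a b)).re) circMeasure :=
    fun a b => (h1 a b).re
  simp only [ip_eq_sum]
  rw [integral_finsetSum _ fun a _ => integrable_finsetSum _ fun b _ => h2 a b]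
  refine Finset.sum_congr rfl fun a _ => ?_
  rw [integral_finsetSum _ fun b _ => h2 a b]
  refine Finset.sum_congr rfl fun b _ => ?_
  have := integral_re (h1 a b)
  simp only [RCLike.re_eq_complex_re] at this
  rw [this, integral_mul_const]
  rfl

theorem matInt_mul_const [Fintype β] {F : Circ → Matrix α β ℂ} (hF : MInt F)
    (B : Matrix β γ ℂ) : matInt (fun θ => F θ * B) = matInt F * B := by
  ext a c
  simp only [matInt, Matrix.mul_apply, Matrix.of_apply]
  rw [integral_finsetSum _ fun b _ => (hF a b).mul_const _]
  simp only [integral_mul_const]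

theorem matInt_const_mul [Fintype α] {F : Circ → Matrix α β ℂ} (hF : MInt F)
    (A : Matrix γ α ℂ) : matInt (fun θ => A * F θ) = A * matInt F := by
  ext c b
  simp only [matInt, Matrix.mul_apply, Matrix.of_apply]
  rw [integral_finsetSum _ fun a _ => (hF a b).const_mul _]
  simp only [integral_const_mul]

theorem matInt_add {F F' : Circ → Matrix α β ℂ} (hF : MInt F) (hF' : MInt F') :
    matInt (fun θ => F θ + F' θ) = matInt F + matInt F' := by
  ext a b; exact integral_add (hF a b) (hF' a b)

theorem matInt_smul {F : Circ → Matrix α β ℂ} (c : ℝ) :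
    matInt (fun θ => c • F θ) = c • matInt F := by
  ext a b; exact integral_smul c _

end MInt

section Blocks
variable {m n l : ℕ}

/-- The trigonometric matrix polynomial with real coefficients `S`, the nonconstant ones
weighted by `c`. -/
noncomputable def trig (c : ℝ) (S : Fin (n + 1) → Matrix (Fin m) (Fin m) ℝ) (θ : Circ) :
    Matrix (Fin m) (Fin m) ℂ :=
  toC (S 0) + (c : ℂ) • ∑ j : Fin n,
    (expi (-((j : ℕ) + 1 : ℤ)) θ • toC (S j.succ) +
      expi ((j : ℕ) + 1 : ℤ) θ • (toC (S j.succ)).transpose)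

theorem sigmaOf_eq (E : Set (Fin m × Fin m)) (S : Fin (n + 1) → Matrix (Fin m) (Fin m) ℝ) :
    sigmaOf E S = trig (1 / 2) fun j => proj E (S j) := by
  funext θ
  simp [sigmaOf, trig]

theorem correlogram_eq (R : Fin (n + 1) → Matrix (Fin m) (Fin m) ℝ) :
    correlogram R = trig 1 R := by
  funext θ
  simp [correlogram, trig]

theorem toC_apply {α β : Type*} (X : Matrix α β ℝ) (a : α) (b : β) : toC X a b = (X a b : ℂ) := rfl

theorem trig_apply (c : ℝ) (S : Fin (n + 1) → Matrix (Fin m) (Fin m) ℝ) (θ : Circ) (a b : Fin m) :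
    trig c S θ a b = (S 0 a b : ℂ) + (c : ℂ) * ∑ j : Fin n,
      (expi (-((j : ℕ) + 1 : ℤ)) θ * (S j.succ a b : ℂ) +
        expi ((j : ℕ) + 1 : ℤ) θ * (S j.succ b a : ℂ)) := by
  simp [trig, toC_apply, Matrix.sum_apply]

theorem continuous_trig_uncurry (c : ℝ) :
    Continuous fun z : (Fin (n + 1) → Matrix (Fin m) (Fin m) ℝ) × Circ => trig c z.1 z.2 := by
  refine continuous_matrix fun a b => ?_
  simp only [trig_apply]
  have h1 : ∀ j a b, Continuous fun z : (Fin (n + 1) → Matrix (Fin m) (Fin m) ℝ) × Circ =>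
      ((z.1 j a b : ℝ) : ℂ) := fun j a b =>
    Complex.continuous_ofReal.comp (((continuous_apply j).comp continuous_fst).matrix_elem a b)
  have h2 : ∀ j, Continuous fun z : (Fin (n + 1) → Matrix (Fin m) (Fin m) ℝ) × Circ =>
      expi j z.2 := fun j => (continuous_expi j).comp continuous_snd
  exact (h1 0 a b).add (continuous_const.mul (continuous_finsetSum _ fun j _ =>
    ((h2 _).mul (h1 _ a b)).add ((h2 _).mul (h1 _ b a))))

theorem continuous_trig (c : ℝ) (S : Fin (n + 1) → Matrix (Fin m) (Fin m) ℝ) :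
    Continuous (trig c S) :=
  (continuous_trig_uncurry c).comp (Continuous.prodMk_right S)

theorem trig_isHermitian (c : ℝ) {S : Fin (n + 1) → Matrix (Fin m) (Fin m) ℝ}
    (hS : S ∈ blockRows m n) (θ : Circ) : (trig c S θ).IsHermitian := by
  ext a b
  have h0 : S 0 b a = S 0 a b := hS.apply a b
  simp only [conjTranspose_apply, trig_apply, RCLike.star_def, map_add, map_mul, map_sum,
    Complex.conj_ofReal, conj_expi, neg_neg, h0]
  congr 2
  exact Finset.sum_congr rfl fun j _ => add_comm _ _

theorem integrable_expi_mul (j : ℤ) (c : ℂ) :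
    Integrable (fun θ => expi j θ * c) circMeasure :=
  integrable_of_continuous ((continuous_expi j).mul continuous_const)

theorem integral_expi_trig (c : ℝ) (S : Fin (n + 1) → Matrix (Fin m) (Fin m) ℝ) (k : ℤ)
    (a b : Fin m) : ∫ θ, expi k θ * trig c S θ a b ∂circMeasure =
      (if k = 0 then 1 else 0) * (S 0 a b : ℂ) + (c : ℂ) * ∑ j : Fin n,
        ((if k = (j : ℕ) + 1 then 1 else 0) * (S j.succ a b : ℂ) +
          (if k = -((j : ℕ) + 1) then 1 else 0) * (S j.succ b a : ℂ)) := by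
  have e : ∀ θ, expi k θ * trig c S θ a b = expi k θ * (S 0 a b : ℂ) + (c : ℂ) * ∑ j : Fin n,
      (expi (k + -((j : ℕ) + 1 : ℤ)) θ * (S j.succ a b : ℂ) +
        expi (k + ((j : ℕ) + 1 : ℤ)) θ * (S j.succ b a : ℂ)) := fun θ => by
    simp only [trig_apply, expi_add, mul_add, Finset.mul_sum]
    congr 1
    refine Finset.sum_congr rfl fun j _ => ?_
    ring
  have hi : ∀ j : Fin n, Integrable (fun θ => expi (k + -((j : ℕ) + 1 : ℤ)) θ *
      (S j.succ a b : ℂ) + expi (k + ((j : ℕ) + 1 : ℤ)) θ * (S j.succ b a : ℂ)) circMeasure :=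
    fun j => (integrable_expi_mul _ _).add (integrable_expi_mul _ _)
  simp only [e]
  rw [integral_add (integrable_expi_mul _ _)
      ((integrable_finsetSum _ fun j _ => hi j).const_mul _),
    integral_const_mul, integral_finsetSum _ fun j _ => hi j, integral_mul_const, integral_expi]
  congr 2
  refine Finset.sum_congr rfl fun j _ => ?_
  rw [integral_add (integrable_expi_mul _ _) (integrable_expi_mul _ _), integral_mul_const,
    integral_mul_const, integral_expi, integral_expi]
  simp only [← sub_eq_add_neg, sub_eq_zero, add_eq_zero_iff_eq_neg]

theorem lag_apply (Φ : Circ → Matrix (Fin m) (Fin m) ℂ) (j : ℕ) (a b : Fin m) :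
    lag Φ j a b = ∫ θ, expi j θ * Φ θ a b ∂circMeasure := rfl

theorem lag_trig_zero (c : ℝ) (S : Fin (n + 1) → Matrix (Fin m) (Fin m) ℝ) :
    lag (trig c S) 0 = toC (S 0) := by
  ext a b
  rw [lag_apply, integral_expi_trig, toC_apply]
  have h1 : ∀ j : Fin n, ¬ ((0 : ℤ) = (j : ℕ) + 1) := fun j => by omega
  have h2 : ∀ j : Fin n, ¬ ((0 : ℤ) = -((j : ℕ) + 1)) := fun j => by omega
  simp [h1, h2, -neg_add_rev]

theorem lag_trig_succ (c : ℝ) (S : Fin (n + 1) → Matrix (Fin m) (Fin m) ℝ) (i : Fin n) :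
    lag (trig c S) ((i : ℕ) + 1) = (c : ℂ) • toC (S i.succ) := by
  ext a b
  rw [lag_apply, integral_expi_trig, Matrix.smul_apply, toC_apply]
  have h0 : ¬ (((i : ℕ) + 1 : ℕ) : ℤ) = 0 := by omega
  have h1 : ∀ j : Fin n, ((((i : ℕ) + 1 : ℕ) : ℤ) = (j : ℕ) + 1) ↔ i = j := fun j => by
    rw [Fin.ext_iff]; omega
  have h2 : ∀ j : Fin n, ¬ ((((i : ℕ) + 1 : ℕ) : ℤ) = -((j : ℕ) + 1)) := fun j => by omega
  simp only [h0, h1, h2, if_false, zero_mul, add_zero, zero_add, ite_mul, one_mul,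
    Finset.sum_ite_eq, Finset.mem_univ, if_true, smul_eq_mul]

theorem lag_correlogram (R : Fin (n + 1) → Matrix (Fin m) (Fin m) ℝ) (j : Fin (n + 1)) :
    lag (correlogram R) j = toC (R j) := by
  rw [correlogram_eq]
  refine Fin.cases ?_ (fun i => ?_) j
  · exact lag_trig_zero 1 R
  · rw [Fin.val_succ, lag_trig_succ]; simp

theorem toC_conjTranspose {α β : Type*} (X : Matrix α β ℝ) : (toC X)ᴴ = toC Xᵀ := by
  ext a b; simp [toC_apply]

theorem toC_transpose {α β : Type*} (X : Matrix α β ℝ) : (toC X)ᵀ = toC Xᵀ := rfl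

theorem toC_mul {α β γ : Type*} [Fintype β] (X : Matrix α β ℝ) (Y : Matrix β γ ℝ) :
    toC (X * Y) = toC X * toC Y := by
  ext a b; simp [toC_apply, Matrix.mul_apply]

theorem toC_add {α β : Type*} (X Y : Matrix α β ℝ) : toC (X + Y) = toC X + toC Y := by
  ext a b; simp [toC_apply]

theorem toC_sub {α β : Type*} (X Y : Matrix α β ℝ) : toC (X - Y) = toC X - toC Y := by
  ext a b; simp [toC_apply]

theorem ip_toC {α β : Type*} [Fintype α] [Fintype β] (X Y : Matrix α β ℝ) :
    ip (toC X) (toC Y) = ∑ a, ∑ b, X a b * Y a b := by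
  simp [ip_eq_sum, toC_apply]

/-- The real pairing of block rows. -/
noncomputable def pairing (R S : Fin (n + 1) → Matrix (Fin m) (Fin m) ℝ) : ℝ :=
  ∑ j, ip (toC (R j)) (toC (S j))

theorem ip_expi_smul (M : Matrix (Fin m) (Fin m) ℂ) (k : ℤ) (θ : Circ)
    (A : Matrix (Fin m) (Fin m) ℂ) : ip M (expi (-k) θ • A) = ip (expi k θ • M) A := by
  rw [ip_csmul_right, conj_expi, neg_neg]

theorem ip_trig {M : Matrix (Fin m) (Fin m) ℂ} (hM : M.IsHermitian)
    (S : Fin (n + 1) → Matrix (Fin m) (Fin m) ℝ) (θ : Circ) :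
    ip M (trig (1 / 2) S θ) = ∑ j : Fin (n + 1), ip (expi (j : ℕ) θ • M) (toC (S j)) := by
  rw [trig, ip_add_right, Fin.sum_univ_succ]
  have h : ∀ A : Matrix (Fin m) (Fin m) ℂ, ip M (((1 / 2 : ℝ) : ℂ) • A) = 1 / 2 * ip M A :=
    fun A => by
      rw [show ((1 / 2 : ℝ) : ℂ) • A = (1 / 2 : ℝ) • A from Complex.coe_smul _ _, ip_smul_right]
  rw [h, ip_sum_right, Finset.mul_sum]
  congr 1
  · simp
  · refine Finset.sum_congr rfl fun j _ => ?_
    have e : expi ((j : ℕ) + 1 : ℤ) θ • (toC (S j.succ))ᵀ =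
        (expi (-((j : ℕ) + 1 : ℤ)) θ • toC (S j.succ))ᴴ := by
      rw [conjTranspose_smul, toC_conjTranspose, RCLike.star_def, conj_expi, neg_neg,
        toC_transpose]
    have e2 : ip M (expi (-((j : ℕ) + 1 : ℤ)) θ • toC (S j.succ))ᴴ =
        ip M (expi (-((j : ℕ) + 1 : ℤ)) θ • toC (S j.succ)) := by
      conv_lhs => rw [← hM.eq]
      exact ip_conjTranspose _ _
    rw [ip_add_right, e, e2, ip_expi_smul, Fin.val_succ, Nat.cast_add, Nat.cast_one]
    ring

theorem integral_ip_trig {Φ : Circ → Matrix (Fin m) (Fin m) ℂ} (hΦ : MInt Φ)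
    (hH : ∀ θ, (Φ θ).IsHermitian) (S : Fin (n + 1) → Matrix (Fin m) (Fin m) ℝ) :
    ∫ θ, ip (Φ θ) (trig (1 / 2) S θ) ∂circMeasure =
      ∑ j : Fin (n + 1), ip (lag Φ j) (toC (S j)) := by
  simp only [fun θ => ip_trig (hH θ) S θ]
  have h := fun j : Fin (n + 1) => hΦ.csmul (continuous_expi (j : ℕ))
  rw [integral_finsetSum _ fun j _ => (h j).integrable_ip continuous_const]
  refine Finset.sum_congr rfl fun j _ => ?_
  rw [lag, ip_matInt (h j)]

theorem proj_apply {K : Type*} [Zero K] (E : Set (Fin m × Fin m)) (X : Matrix (Fin m) (Fin m) K)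
    (a b : Fin m) [Decidable ((a, b) ∈ E)] : proj E X a b = if (a, b) ∈ E then X a b else 0 := by
  simp only [proj, Matrix.of_apply]; congr

theorem ip_proj (E : Set (Fin m × Fin m)) (X : Matrix (Fin m) (Fin m) ℂ)
    (Y : Matrix (Fin m) (Fin m) ℝ) : ip (proj E X) (toC Y) = ip X (toC (proj E Y)) := by
  classical
  simp only [ip_eq_sum, toC_apply, proj_apply]
  refine Finset.sum_congr rfl fun a _ => Finset.sum_congr rfl fun b _ => ?_
  split_ifs <;> simp

theorem sum_ip_lagGap (E : Set (Fin m × Fin m)) (R : Fin (n + 1) → Matrix (Fin m) (Fin m) ℝ)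
    {Φ : Circ → Matrix (Fin m) (Fin m) ℂ} (hΦ : MInt Φ) (hH : ∀ θ, (Φ θ).IsHermitian)
    (S : Fin (n + 1) → Matrix (Fin m) (Fin m) ℝ) :
    ∑ j, ip (lagGap E R Φ j) (toC (S j)) =
      ∫ θ, ip (Φ θ) (sigmaOf E S θ) ∂circMeasure - pairing R (fun j => proj E (S j)) := by
  rw [sigmaOf_eq, integral_ip_trig hΦ hH, pairing, ← Finset.sum_sub_distrib]
  refine Finset.sum_congr rfl fun j _ => ?_
  rw [lagGap, ip_proj, ip_sub_left]

theorem integral_ip_correlogram {R : Fin (n + 1) → Matrix (Fin m) (Fin m) ℝ}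
    (hR : R ∈ blockRows m n) (S : Fin (n + 1) → Matrix (Fin m) (Fin m) ℝ) :
    ∫ θ, ip (correlogram R θ) (trig (1 / 2) S θ) ∂circMeasure = pairing R S := by
  have h := correlogram_eq R
  rw [integral_ip_trig (by rw [h]; exact MInt.of_continuous (continuous_trig 1 R))
    (by rw [h]; exact trig_isHermitian 1 hR)]
  simp only [lag_correlogram, pairing]

theorem continuous_shift : Continuous (shift m n) := by
  refine continuous_matrix fun a p => ?_
  simp only [shift, Matrix.of_apply]
  split_ifs
  · exact continuous_expi _
  · exact continuous_const

theorem continuous_gram (G : Matrix (Fin l) (BIdx m n) ℝ) (H : Matrix (Fin l) (Fin l) ℝ) :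
    Continuous (gram G H) :=
  (continuous_shift.matrix_mul continuous_const).matrix_mul continuous_shift.matrix_conjTranspose

theorem ip_congruence {α β : Type*} [Fintype α] [Fintype β] (A : Matrix α β ℂ)
    (M : Matrix α α ℂ) (H : Matrix β β ℂ) : ip (Aᴴ * M * A) H = ip M (A * H * Aᴴ) := by
  simp only [ip, conjTranspose_mul, conjTranspose_conjTranspose]
  rw [Matrix.mul_assoc, Matrix.mul_assoc, Matrix.trace_mul_comm]
  simp only [Matrix.mul_assoc]

theorem ip_covGap (G : Matrix (Fin l) (BIdx m n) ℝ)
    (R : Fin (n + 1) → Matrix (Fin m) (Fin m) ℝ)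
    {Φ : Circ → Matrix (Fin m) (Fin m) ℂ} (hΦ : MInt Φ) (H : Matrix (Fin l) (Fin l) ℝ) :
    ip (covGap G R Φ) (toC H) = ∫ θ, ip (Φ θ) (gram G H θ) ∂circMeasure -
      ip (toC (G * toep R * Gᵀ)) (toC H) := by
  rw [covGap, ip_sub_left, ip_matInt]
  · congr 1
    refine integral_congr_ae (Eventually.of_forall fun θ => ?_)
    have e : toC G * (shift m n θ)ᴴ * Φ θ * shift m n θ * (toC G)ᵀ =
        (shift m n θ * toC Gᵀ)ᴴ * Φ θ * (shift m n θ * toC Gᵀ) := by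
      rw [conjTranspose_mul, toC_conjTranspose, transpose_transpose, toC_transpose]
      simp only [Matrix.mul_assoc]
    simp only
    rw [e, ip_congruence, gram, conjTranspose_mul, toC_conjTranspose, transpose_transpose,
      toC_mul, toC_mul]
    simp only [Matrix.mul_assoc]
  · exact ((hΦ.mul_left (continuous_const.matrix_mul
      continuous_shift.matrix_conjTranspose)).mul_right continuous_shift).mul_right continuous_const

theorem shift_congr_apply (M : Matrix (Fin m) (Fin m) ℂ) (θ : Circ) (p q : BIdx m n) :
    ((shift m n θ)ᴴ * M * shift m n θ) p q =
      expi (((q.1 : ℕ) : ℤ) - (p.1 : ℕ)) θ * M p.2 q.2 := by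
  simp only [Matrix.mul_apply, conjTranspose_apply, shift, Matrix.of_apply]
  simp only [apply_ite star, star_zero, ite_mul, zero_mul, Finset.sum_ite_eq', Finset.mem_univ,
    if_true, mul_ite, mul_zero, RCLike.star_def, conj_expi]
  rw [sub_eq_add_neg, expi_add]
  ring

theorem matInt_shift_correlogram {R : Fin (n + 1) → Matrix (Fin m) (Fin m) ℝ}
    (hR : R ∈ blockRows m n) :
    matInt (fun θ => (shift m n θ)ᴴ * correlogram R θ * shift m n θ) = toC (toep R) := by
  ext p q
  obtain ⟨h, a⟩ := p
  obtain ⟨k, b⟩ := q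
  have h1 : ∀ (j : Fin (n + 1)) (a b : Fin m),
      ∫ θ, expi (j : ℕ) θ * correlogram R θ a b ∂circMeasure = (R j a b : ℂ) := fun j a b =>
    congrFun (congrFun (lag_correlogram R j) a) b
  simp only [matInt, Matrix.of_apply, shift_congr_apply, toC_apply, toep]
  split_ifs with hhk
  · rw [← h1]
    have : ((k : ℕ) : ℤ) - (h : ℕ) = ((k - h : Fin (n + 1)) : ℕ) := by
      rw [Fin.coe_sub_iff_le.2 hhk]; have : (h : ℕ) ≤ k := hhk; omega
    rw [this]
  · have hlt : k ≤ h := (not_le.1 hhk).le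
    have e : ((k : ℕ) : ℤ) - (h : ℕ) = -(((h - k : Fin (n + 1)) : ℕ) : ℤ) := by
      rw [Fin.coe_sub_iff_le.2 hlt]; have : (k : ℕ) ≤ h := hlt; omega
    rw [e, ← Complex.conj_ofReal, ← h1, ← integral_conj]
    refine integral_congr_ae (Eventually.of_forall fun θ => ?_)
    simp only [map_mul, conj_expi]
    congr 1
    rw [correlogram_eq]
    have := congrFun (congrFun (trig_isHermitian 1 hR θ).eq a) b
    rw [← this]; rfl

theorem covGap_correlogram (G : Matrix (Fin l) (BIdx m n) ℝ)
    {R : Fin (n + 1) → Matrix (Fin m) (Fin m) ℝ} (hR : R ∈ blockRows m n) :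
    covGap G R (correlogram R) = 0 := by
  have h0 : MInt (correlogram R) := by
    rw [correlogram_eq]; exact MInt.of_continuous (continuous_trig 1 R)
  have h1 : MInt (fun θ => (shift m n θ)ᴴ * correlogram R θ * shift m n θ) :=
    (h0.mul_left continuous_shift.matrix_conjTranspose).mul_right continuous_shift
  have e : ∀ θ, toC G * (shift m n θ)ᴴ * correlogram R θ * shift m n θ * (toC G)ᵀ =
      toC G * ((shift m n θ)ᴴ * correlogram R θ * shift m n θ) * (toC G)ᵀ := fun θ => by
    simp only [Matrix.mul_assoc]
  rw [covGap]
  simp only [e]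
  rw [matInt_mul_const (h1.mul_left continuous_const), matInt_const_mul h1,
    matInt_shift_correlogram hR, toC_mul, toC_mul, toC_transpose, sub_self]

theorem lagrangian_eq (E : Set (Fin m × Fin m)) (G : Matrix (Fin l) (BIdx m n) ℝ)
    {R : Fin (n + 1) → Matrix (Fin m) (Fin m) ℝ} (hR : R ∈ blockRows m n)
    {Φ : Circ → Matrix (Fin m) (Fin m) ℂ} (hΦ : MInt Φ) (hH : ∀ θ, (Φ θ).IsHermitian)
    (S : Fin (n + 1) → Matrix (Fin m) (Fin m) ℝ) (H : Matrix (Fin l) (Fin l) ℝ) :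
    lagrangian E G R Φ S H = entropy Φ -
      ∫ θ, ip (Φ θ) (sigmaOf E S θ - gram G H θ) ∂circMeasure +
      ∫ θ, ip (correlogram R θ) (sigmaOf E S θ - gram G H θ) ∂circMeasure := by
  have hc := correlogram_eq R
  have h0 : MInt (correlogram R) := by
    rw [hc]; exact MInt.of_continuous (continuous_trig 1 R)
  have hcg := ip_covGap G R h0 H
  rw [covGap_correlogram G hR, ip_zero_left] at hcg
  have hs : Continuous (sigmaOf E S) := by rw [sigmaOf_eq]; exact continuous_trig _ _
  have hg := continuous_gram G H
  simp only [ip_sub_right]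
  rw [integral_sub (hΦ.integrable_ip hs) (hΦ.integrable_ip hg),
    integral_sub (h0.integrable_ip hs) (h0.integrable_ip hg), lagrangian,
    sum_ip_lagGap E R hΦ hH, ip_covGap G R hΦ, sigmaOf_eq, integral_ip_correlogram hR]
  linarith

end Blocks

section Parametric
variable {m n : ℕ} {X : Type*} [TopologicalSpace X]

theorem posDef_of_sphere {M : Matrix (Fin m) (Fin m) ℂ} (hM : M.IsHermitian)
    (h : ∀ v ∈ Metric.sphere (0 : Fin m → ℂ) 1, 0 < (star v ⬝ᵥ (M *ᵥ v)).re) : M.PosDef := by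
  refine Matrix.PosDef.of_dotProduct_mulVec_pos hM fun v hv => ?_
  have hn : 0 < ‖v‖ := norm_pos_iff.2 hv
  have him : (star v ⬝ᵥ (M *ᵥ v)).im = 0 := hM.im_star_dotProduct_mulVec_self v
  refine Complex.lt_def.2 ⟨?_, him.symm⟩
  have h1 := h (((‖v‖⁻¹ : ℝ) : ℂ) • v) (by
    rw [mem_sphere_zero_iff_norm, norm_smul, Complex.norm_real, norm_inv, norm_norm,
      inv_mul_cancel₀ hn.ne'])
  rw [star_smul, mulVec_smul, dotProduct_smul, smul_dotProduct, RCLike.star_def,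
    Complex.conj_ofReal, smul_smul, ← Complex.ofReal_mul, smul_eq_mul, Complex.re_ofReal_mul] at h1
  exact pos_of_mul_pos_right h1 (mul_self_nonneg _)

/-- Positive definiteness on the whole circle is an open condition. -/
theorem eventually_posDef {M : X → Circ → Matrix (Fin m) (Fin m) ℂ}
    (hM : Continuous fun z : X × Circ => M z.1 z.2) {x₀ : X} (h₀ : ∀ θ, (M x₀ θ).PosDef) :
    ∀ᶠ x in 𝓝 x₀, ∀ θ, (M x θ).IsHermitian → (M x θ).PosDef := by
  have hK : IsCompact ((Set.univ : Set Circ) ×ˢ Metric.sphere (0 : Fin m → ℂ) 1) :=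
    isCompact_univ.prod (isCompact_sphere _ _)
  have hc : Continuous fun z : X × (Circ × (Fin m → ℂ)) =>
      (star z.2.2 ⬝ᵥ (M z.1 z.2.1 *ᵥ z.2.2)).re := by
    have h1 : Continuous fun z : X × (Circ × (Fin m → ℂ)) => M z.1 z.2.1 :=
      hM.comp (continuous_fst.prodMk (continuous_fst.comp continuous_snd))
    have h2 : Continuous fun z : X × (Circ × (Fin m → ℂ)) => z.2.2 := by fun_prop
    exact Complex.continuous_re.comp (h2.star.dotProduct (h1.matrix_mulVec h2))
  have h := hK.eventually_forall_of_forall_eventually (x₀ := x₀)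
    (P := fun x y => 0 < (star y.2 ⬝ᵥ (M x y.1 *ᵥ y.2)).re) (fun y hy => by
      refine hc.continuousAt.eventually (lt_mem_nhds ?_)
      have hy0 : y.2 ≠ 0 := by
        intro h0
        have := hy.2
        rw [h0, mem_sphere_zero_iff_norm, norm_zero] at this
        exact zero_ne_one this
      exact (Complex.lt_def.1 ((h₀ y.1).dotProduct_mulVec_pos hy0)).1)
  exact h.mono fun x hx θ hH => posDef_of_sphere hH fun v hv => hx (θ, v) ⟨Set.mem_univ _, hv⟩

theorem tendsto_integral_of_continuousAt {F : X → Circ → ℝ} {x₀ : X}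
    (h : ∀ θ, ContinuousAt (fun z : X × Circ => F z.1 z.2) (x₀, θ)) {L : Filter X}
    (hL : L ≤ 𝓝 x₀) (hF : ∀ᶠ x in L, Integrable (F x) circMeasure) :
    Tendsto (fun x => ∫ θ, F x θ ∂circMeasure) L (𝓝 (∫ θ, F x₀ θ ∂circMeasure)) := by
  have hc : Continuous (F x₀) := continuous_iff_continuousAt.2 fun θ =>
    ContinuousAt.comp (g := fun z : X × Circ => F z.1 z.2) (f := fun θ => (x₀, θ)) (h θ)
      (Continuous.prodMk_right x₀).continuousAt
  refine Metric.tendsto_nhds.2 fun ε hε => ?_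
  have hu : ∀ᶠ x in 𝓝 x₀, ∀ θ ∈ (Set.univ : Set Circ), |F x θ - F x₀ θ| < ε / 2 := by
    refine isCompact_univ.eventually_forall_of_forall_eventually fun θ _ => ?_
    have h1 : ContinuousAt (fun z : X × Circ => |F z.1 z.2 - F x₀ z.2|) (x₀, θ) :=
      ((h θ).sub (hc.continuousAt.comp continuousAt_snd)).abs
    refine h1.eventually (gt_mem_nhds ?_)
    simp [hε]
  filter_upwards [hL hu, hF] with x hx hi
  rw [Real.dist_eq, ← integral_sub hi (integrable_of_continuous hc), ← Real.norm_eq_abs]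
  have := norm_integral_le_of_norm_le_const (μ := circMeasure) (f := fun θ => F x θ - F x₀ θ)
    (Eventually.of_forall fun θ => (hx θ trivial).le)
  refine lt_of_le_of_lt this ?_
  rw [probReal_univ, mul_one]
  linarith

theorem continuousAt_log_det {M : X → Matrix (Fin m) (Fin m) ℂ} {x₀ : X}
    (hM : ContinuousAt M x₀) (h₀ : (M x₀).PosDef) :
    ContinuousAt (fun x => Real.log (M x).det.re) x₀ := by
  have h1 : Continuous fun A : Matrix (Fin m) (Fin m) ℂ => A.det.re :=
    Complex.continuous_re.comp continuous_id.matrix_det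
  exact (h1.continuousAt.comp hM).log (posDef_det_re_pos h₀).ne'

theorem continuousAt_inv_of_posDef {M : X → Matrix (Fin m) (Fin m) ℂ} {x₀ : X}
    (hM : ContinuousAt M x₀) (h₀ : (M x₀).PosDef) :
    ContinuousAt (fun x => (M x)⁻¹) x₀ := by
  refine ContinuousAt.comp (g := fun A : Matrix (Fin m) (Fin m) ℂ => A⁻¹)
    (continuousAt_matrix_inv _ ?_) hM
  simp only [Ring.inverse_eq_inv']
  exact continuousAt_inv₀ h₀.det_pos.ne'

theorem continuous_inv_of_posDef {M : X → Matrix (Fin m) (Fin m) ℂ} (hM : Continuous M)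
    (h : ∀ x, (M x).PosDef) : Continuous fun x => (M x)⁻¹ :=
  continuous_iff_continuousAt.2 fun x => continuousAt_inv_of_posDef hM.continuousAt (h x)

theorem continuous_log_det {M : X → Matrix (Fin m) (Fin m) ℂ} (hM : Continuous M)
    (h : ∀ x, (M x).PosDef) : Continuous fun x => Real.log (M x).det.re :=
  continuous_iff_continuousAt.2 fun x => continuousAt_log_det hM.continuousAt (h x)

theorem continuous_ip {ι κ : Type*} [Fintype ι] [Fintype κ] :
    Continuous fun z : Matrix ι κ ℂ × Matrix ι κ ℂ => ip z.1 z.2 :=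
  Complex.continuous_re.comp
    (continuous_fst.matrix_mul continuous_snd.matrix_conjTranspose).matrix_trace

end Parametric

section SpecDens
variable {m n : ℕ}

theorem isHermitian_smul_one (c : ℝ) : ((c : ℂ) • (1 : Matrix (Fin m) (Fin m) ℂ)).IsHermitian := by
  rw [Matrix.IsHermitian, conjTranspose_smul, conjTranspose_one, RCLike.star_def,
    Complex.conj_ofReal]

theorem specDens_of_continuous {F : Circ → Matrix (Fin m) (Fin m) ℂ} (hF : Continuous F)
    (h : ∀ θ, (F θ).PosDef) : F ∈ specDens m := by
  refine ⟨fun a b => (hF.matrix_elem a b).measurable, fun θ => (h θ).1, ?_⟩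
  have hsnd : Continuous fun z : ℝ × Circ => F z.2 := hF.comp continuous_snd
  have hfst : Continuous fun z : ℝ × Circ => (z.1 : ℂ) :=
    Complex.continuous_ofReal.comp continuous_fst
  have e1 := eventually_posDef (X := ℝ) (M := fun x θ => F θ - (x : ℂ) • 1) (x₀ := 0)
    (hsnd.sub (hfst.smul continuous_const)) (by simpa using h)
  have e2 := eventually_posDef (X := ℝ) (M := fun x θ => 1 - (x : ℂ) • F θ) (x₀ := 0)
    (continuous_const.sub (hfst.smul hsnd)) (fun θ => by
      simpa using (Matrix.PosDef.one : (1 : Matrix (Fin m) (Fin m) ℂ).PosDef))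
  obtain ⟨x, ⟨hx1, hx2⟩, hx⟩ := (((e1.and e2).filter_mono nhdsWithin_le_nhds).and
    (self_mem_nhdsWithin : Set.Ioi (0 : ℝ) ∈ 𝓝[>] 0)).exists
  have hx : 0 < x := hx
  refine ⟨x, x⁻¹, hx, inv_pos.2 hx, fun θ =>
    ⟨(hx1 θ ((h θ).1.sub (isHermitian_smul_one x))).posSemidef, ?_⟩⟩
  have hh : (1 - (x : ℂ) • F θ).IsHermitian := by
    refine Matrix.isHermitian_one.sub ?_
    rw [Matrix.IsHermitian, conjTranspose_smul, (h θ).1.eq, RCLike.star_def, Complex.conj_ofReal]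
  have h3 := (hx2 θ hh).posSemidef.smul
    (Complex.zero_le_real.2 (inv_pos.2 hx).le)
  rw [smul_sub, smul_smul, ← Complex.ofReal_mul, inv_mul_cancel₀ hx.ne'] at h3
  simpa using h3

variable {Φ Ψ : Circ → Matrix (Fin m) (Fin m) ℂ}

theorem posDef_of_sub_smul_one {A : Matrix (Fin m) (Fin m) ℂ} {c : ℝ} (hc : 0 < c)
    (h : (A - (c : ℂ) • 1).PosSemidef) : A.PosDef := by
  have h1 : ((c : ℂ) • (1 : Matrix (Fin m) (Fin m) ℂ)).PosDef :=
    Matrix.PosDef.one.smul (Complex.zero_lt_real.2 hc)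
  have := h1.add_posSemidef h
  rwa [add_sub_cancel] at this

theorem specDens_posDef (hΦ : Φ ∈ specDens m) (θ : Circ) : (Φ θ).PosDef := by
  obtain ⟨-, -, c₁, c₂, h1, -, h⟩ := hΦ
  exact posDef_of_sub_smul_one h1 (h θ).1

theorem PosSemidef_diag_re_le_trace {A : Matrix (Fin m) (Fin m) ℂ} (hA : A.PosSemidef)
    (a : Fin m) : (A a a).re ≤ A.trace.re := by
  rw [Matrix.trace, Complex.re_sum]
  exact Finset.single_le_sum (f := fun i => (A i i).re)
    (fun i _ => (Complex.le_def.1 hA.diag_nonneg).1) (Finset.mem_univ a)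

theorem norm_apply_le_trace {A : Matrix (Fin m) (Fin m) ℂ} (hA : A.PosSemidef) (a b : Fin m) :
    ‖A a b‖ ≤ A.trace.re := by
  obtain ⟨B, hB⟩ := exists_factor_of_posSemidef hA
  have hd : ∀ c, (A c c).re = ∑ k, ‖B k c‖ ^ 2 := fun c => by
    rw [hB, Matrix.mul_apply, Complex.re_sum]
    refine Finset.sum_congr rfl fun k _ => ?_
    rw [conjTranspose_apply, RCLike.star_def, mul_comm, Complex.mul_conj, Complex.ofReal_re,
      Complex.normSq_eq_norm_sq]
  have h1 : ‖A a b‖ ≤ ∑ k, ‖B k a‖ * ‖B k b‖ := by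
    rw [hB, Matrix.mul_apply]
    refine (norm_sum_le _ _).trans (Finset.sum_le_sum fun k _ => ?_)
    rw [norm_mul, conjTranspose_apply, norm_star]
  have h2 : ∑ k, ‖B k a‖ * ‖B k b‖ ≤ ((A a a).re + (A b b).re) / 2 := by
    rw [hd, hd, ← Finset.sum_add_distrib, Finset.sum_div]
    exact Finset.sum_le_sum fun k _ => by nlinarith [sq_nonneg (‖B k a‖ - ‖B k b‖)]
  have h3 := PosSemidef_diag_re_le_trace hA a
  have h4 := PosSemidef_diag_re_le_trace hA b
  linarith

theorem specDens_trace_le (hΦ : Φ ∈ specDens m) : ∃ C, ∀ θ, (Φ θ).trace.re ≤ C := by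
  obtain ⟨-, -, c₁, c₂, -, -, h⟩ := hΦ
  refine ⟨c₂ * m, fun θ => ?_⟩
  have := (Complex.le_def.1 (h θ).2.trace_nonneg).1
  simp [trace_sub, trace_smul] at this
  linarith

theorem specDens_mInt (hΦ : Φ ∈ specDens m) : MInt Φ := by
  obtain ⟨C, hC⟩ := specDens_trace_le hΦ
  intro a b
  exact Integrable.of_bound (hΦ.1 a b).aestronglyMeasurable C (Eventually.of_forall fun θ =>
    (norm_apply_le_trace (specDens_posDef hΦ θ).posSemidef a b).trans (hC θ))

theorem measurable_log_det (hΦ : ∀ a b, Measurable fun θ => Φ θ a b) :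
    Measurable fun θ => Real.log (Φ θ).det.re := by
  simp only [Matrix.det_apply]
  refine Real.measurable_log.comp (Complex.measurable_re.comp ?_)
  exact Finset.measurable_sum _ fun σ _ =>
    (Finset.measurable_prod _ fun i _ => hΦ _ _).const_smul _

theorem log_det_le_trace {A : Matrix (Fin m) (Fin m) ℂ} (hA : A.PosDef) :
    Real.log A.det.re ≤ A.trace.re := by
  have := log_det_le_trace_sub hA
  have h2 : (0 : ℝ) ≤ Fintype.card (Fin m) := Nat.cast_nonneg _
  linarith

theorem log_det_ge {A : Matrix (Fin m) (Fin m) ℂ} {c : ℝ} (hc : 0 < c)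
    (h : (A - (c : ℂ) • 1).PosSemidef) : m * Real.log c ≤ Real.log A.det.re := by
  have hA := posDef_of_sub_smul_one hc h
  have hlow : ∀ i, c ≤ hA.1.eigenvalues i := fun i => by
    have h1 := h.re_dotProduct_nonneg (hA.1.eigenvectorBasis i)
    have h2 : star (hA.1.eigenvectorBasis i : Fin m → ℂ) ⬝ᵥ (hA.1.eigenvectorBasis i : Fin m → ℂ)
        = 1 := by
      have := hA.1.eigenvectorBasis.orthonormal.1 i
      have h3 := inner_self_eq_norm_sq_to_K (𝕜 := ℂ) (hA.1.eigenvectorBasis i)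
      rw [this, EuclideanSpace.inner_eq_star_dotProduct, dotProduct_comm] at h3
      simpa using h3
    rw [sub_mulVec, hA.1.mulVec_eigenvectorBasis, smul_mulVec, one_mulVec, dotProduct_sub,
      dotProduct_smul, dotProduct_smul, h2] at h1
    simpa using h1
  rw [log_det_eq_sum hA]
  calc (m : ℝ) * Real.log c = ∑ _i : Fin m, Real.log c := by simp
    _ ≤ _ := Finset.sum_le_sum fun i _ => Real.log_le_log hc (hlow i)

theorem specDens_integrable_log_det (hΦ : Φ ∈ specDens m) :
    Integrable (fun θ => Real.log (Φ θ).det.re) circMeasure := by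
  obtain ⟨C, hC⟩ := specDens_trace_le hΦ
  obtain ⟨c₁, c₂, h1, -, h⟩ := hΦ.2.2
  refine Integrable.of_bound (measurable_log_det hΦ.1).aestronglyMeasurable
    (max C (-(m * Real.log c₁))) (Eventually.of_forall fun θ => ?_)
  rw [Real.norm_eq_abs, abs_le]
  have hu := log_det_le_trace (specDens_posDef hΦ θ)
  have hl := log_det_ge h1 (h θ).1
  constructor
  · have := le_max_right C (-(m * Real.log c₁)); linarith
  · exact (hu.trans (hC θ)).trans (le_max_left _ _)

theorem specDens_convex_comb (hΦ : Φ ∈ specDens m) (hΨ : Ψ ∈ specDens m) {a b : ℝ}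
    (ha : 0 ≤ a) (hb : 0 ≤ b) (hab : a + b = 1) : a • Φ + b • Ψ ∈ specDens m := by
  obtain ⟨hm, hh, c₁, c₂, p1, p2, h⟩ := hΦ
  obtain ⟨hm', hh', d₁, d₂, q1, q2, h'⟩ := hΨ
  have hcd : ∀ {x y : ℝ}, 0 < x → 0 < y → 0 < a * x + b * y := fun {x y} hx hy => by
    rcases ha.eq_or_lt with h0 | h0
    · have : b = 1 := by linarith
      subst h0 this; simpa using hy
    · have := mul_pos h0 hx; have := mul_nonneg hb hy.le; linarith
  have hsm : ∀ {r : ℝ} {A : Matrix (Fin m) (Fin m) ℂ}, 0 ≤ r → A.PosSemidef →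
      (r • A).PosSemidef := fun {r A} hr hA => by
    rw [← Complex.coe_smul]; exact hA.smul (Complex.zero_le_real.2 hr)
  refine ⟨fun i j => ?_, fun θ => ?_, a * c₁ + b * d₁, a * c₂ + b * d₂, hcd p1 q1, hcd p2 q2,
    fun θ => ⟨?_, ?_⟩⟩
  · exact ((hm i j).const_smul a).add ((hm' i j).const_smul b)
  · have e1 : (a • Φ θ).IsHermitian := by
      rw [Matrix.IsHermitian, conjTranspose_smul, (hh θ).eq, star_trivial]
    have e2 : (b • Ψ θ).IsHermitian := by
      rw [Matrix.IsHermitian, conjTranspose_smul, (hh' θ).eq, star_trivial]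
    exact e1.add e2
  · have e : (a • Φ + b • Ψ) θ - ((a * c₁ + b * d₁ : ℝ) : ℂ) • 1 =
        a • (Φ θ - (c₁ : ℂ) • 1) + b • (Ψ θ - (d₁ : ℂ) • 1) := by
      ext i j; simp; ring
    rw [e]; exact (hsm ha (h θ).1).add (hsm hb (h' θ).1)
  · have e : ((a * c₂ + b * d₂ : ℝ) : ℂ) • 1 - (a • Φ + b • Ψ) θ =
        a • ((c₂ : ℂ) • 1 - Φ θ) + b • ((d₂ : ℂ) • 1 - Ψ θ) := by
      ext i j; simp; ring
    rw [e]; exact (hsm ha (h θ).2).add (hsm hb (h' θ).2)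

end SpecDens

section Nonsingular
variable {m n : ℕ}

theorem contDiff_expi (j : ℤ) : ContDiff ℝ 1 fun x : ℝ => expi j (x : Circ) := by
  have h : ContDiff ℝ 1 fun x : ℝ => (x : ℂ) := Complex.ofRealCLM.contDiff
  simp only [expi, fourier_coe_apply]
  exact ((contDiff_const.mul h).div_const _).cexp

theorem contDiff_trig (c : ℝ) (S : Fin (n + 1) → Matrix (Fin m) (Fin m) ℝ) (a b : Fin m) :
    ContDiff ℝ 1 fun x : ℝ => trig c S (x : Circ) a b := by
  simp only [trig_apply]
  refine contDiff_const.add (contDiff_const.mul (ContDiff.sum fun j _ => ?_))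
  exact ((contDiff_expi _).mul contDiff_const).add ((contDiff_expi _).mul contDiff_const)

theorem integral_circ_eq (f : Circ → ℝ) (a : ℝ) :
    ∫ θ, f θ ∂circMeasure = (2 * Real.pi)⁻¹ * ∫ x in a..a + 2 * Real.pi, f (x : Circ) := by
  rw [AddCircle.intervalIntegral_preimage, AddCircle.integral_haarAddCircle, smul_eq_mul]

theorem integral_inv_affine {a K t : ℝ} (hK : 0 < K) (ht : 0 < t) :
    ∫ x in a..a + 2 * Real.pi, (K * (x - a) + t)⁻¹ =
      K⁻¹ * (Real.log (K * (2 * Real.pi) + t) - Real.log t) := by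
  have hpos : ∀ x ∈ Set.uIcc a (a + 2 * Real.pi), 0 < K * (x - a) + t := fun x hx => by
    rw [Set.uIcc_of_le (by linarith [Real.pi_pos])] at hx
    have := mul_nonneg hK.le (sub_nonneg.2 hx.1)
    linarith
  rw [intervalIntegral.integral_eq_sub_of_hasDerivAt
    (f := fun x => K⁻¹ * Real.log (K * (x - a) + t))]
  · simp only [add_sub_cancel_left, sub_self, mul_zero, zero_add]; ring
  · intro x hx
    have h1 : HasDerivAt (fun x => K * (x - a) + t) K x := by
      simpa using (((hasDerivAt_id x).sub_const a).const_mul K).add_const t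
    have h2 := (h1.log (hpos x hx).ne').const_mul K⁻¹
    rwa [mul_div, inv_mul_cancel₀ hK.ne', one_div] at h2
  · refine ContinuousOn.intervalIntegrable (ContinuousOn.inv₀ (by fun_prop) ?_)
    exact fun x hx => (hpos x hx).ne'

theorem posDef_add_smul_one {A : Matrix (Fin m) (Fin m) ℂ} (hA : A.PosSemidef) {t : ℝ}
    (ht : 0 < t) : (A + (t : ℂ) • 1).PosDef := by
  refine posDef_of_sub_smul_one ht ?_
  simpa using hA

theorem exists_unit_kernel {A : Matrix (Fin m) (Fin m) ℂ} (hA : A.PosSemidef) (h : ¬ A.PosDef) :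
    ∃ v : Fin m → ℂ, star v ⬝ᵥ v = 1 ∧ (star v ⬝ᵥ (A *ᵥ v)).re = 0 := by
  rw [hA.1.posDef_iff_eigenvalues_pos] at h
  push Not at h
  obtain ⟨i, hi⟩ := h
  have h0 : hA.1.eigenvalues i = 0 := le_antisymm hi (hA.eigenvalues_nonneg i)
  refine ⟨hA.1.eigenvectorBasis i, ?_, ?_⟩
  · have := hA.1.eigenvectorBasis.orthonormal.1 i
    have h3 := inner_self_eq_norm_sq_to_K (𝕜 := ℂ) (hA.1.eigenvectorBasis i)
    rw [this, EuclideanSpace.inner_eq_star_dotProduct, dotProduct_comm] at h3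
    simpa using h3
  · rw [hA.1.mulVec_eigenvectorBasis, h0]; simp

/-- A positive semidefinite trigonometric polynomial whose regularized inverses have bounded
integrated trace is nonsingular on the circle. -/
theorem posDef_of_integral_trace_inv_le {S : Fin (n + 1) → Matrix (Fin m) (Fin m) ℝ}
    {c C : ℝ} (hS : ∀ θ, (trig c S θ).PosSemidef)
    (hC : ∀ t : ℝ, 0 < t →
      ∫ θ, ((trig c S θ + (t : ℂ) • 1)⁻¹).trace.re ∂circMeasure ≤ C) (θ : Circ) :
    (trig c S θ).PosDef := by
  by_contra hn
  obtain ⟨a, rfl⟩ := QuotientAddGroup.mk_surjective θ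
  obtain ⟨v, hv, hv0⟩ := exists_unit_kernel (hS _) hn
  set f : ℝ → ℝ := fun x => (star v ⬝ᵥ (trig c S (x : Circ) *ᵥ v)).re with hf
  have hfc : ContDiff ℝ 1 f := by
    have : ContDiff ℝ 1 fun x : ℝ => star v ⬝ᵥ (trig c S (x : Circ) *ᵥ v) := by
      simp only [dotProduct, mulVec]
      exact ContDiff.sum fun i _ => contDiff_const.mul
        (ContDiff.sum fun j _ => (contDiff_trig c S i j).mul contDiff_const)
    exact Complex.reCLM.contDiff.comp this
  obtain ⟨K₀, hK₀⟩ := (hfc.contDiffOn (s := Set.Icc a (a + 2 * Real.pi))).exists_lipschitzOnWith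
    one_ne_zero (convex_Icc _ _) isCompact_Icc
  set K : ℝ := K₀ + 1 with hKdef
  have hK : 0 < K := by positivity
  have hpi := Real.pi_pos
  have hle : ∀ x ∈ Set.Icc a (a + 2 * Real.pi), f x ≤ K * (x - a) := fun x hx => by
    have h1 := hK₀.dist_le_mul x hx a (Set.left_mem_Icc.2 (by linarith))
    have h2 : f a = 0 := hv0
    rw [h2, Real.dist_eq, sub_zero, Real.dist_eq, abs_of_nonneg (sub_nonneg.2 hx.1)] at h1
    have h3 := le_abs_self (f x)
    have h4 : (K₀ : ℝ) * (x - a) ≤ K * (x - a) :=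
      mul_le_mul_of_nonneg_right (by rw [hKdef]; linarith) (sub_nonneg.2 hx.1)
    linarith
  have hnn : ∀ x, 0 ≤ f x := fun x => (hS x).re_dotProduct_nonneg v
  have hbound : ∀ t : ℝ, 0 < t → Real.log (K * (2 * Real.pi) + t) - Real.log t ≤
      K * (2 * Real.pi * C) := fun t ht => by
    have h1 := hC t ht
    rw [integral_circ_eq _ a] at h1
    have hcont : Continuous fun x : ℝ =>
        ((trig c S (x : Circ) + (t : ℂ) • 1)⁻¹).trace.re := by
      have hq : Continuous fun x : ℝ => trig c S (x : Circ) + (t : ℂ) • 1 :=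
        ((continuous_trig c S).comp (AddCircle.continuous_mk' _)).add continuous_const
      exact Complex.continuous_re.comp
        (continuous_inv_of_posDef hq fun x => posDef_add_smul_one (hS _) ht).matrix_trace
    have h2 : ∫ x in a..a + 2 * Real.pi, (K * (x - a) + t)⁻¹ ≤
        ∫ x in a..a + 2 * Real.pi, ((trig c S (x : Circ) + (t : ℂ) • 1)⁻¹).trace.re := by
      refine intervalIntegral.integral_mono_on (by linarith) ?_ (hcont.intervalIntegrable _ _) ?_
      · refine ContinuousOn.intervalIntegrable (ContinuousOn.inv₀ (by fun_prop) fun x hx => ?_)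
        rw [Set.uIcc_of_le (by linarith)] at hx
        have := mul_nonneg hK.le (sub_nonneg.2 hx.1)
        linarith
      · intro x hx
        have h3 := inv_le_trace_inv (posDef_add_smul_one (hS (x : Circ)) ht) hv
        have h4 : (star v ⬝ᵥ ((trig c S (x : Circ) + (t : ℂ) • 1) *ᵥ v)).re = f x + t := by
          rw [add_mulVec, smul_mulVec, one_mulVec, dotProduct_add, dotProduct_smul, hv]
          simp [hf]
        rw [h4] at h3
        refine le_trans ?_ h3
        exact inv_anti₀ (by linarith [hnn x]) (by linarith [hle x hx])
    rw [integral_inv_affine hK ht] at h2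
    rw [inv_mul_le_iff₀ (by positivity)] at h1
    have h5 := h2.trans h1
    rwa [inv_mul_le_iff₀ hK] at h5
  set B := K * (2 * Real.pi * C) with hB
  have ht : 0 < K * (2 * Real.pi) / Real.exp B := by positivity
  have h1 := hbound _ ht
  rw [← Real.log_div (by positivity) ht.ne', Real.log_le_iff_le_exp (by positivity),
    add_div, div_self ht.ne'] at h1
  have : K * (2 * Real.pi) / (K * (2 * Real.pi) / Real.exp B) = Real.exp B := by
    field_simp
  linarith

end Nonsingular

section Toeplitz

/-- Two finite families of vectors with the same Gram matrix are related by an isometry. -/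
theorem exists_isometry_of_inner_eq {V ι : Type*} [NormedAddCommGroup V] [InnerProductSpace ℝ V]
    [FiniteDimensional ℝ V] [Fintype ι] {u v : ι → V}
    (h : ∀ i j, inner ℝ (u i) (u j) = inner ℝ (v i) (v j)) :
    ∃ U : V →ₗᵢ[ℝ] V, ∀ i, U (u i) = v i := by
  classical
  set f := Fintype.linearCombination ℝ u with hf
  set g := Fintype.linearCombination ℝ v with hg
  have hn : ∀ c, ‖f c‖ = ‖g c‖ := fun c => by
    have : inner ℝ (f c) (f c) = inner ℝ (g c) (g c) := by
      simp only [hf, hg, Fintype.linearCombination_apply, sum_inner, inner_sum, inner_smul_left,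
        inner_smul_right, h]
    rw [real_inner_self_eq_norm_sq, real_inner_self_eq_norm_sq] at this
    exact (sq_eq_sq₀ (norm_nonneg _) (norm_nonneg _)).1 this
  obtain ⟨s, hs⟩ := LinearMap.exists_rightInverse_of_surjective f.rangeRestrict
    f.range_rangeRestrict
  have hs' : ∀ x : LinearMap.range f, f (s x) = x := fun x =>
    congrArg Subtype.val (LinearMap.congr_fun hs x)
  let L : LinearMap.range f →ₗᵢ[ℝ] V :=
    { toLinearMap := g ∘ₗ s
      norm_map' := fun x => by
        rw [LinearMap.comp_apply, ← hn, hs']; rfl }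
  refine ⟨L.extend, fun i => ?_⟩
  have hu : f (Pi.single i 1) = u i := by simp [hf]
  have hv : g (Pi.single i 1) = v i := by simp [hg]
  have e := L.extend_apply ⟨u i, ⟨_, hu⟩⟩
  have h2 := hn (s ⟨u i, ⟨_, hu⟩⟩ - Pi.single i 1)
  rw [map_sub, hs', hu, sub_self, norm_zero, map_sub, hv] at h2
  exact e.trans (sub_eq_zero.1 (norm_eq_zero.1 h2.symm))

variable {m n : ℕ}

theorem toep_shift (R : Fin (n + 1) → Matrix (Fin m) (Fin m) ℝ) (h k : Fin n) (a b : Fin m) :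
    toep R (h.castSucc, a) (k.castSucc, b) = toep R (h.succ, a) (k.succ, b) := by
  have e : ∀ {h k : Fin n}, h ≤ k → k.succ - h.succ = k.castSucc - h.castSucc := fun {h k} hk => by
    apply Fin.ext
    have hk' : (h : ℕ) ≤ k := hk
    rw [Fin.coe_sub_iff_le.2 (Fin.succ_le_succ_iff.2 hk),
      Fin.coe_sub_iff_le.2 (Fin.castSucc_le_castSucc_iff.2 hk)]
    simp
  simp only [toep, Matrix.of_apply, Fin.castSucc_le_castSucc_iff, Fin.succ_le_succ_iff]
  split_ifs with hk
  · rw [e hk]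
  · rw [e (not_le.1 hk).le]

/-- A positive semidefinite block Toeplitz matrix is the covariance of a stationary sequence of
vectors. -/
theorem exists_stationary {R : Fin (n + 1) → Matrix (Fin m) (Fin m) ℝ}
    (hT : (toep R).PosSemidef) : ∃ w : ℕ → Fin m → EuclideanSpace ℝ (BIdx m n),
      ∀ (h : ℕ) (j : Fin (n + 1)) (a b : Fin m), inner ℝ (w h a) (w (h + j) b) = R j a b := by
  obtain ⟨B, hB⟩ := exists_factor_of_posSemidef hT
  let x : BIdx m n → EuclideanSpace ℝ (BIdx m n) := fun p => WithLp.toLp 2 fun i => B i p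
  have hx : ∀ p q, inner ℝ (x p) (x q) = toep R p q := fun p q => by
    rw [hB]
    simp [x, EuclideanSpace.inner_eq_star_dotProduct, Matrix.mul_apply, dotProduct, mul_comm]
  obtain ⟨U, hU⟩ := exists_isometry_of_inner_eq (ι := Fin n × Fin m)
    (u := fun p => x (p.1.castSucc, p.2)) (v := fun p => x (p.1.succ, p.2))
    (fun p q => by rw [hx, hx, toep_shift])
  let w : ℕ → Fin m → EuclideanSpace ℝ (BIdx m n) := fun k a => U^[k] (x (0, a))
  have hw : ∀ (j : Fin (n + 1)) (a : Fin m), w j a = x (j, a) := fun j a => by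
    induction j using Fin.induction with
    | zero => rfl
    | succ i ih =>
      rw [← hU (i, a)]
      simp only [← ih, w, Fin.val_succ, Function.iterate_succ_apply', Fin.val_castSucc]
  have hinv : ∀ (h : ℕ) (y z : EuclideanSpace ℝ (BIdx m n)),
      inner ℝ (U^[h] y) (U^[h] z) = inner ℝ y z := fun h => by
    induction h with
    | zero => intro y z; rfl
    | succ h ih =>
      intro y z
      rw [Function.iterate_succ_apply, Function.iterate_succ_apply, ih, U.inner_map_map]
  refine ⟨w, fun h j a b => ?_⟩
  have e : w (h + j) b = U^[h] (w j b) := Function.iterate_add_apply _ _ _ _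
  rw [e, hinv, hw, hx]
  simp [toep]

theorem continuous_sum_expi {κ : Type*} (s : Finset κ) (e : κ → ℤ) (c : κ → ℂ) :
    Continuous fun θ => ∑ i ∈ s, expi (e i) θ * c i :=
  continuous_finsetSum _ fun _ _ => (continuous_expi _).mul continuous_const

/-- A trigonometric polynomial that is positive semidefinite on the circle pairs nonnegatively
with the block rows of positive semidefinite block Toeplitz matrices. -/
theorem pairing_nonneg {R S : Fin (n + 1) → Matrix (Fin m) (Fin m) ℝ}
    (hT : (toep R).PosSemidef) (hS : ∀ θ, (trig (1 / 2) S θ).PosSemidef) :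
    0 ≤ pairing R S := by
  obtain ⟨w, hw⟩ := exists_stationary hT
  let F : ℕ → Circ → Matrix (Fin m) (Fin m) ℂ := fun N θ => Matrix.of fun a b =>
    ∑ p ∈ Finset.range N ×ˢ Finset.range N,
      expi ((p.1 : ℤ) - p.2) θ * ((inner ℝ (w p.1 a) (w p.2 b) : ℝ) : ℂ)
  have hcont : ∀ N, Continuous (F N) := fun N =>
    continuous_matrix fun a b => continuous_sum_expi _ _ _
  have hpsd : ∀ N θ, (F N θ).PosSemidef := fun N θ => by
    let Z : Matrix (Fin m) (BIdx m n) ℂ := Matrix.of fun a i =>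
      ∑ h ∈ Finset.range N, expi h θ * ((w h a i : ℝ) : ℂ)
    have : F N θ = Z * Zᴴ := by
      ext a b
      simp only [F, Z, Matrix.of_apply, Matrix.mul_apply, conjTranspose_apply, RCLike.star_def,
        map_sum, map_mul, conj_expi, Complex.conj_ofReal, Finset.sum_mul_sum,
        ← Finset.sum_product']
      refine Eq.trans ?_ (Finset.sum_product_right _ _ _).symm
      refine Finset.sum_congr rfl fun p _ => ?_
      rw [EuclideanSpace.inner_eq_star_dotProduct, dotProduct, Complex.ofReal_sum, Finset.mul_sum]
      refine Finset.sum_congr rfl fun i _ => ?_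
      simp only [Pi.star_apply, star_trivial, Complex.ofReal_mul, sub_eq_add_neg, expi_add]
      ring
    rw [this]
    exact posSemidef_self_mul_conjTranspose _
  have hlag : ∀ (N : ℕ) (j : Fin (n + 1)), n ≤ N →
      lag (F N) j = ((N : ℝ) - (j : ℕ)) • toC (R j) := fun N j hN => by
    ext a b
    have e : ∀ θ, expi (j : ℕ) θ * F N θ a b = ∑ p ∈ Finset.range N ×ˢ Finset.range N,
        expi (((j : ℕ) : ℤ) + ((p.1 : ℤ) - p.2)) θ *
          ((inner ℝ (w p.1 a) (w p.2 b) : ℝ) : ℂ) := fun θ => by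
      simp only [F, Matrix.of_apply, Finset.mul_sum, expi_add, mul_assoc]
    rw [lag_apply]
    simp only [e]
    rw [integral_finsetSum _ fun p _ => integrable_expi_mul _ _]
    simp only [integral_mul_const, integral_expi]
    rw [Finset.sum_product]
    have e2 : ∀ h k : ℕ, ((j : ℕ) : ℤ) + ((h : ℤ) - k) = 0 ↔ h + (j : ℕ) = k := fun h k => by omega
    simp only [e2, ite_mul, one_mul, zero_mul, Finset.sum_ite_eq, Finset.mem_range, hw]
    rw [← Finset.sum_filter, Finset.sum_const]
    have e3 : (Finset.range N).filter (fun h => h + (j : ℕ) < N) = Finset.range (N - j) := by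
      ext h; simp only [Finset.mem_filter, Finset.mem_range]; omega
    have hj : (j : ℕ) ≤ N := by have := j.2; omega
    rw [e3, Finset.card_range, Matrix.smul_apply, toC_apply, nsmul_eq_mul, Nat.cast_sub hj]
    simp
  have hmain : ∀ N : ℕ, n ≤ N → 0 ≤ N * pairing R S -
      ∑ j : Fin (n + 1), ((j : ℕ) : ℝ) * ip (toC (R j)) (toC (S j)) := fun N hN => by
    have h1 : 0 ≤ ∫ θ, ip (F N θ) (trig (1 / 2) S θ) ∂circMeasure :=
      integral_nonneg fun θ => ip_nonneg (hpsd N θ) (hS θ)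
    rw [integral_ip_trig (MInt.of_continuous (hcont N)) fun θ => (hpsd N θ).1] at h1
    simp only [hlag N _ hN, ip_smul_left, sub_mul, Finset.sum_sub_distrib, ← Finset.mul_sum] at h1
    exact h1
  by_contra hneg
  push Not at hneg
  set D := ∑ j : Fin (n + 1), ((j : ℕ) : ℝ) * ip (toC (R j)) (toC (S j)) with hD
  obtain ⟨N, hN⟩ := exists_nat_gt (D / pairing R S)
  have h1 := hmain (max n N) (le_max_left _ _)
  have h2 : ((N : ℕ) : ℝ) ≤ (max n N : ℕ) := Nat.cast_le.2 (le_max_right _ _)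
  rw [div_lt_iff_of_neg hneg] at hN
  nlinarith

/-- The block row of the identity. -/
def idRow (m n : ℕ) : Fin (n + 1) → Matrix (Fin m) (Fin m) ℝ := fun j => if j = 0 then 1 else 0

theorem toep_idRow : toep (idRow m n) = 1 := by
  ext ⟨h, a⟩ ⟨k, b⟩
  simp only [toep, Matrix.of_apply, idRow, Matrix.one_apply, Prod.mk.injEq]
  by_cases hhk : h = k
  · subst hhk; simp [Matrix.one_apply]
  · have h1 : ¬ (k - h = 0) := fun h0 => hhk (sub_eq_zero.1 h0).symm
    have h2 : ¬ (h - k = 0) := fun h0 => hhk (sub_eq_zero.1 h0)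
    simp [hhk, h1, h2]

theorem idRow_mem : idRow m n ∈ blockRows m n := by
  simp [blockRows, idRow, Matrix.IsSymm]

theorem pairing_idRow_left (S : Fin (n + 1) → Matrix (Fin m) (Fin m) ℝ) :
    pairing (idRow m n) S = (S 0).trace := by
  rw [pairing, Fin.sum_univ_succ]
  simp only [ip_toC, idRow, Fin.succ_ne_zero, if_false, if_true]
  simp [Matrix.trace, Matrix.one_apply]

theorem pairing_sub_left (R R' S : Fin (n + 1) → Matrix (Fin m) (Fin m) ℝ) :
    pairing (R - R') S = pairing R S - pairing R' S := by
  simp [pairing, toC_sub, ip_sub_left, Finset.sum_sub_distrib]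

theorem pairing_smul_left (c : ℝ) (R S : Fin (n + 1) → Matrix (Fin m) (Fin m) ℝ) :
    pairing (c • R) S = c * pairing R S := by
  simp only [pairing, ip_toC, Finset.mul_sum, Pi.smul_apply, Matrix.smul_apply, smul_eq_mul,
    mul_assoc]

theorem pairing_comm (R S : Fin (n + 1) → Matrix (Fin m) (Fin m) ℝ) :
    pairing R S = pairing S R := by
  simp [pairing, ip_comm]

theorem pairing_add_right (R S S' : Fin (n + 1) → Matrix (Fin m) (Fin m) ℝ) :
    pairing R (S + S') = pairing R S + pairing R S' := by
  simp [pairing, toC_add, ip_add_right, Finset.sum_add_distrib]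

theorem pairing_smul_right (c : ℝ) (R S : Fin (n + 1) → Matrix (Fin m) (Fin m) ℝ) :
    pairing R (c • S) = c * pairing R S := by
  rw [pairing_comm, pairing_smul_left, pairing_comm]

theorem exists_pos_sub_smul_one_posSemidef {ι : Type*} [Fintype ι] [DecidableEq ι]
    {A : Matrix ι ι ℝ} (hA : A.PosDef) : ∃ ε : ℝ, 0 < ε ∧ (A - ε • 1).PosSemidef := by
  have hpos := hA.eigenvalues_pos
  obtain ⟨ε, hε, hle⟩ : ∃ ε : ℝ, 0 < ε ∧ ∀ i, ε ≤ hA.1.eigenvalues i := by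
    rcases isEmpty_or_nonempty ι with h | h
    · exact ⟨1, one_pos, fun i => h.elim i⟩
    · obtain ⟨i, hi⟩ := Finite.exists_min hA.1.eigenvalues
      exact ⟨_, hpos i, hi⟩
  refine ⟨ε, hε, ?_⟩
  have h1 := hA.1.spectral_theorem
  set U := hA.1.eigenvectorUnitary
  have h2 : A - ε • 1 = (U : Matrix ι ι ℝ) *
      Matrix.diagonal (fun i => hA.1.eigenvalues i - ε) * (U : Matrix ι ι ℝ)ᴴ := by
    have hu : (U : Matrix ι ι ℝ) * (U : Matrix ι ι ℝ)ᴴ = 1 := Unitary.coe_mul_star_self U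
    have : Matrix.diagonal (fun i => hA.1.eigenvalues i - ε) =
        Matrix.diagonal (RCLike.ofReal ∘ hA.1.eigenvalues) - ε • (1 : Matrix ι ι ℝ) := by
      ext i j
      by_cases hij : i = j
      · subst hij; simp
      · simp [hij]
    rw [this, mul_sub, sub_mul, Matrix.mul_smul, Matrix.mul_one, Matrix.smul_mul, hu]
    conv_lhs => rw [h1]
    rfl
  rw [h2]
  exact (Matrix.PosSemidef.diagonal fun i => sub_nonneg.2 (hle i)).mul_mul_conjTranspose_same _

/-- Coercivity of the pairing on the cone of nonnegative trigonometric polynomials. -/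
theorem exists_pairing_ge {R : Fin (n + 1) → Matrix (Fin m) (Fin m) ℝ}
    (hT : (toep R).PosDef) : ∃ ε : ℝ, 0 < ε ∧
      ∀ S : Fin (n + 1) → Matrix (Fin m) (Fin m) ℝ, (∀ θ, (trig (1 / 2) S θ).PosSemidef) →
        ε * (S 0).trace ≤ pairing R S := by
  obtain ⟨ε, hε, h⟩ := exists_pos_sub_smul_one_posSemidef hT
  refine ⟨ε, hε, fun S hS => ?_⟩
  have e : toep (R - ε • idRow m n) = toep R - ε • 1 := by
    rw [← toep_idRow]
    ext p q
    simp only [toep, Matrix.of_apply, Matrix.sub_apply, Matrix.smul_apply, Pi.sub_apply,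
      Pi.smul_apply]
    split_ifs <;> rfl
  rw [← e] at h
  have h1 := pairing_nonneg h hS
  rw [pairing_sub_left, pairing_smul_left, pairing_idRow_left] at h1
  linarith

end Toeplitz

section Minimization
variable {m n : ℕ}

theorem trig_add (c : ℝ) (S S' : Fin (n + 1) → Matrix (Fin m) (Fin m) ℝ) (θ : Circ) :
    trig c (S + S') θ = trig c S θ + trig c S' θ := by
  ext a b
  simp only [Matrix.add_apply, trig_apply, Pi.add_apply, Complex.ofReal_add, mul_add,
    Finset.sum_add_distrib]
  ring

theorem trig_smul (c r : ℝ) (S : Fin (n + 1) → Matrix (Fin m) (Fin m) ℝ) (θ : Circ) :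
    trig c (r • S) θ = r • trig c S θ := by
  ext a b
  simp only [Matrix.smul_apply, trig_apply, Pi.smul_apply, Complex.real_smul, smul_eq_mul,
    Complex.ofReal_mul, mul_add, Finset.mul_sum]
  congr 1
  refine Finset.sum_congr rfl fun j _ => ?_
  ring

theorem trig_idRow (c : ℝ) (θ : Circ) : trig c (idRow m n) θ = 1 := by
  ext a b
  by_cases hab : a = b <;> simp [trig_apply, idRow, Matrix.one_apply, hab]

theorem blockRows_add {S S' : Fin (n + 1) → Matrix (Fin m) (Fin m) ℝ}
    (h : S ∈ blockRows m n) (h' : S' ∈ blockRows m n) : S + S' ∈ blockRows m n :=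
  Matrix.IsSymm.add h h'

theorem blockRows_smul (c : ℝ) {S : Fin (n + 1) → Matrix (Fin m) (Fin m) ℝ}
    (h : S ∈ blockRows m n) : c • S ∈ blockRows m n :=
  Matrix.IsSymm.smul h c

theorem integral_trace_trig (S : Fin (n + 1) → Matrix (Fin m) (Fin m) ℝ) :
    ∫ θ, (trig (1 / 2) S θ).trace.re ∂circMeasure = (S 0).trace := by
  rw [← pairing_idRow_left, ← integral_ip_correlogram idRow_mem]
  refine integral_congr_ae (Eventually.of_forall fun θ => ?_)
  simp only [correlogram_eq, trig_idRow]
  rw [ip_comm, ip_one_right]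

theorem abs_apply_le_trace {S : Fin (n + 1) → Matrix (Fin m) (Fin m) ℝ}
    (hS : ∀ θ, (trig (1 / 2) S θ).PosSemidef) (j : Fin (n + 1)) (a b : Fin m) :
    |S j a b| ≤ 2 * (S 0).trace := by
  have hl : ‖lag (trig (1 / 2) S) j a b‖ ≤ (S 0).trace := by
    rw [lag_apply, ← integral_trace_trig]
    have hc := continuous_trig (1 / 2) S
    refine norm_integral_le_of_norm_le (integrable_of_continuous
      (Complex.continuous_re.comp hc.matrix_trace)) (Eventually.of_forall fun θ => ?_)
    rw [norm_mul, norm_expi, one_mul]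
    exact norm_apply_le_trace (hS θ) a b
  have h0 : 0 ≤ (S 0).trace := (norm_nonneg _).trans hl
  have habs : ∀ x : ℝ, ‖(x : ℂ)‖ = |x| := fun x => by rw [Complex.norm_real, Real.norm_eq_abs]
  revert hl
  refine Fin.cases (fun hl => ?_) (fun i hl => ?_) j
  · rw [Fin.val_zero, lag_trig_zero, toC_apply, habs] at hl
    linarith
  · rw [Fin.val_succ, lag_trig_succ, Matrix.smul_apply, toC_apply, smul_eq_mul, norm_mul, habs,
      habs, abs_of_pos (by norm_num : (0 : ℝ) < 1 / 2)] at hl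
    linarith

/-- The value of the identification objective at the trigonometric polynomial with coefficients
`S`. -/
noncomputable def dualVal (R S : Fin (n + 1) → Matrix (Fin m) (Fin m) ℝ) : ℝ :=
  -(∫ θ, Real.log (trig (1 / 2) S θ).det.re ∂circMeasure) + pairing R S

theorem continuous_pairing (R : Fin (n + 1) → Matrix (Fin m) (Fin m) ℝ) :
    Continuous fun S : Fin (n + 1) → Matrix (Fin m) (Fin m) ℝ => pairing R S := by
  simp only [pairing, ip_toC]
  exact continuous_finsetSum _ fun j _ => continuous_finsetSum _ fun a _ =>
    continuous_finsetSum _ fun b _ => continuous_const.mul ((continuous_apply j).matrix_elem a b)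

theorem integrable_log_det {F : Circ → Matrix (Fin m) (Fin m) ℂ} (hF : Continuous F)
    (h : ∀ θ, (F θ).PosDef) : Integrable (fun θ => Real.log (F θ).det.re) circMeasure :=
  integrable_of_continuous (continuous_log_det hF h)

theorem integrable_ip_inv {F A : Circ → Matrix (Fin m) (Fin m) ℂ} (hF : Continuous F)
    (hA : Continuous A) (h : ∀ θ, (F θ).PosDef) :
    Integrable (fun θ => ip (A θ) (F θ)⁻¹) circMeasure :=
  (MInt.of_continuous hA).integrable_ip (continuous_inv_of_posDef hF h)

theorem tendsto_dualVal (R : Fin (n + 1) → Matrix (Fin m) (Fin m) ℝ)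
    {S₀ : Fin (n + 1) → Matrix (Fin m) (Fin m) ℝ} (h₀ : ∀ θ, (trig (1 / 2) S₀ θ).PosDef)
    {L : Filter (Fin (n + 1) → Matrix (Fin m) (Fin m) ℝ)} (hL : L ≤ 𝓝 S₀)
    (hpd : ∀ᶠ S in L, ∀ θ, (trig (1 / 2) S θ).PosDef) :
    Tendsto (dualVal R) L (𝓝 (dualVal R S₀)) := by
  refine Tendsto.add (Tendsto.neg ?_) ((continuous_pairing R).continuousAt.mono_left hL)
  refine tendsto_integral_of_continuousAt (fun θ => ?_) hL
    (hpd.mono fun S hS => integrable_log_det (continuous_trig _ S) hS)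
  exact continuousAt_log_det (M := fun z : (Fin (n + 1) → Matrix (Fin m) (Fin m) ℝ) × Circ =>
    trig (1 / 2) z.1 z.2) (continuous_trig_uncurry _).continuousAt (h₀ θ)

/-- The tangent inequality for the identification objective. -/
theorem dualVal_add_le (R : Fin (n + 1) → Matrix (Fin m) (Fin m) ℝ)
    {S D : Fin (n + 1) → Matrix (Fin m) (Fin m) ℝ} (hS : ∀ θ, (trig (1 / 2) S θ).PosDef)
    (hD : ∀ θ, (trig (1 / 2) (S + D) θ).PosDef) :
    dualVal R (S + D) ≤ dualVal R S + pairing R D -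
      ∫ θ, ip (trig (1 / 2) D θ) (trig (1 / 2) (S + D) θ)⁻¹ ∂circMeasure := by
  have h1 : ∫ θ, Real.log (trig (1 / 2) S θ).det.re ∂circMeasure ≤
      ∫ θ, (Real.log (trig (1 / 2) (S + D) θ).det.re -
        ip (trig (1 / 2) D θ) (trig (1 / 2) (S + D) θ)⁻¹) ∂circMeasure := by
    refine integral_mono (integrable_log_det (continuous_trig _ S) hS)
      ((integrable_log_det (continuous_trig _ _) hD).sub
        (integrable_ip_inv (continuous_trig _ _) (continuous_trig _ _) hD)) fun θ => ?_
    have := log_det_le_tangent (hD θ) (hS θ)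
    have e : ip (trig (1 / 2) S θ - trig (1 / 2) (S + D) θ) (trig (1 / 2) (S + D) θ)⁻¹ =
        -ip (trig (1 / 2) D θ) (trig (1 / 2) (S + D) θ)⁻¹ := by
      rw [ip_sub_left]
      have h2 := ip_add_left (trig (1 / 2) S θ) (trig (1 / 2) D θ) (trig (1 / 2) (S + D) θ)⁻¹
      rw [← trig_add] at h2
      linarith
    rw [e] at this
    simpa [sub_eq_add_neg] using this
  rw [integral_sub (integrable_log_det (continuous_trig _ _) hD)
    (integrable_ip_inv (continuous_trig _ _) (continuous_trig _ _) hD)] at h1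
  rw [dualVal, dualVal, pairing_add_right]
  linarith

theorem posSemidef_of_tendsto {ι τ : Type*} [Fintype ι] {L : Filter τ} [L.NeBot]
    {F : τ → Matrix ι ι ℂ} {A : Matrix ι ι ℂ} (hF : Tendsto F L (𝓝 A))
    (h : ∀ᶠ x in L, (F x).PosSemidef) : A.PosSemidef := by
  have hH : A.IsHermitian := by
    have h1 : Tendsto (fun x => (F x)ᴴ) L (𝓝 Aᴴ) :=
      (continuous_id.matrix_conjTranspose.tendsto A).comp hF
    exact tendsto_nhds_unique (h1.congr' (h.mono fun x hx => hx.1.eq)) hF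
  refine Matrix.PosSemidef.of_dotProduct_mulVec_nonneg hH fun v => ?_
  refine Complex.le_def.2 ⟨?_, (hH.im_star_dotProduct_mulVec_self v).symm⟩
  have hc : Continuous fun M : Matrix ι ι ℂ => (star v ⬝ᵥ (M *ᵥ v)).re :=
    Complex.continuous_re.comp (continuous_const.dotProduct
      (continuous_id.matrix_mulVec continuous_const))
  exact ge_of_tendsto ((hc.tendsto A).comp hF) (h.mono fun x hx => hx.re_dotProduct_nonneg v)

theorem continuousAt_ip {X ι κ : Type*} [TopologicalSpace X] [Fintype ι] [Fintype κ]
    {F A : X → Matrix ι κ ℂ} {x : X} (hF : ContinuousAt F x) (hA : ContinuousAt A x) :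
    ContinuousAt (fun x => ip (F x) (A x)) x := by
  have h := (continuous_ip (ι := ι) (κ := κ)).tendsto (F x, A x)
  have h2 := h.comp (Filter.Tendsto.prodMk_nhds hF hA)
  exact h2

/-- First order optimality condition in a feasible direction. -/
theorem integral_ip_inv_le_of_minimal {R S₀ D : Fin (n + 1) → Matrix (Fin m) (Fin m) ℝ}
    {C : Set (Fin (n + 1) → Matrix (Fin m) (Fin m) ℝ)} (hC : C ⊆ blockRows m n)
    (h₀ : ∀ θ, (trig (1 / 2) S₀ θ).PosDef)
    (hmin : ∀ S ∈ C, (∀ θ, (trig (1 / 2) S θ).PosDef) → dualVal R S₀ ≤ dualVal R S)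
    (hD : ∀ s : ℝ, 0 < s → s < 1 → S₀ + s • D ∈ C) :
    ∫ θ, ip (trig (1 / 2) D θ) (trig (1 / 2) S₀ θ)⁻¹ ∂circMeasure ≤ pairing R D := by
  have hcont : Continuous fun z : ℝ × Circ => trig (1 / 2) (S₀ + z.1 • D) z.2 :=
    (continuous_trig_uncurry (1 / 2)).comp
      ((continuous_const.add (continuous_fst.smul continuous_const)).prodMk continuous_snd)
  have hpd0 := eventually_posDef (M := fun (s : ℝ) θ => trig (1 / 2) (S₀ + s • D) θ) (x₀ := 0)
    hcont (by simpa using h₀)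
  have hIoo : ∀ᶠ s : ℝ in 𝓝[>] 0, 0 < s ∧ s < 1 := Ioo_mem_nhdsGT one_pos
  have hpd : ∀ᶠ s : ℝ in 𝓝[>] 0, ∀ θ, (trig (1 / 2) (S₀ + s • D) θ).PosDef := by
    filter_upwards [hpd0.filter_mono nhdsWithin_le_nhds, hIoo] with s hs h01 θ
    exact hs θ (trig_isHermitian _ (hC (hD s h01.1 h01.2)) θ)
  have hlim := tendsto_integral_of_continuousAt (X := ℝ) (x₀ := 0) (L := 𝓝[>] 0)
    (F := fun s θ => ip (trig (1 / 2) D θ) (trig (1 / 2) (S₀ + s • D) θ)⁻¹)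
    (fun θ => by
      have h1 : ContinuousAt (fun z : ℝ × Circ => (trig (1 / 2) (S₀ + z.1 • D) z.2)⁻¹) (0, θ) :=
        continuousAt_inv_of_posDef hcont.continuousAt (by simpa using h₀ θ)
      have h2 : ContinuousAt (fun z : ℝ × Circ => trig (1 / 2) D z.2) (0, θ) :=
        ((continuous_trig _ D).comp continuous_snd).continuousAt
      exact continuousAt_ip h2 h1)
    nhdsWithin_le_nhds
    (hpd.mono fun s hs => integrable_ip_inv (continuous_trig _ _) (continuous_trig _ _) hs)
  simp only [zero_smul, add_zero] at hlim
  refine le_of_tendsto hlim ?_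
  filter_upwards [hpd, hIoo] with s hs h01
  have h1 := dualVal_add_le R h₀ hs
  have h2 := hmin _ (hD s h01.1 h01.2) hs
  simp only [trig_smul, ip_smul_left] at h1
  rw [integral_const_mul, pairing_smul_right] at h1
  have h3 : 0 ≤ s * (pairing R D -
      ∫ θ, ip (trig (1 / 2) D θ) (trig (1 / 2) (S₀ + s • D) θ)⁻¹ ∂circMeasure) := by linarith
  have h4 := nonneg_of_mul_nonneg_right h3 h01.1
  linarith

theorem exists_dualVal_ge {R : Fin (n + 1) → Matrix (Fin m) (Fin m) ℝ}
    (hT : (toep R).PosDef) : ∃ ε c : ℝ, 0 < ε ∧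
      ∀ S : Fin (n + 1) → Matrix (Fin m) (Fin m) ℝ, (∀ θ, (trig (1 / 2) S θ).PosDef) →
        ε * (S 0).trace + c ≤ dualVal R S := by
  obtain ⟨ε, hε, h⟩ := exists_pairing_ge hT
  set A : Matrix (Fin m) (Fin m) ℂ := ((ε / 2 : ℝ) : ℂ) • 1 with hA
  have hApd : A.PosDef := Matrix.PosDef.one.smul (Complex.zero_lt_real.2 (half_pos hε))
  refine ⟨ε / 2, Real.log A.det.re + m, half_pos hε, fun S hS => ?_⟩
  have h1 := h S fun θ => (hS θ).posSemidef
  have hc := continuous_trig (1 / 2) S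
  have hti : Integrable (fun θ => (trig (1 / 2) S θ).trace.re) circMeasure :=
    integrable_of_continuous (Complex.continuous_re.comp hc.matrix_trace)
  have h2 : ∫ θ, Real.log (trig (1 / 2) S θ).det.re ∂circMeasure ≤
      ∫ θ, (ε / 2 * (trig (1 / 2) S θ).trace.re - (Real.log A.det.re + m)) ∂circMeasure := by
    refine integral_mono (integrable_log_det hc hS)
      ((hti.const_mul _).sub (integrable_const _)) fun θ => ?_
    have h3 := log_det_sub_ip_le hApd (hS θ)
    rw [hA, Complex.coe_smul, ip_smul_right, ip_one_right, Fintype.card_fin, ← Complex.coe_smul,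
      ← hA] at h3
    simp only
    linarith
  rw [integral_sub (hti.const_mul _) (integrable_const _), integral_const_mul,
    integral_trace_trig, integral_const, probReal_univ, one_smul] at h2
  rw [dualVal]
  linarith

/-- Existence of a nonsingular minimizer on a closed convex cone of trigonometric polynomials. -/
theorem exists_minimizer {R : Fin (n + 1) → Matrix (Fin m) (Fin m) ℝ} (hT : (toep R).PosDef)
    {C : Set (Fin (n + 1) → Matrix (Fin m) (Fin m) ℝ)}
    (hcl : IsClosed C) (hadd : ∀ S ∈ C, ∀ S' ∈ C, S + S' ∈ C)
    (hsmul : ∀ c : ℝ, 0 ≤ c → ∀ S ∈ C, c • S ∈ C) (hid : idRow m n ∈ C) :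
    ∃ S₀ ∈ C, (∀ θ, (trig (1 / 2) S₀ θ).PosDef) ∧
      (∀ S ∈ C, (∀ θ, (trig (1 / 2) S θ).PosDef) → dualVal R S₀ ≤ dualVal R S) := by
  obtain ⟨ε, c, hε, hlow⟩ := exists_dualVal_ge hT
  set D := {S | S ∈ C ∧ ∀ θ, (trig (1 / 2) S θ).PosDef} with hD
  have hidD : idRow m n ∈ D := ⟨hid, fun θ => by rw [trig_idRow]; exact Matrix.PosDef.one⟩
  have hne : (dualVal R '' D).Nonempty := ⟨_, _, hidD, rfl⟩
  have hbdd : BddBelow (dualVal R '' D) := by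
    refine ⟨c, ?_⟩
    rintro _ ⟨S, hS, rfl⟩
    have h1 := hlow S hS.2
    have h2 : 0 ≤ (S 0).trace := by
      rw [← integral_trace_trig]
      exact integral_nonneg fun θ => (Complex.le_def.1 (hS.2 θ).posSemidef.trace_nonneg).1
    have := mul_nonneg hε.le h2
    linarith
  set J := sInf (dualVal R '' D) with hJ
  have hJle : ∀ S ∈ D, J ≤ dualVal R S := fun S hS => csInf_le hbdd ⟨S, hS, rfl⟩
  obtain ⟨u, -, hu, huD⟩ := exists_seq_tendsto_sInf hne hbdd
  choose S hSD hSu using huD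
  have hlim : Tendsto (fun k => dualVal R (S k)) atTop (𝓝 J) := by simpa only [hSu] using hu
  set M := (J + 1 - c) / ε with hM
  have hev : ∀ᶠ k in atTop, (S k 0).trace ≤ M := by
    filter_upwards [hlim.eventually (gt_mem_nhds (lt_add_one J))] with k hk
    rw [hM, le_div_iff₀ hε]
    have := hlow (S k) (hSD k).2
    linarith
  set B : Set (Fin (n + 1) → Matrix (Fin m) (Fin m) ℝ) :=
    Set.univ.pi fun _ => (Set.Icc (-(2 * M)) (2 * M)).matrix with hB
  have hBc : IsCompact B := isCompact_univ_pi fun _ => isCompact_Icc.matrix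
  let U : Ultrafilter ℕ := hyperfilter ℕ
  have hUat : (U : Filter ℕ) ≤ atTop := Nat.hyperfilter_le_atTop
  have hUB : ↑(U.map S) ≤ 𝓟 (B ∩ C) := by
    rw [le_principal_iff, Ultrafilter.coe_map, Filter.mem_map]
    refine hUat (hev.mono fun k hk => ⟨fun j _ a b => ?_, (hSD k).1⟩)
    have := abs_apply_le_trace (fun θ => ((hSD k).2 θ).posSemidef) j a b
    exact abs_le.1 (this.trans (by linarith))
  obtain ⟨S₀, hS₀, hconv⟩ := (hBc.inter_right hcl).ultrafilter_le_nhds _ hUB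
  have hS₀C : S₀ ∈ C := hS₀.2
  have hconv' : Tendsto S U (𝓝 S₀) := hconv
  have hlimU : Tendsto (fun k => dualVal R (S k)) U (𝓝 J) := hlim.mono_left hUat
  have hpsd : ∀ θ, (trig (1 / 2) S₀ θ).PosSemidef := fun θ => by
    have h1 : Continuous fun S : Fin (n + 1) → Matrix (Fin m) (Fin m) ℝ => trig (1 / 2) S θ :=
      (continuous_trig_uncurry _).comp (Continuous.prodMk_left θ)
    exact posSemidef_of_tendsto ((h1.tendsto S₀).comp hconv')
      (Eventually.of_forall fun k => ((hSD k).2 θ).posSemidef)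
  have hshift : ∀ (S : Fin (n + 1) → Matrix (Fin m) (Fin m) ℝ) (t : ℝ) (θ : Circ),
      trig (1 / 2) (S + t • idRow m n) θ = trig (1 / 2) S θ + (t : ℂ) • 1 := fun S t θ => by
    rw [trig_add, trig_smul, trig_idRow, Complex.coe_smul]
  have hpd₀ : ∀ θ, (trig (1 / 2) S₀ θ).PosDef := by
    refine posDef_of_integral_trace_inv_le (C := pairing R (idRow m n)) hpsd fun t ht => ?_
    have hpdk : ∀ S, (∀ θ, (trig (1 / 2) S θ).PosSemidef) → ∀ θ,
        (trig (1 / 2) (S + t • idRow m n) θ).PosDef := fun S hS θ => by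
      rw [hshift]; exact posDef_add_smul_one (hS θ) ht
    have hct : Continuous fun z : (Fin (n + 1) → Matrix (Fin m) (Fin m) ℝ) × Circ =>
        trig (1 / 2) (z.1 + t • idRow m n) z.2 :=
      (continuous_trig_uncurry _).comp
        ((continuous_fst.add continuous_const).prodMk continuous_snd)
    have hint := tendsto_integral_of_continuousAt (x₀ := S₀) (L := (U : Filter ℕ).map S)
      (F := fun S θ => ((trig (1 / 2) (S + t • idRow m n) θ)⁻¹).trace.re)
      (fun θ => by
        have h1 := continuousAt_inv_of_posDef (x₀ := (S₀, θ)) hct.continuousAt (hpdk S₀ hpsd θ)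
        have h2 : Continuous fun M : Matrix (Fin m) (Fin m) ℂ => M.trace.re :=
          Complex.continuous_re.comp continuous_id.matrix_trace
        exact ContinuousAt.comp (g := fun M : Matrix (Fin m) (Fin m) ℂ => M.trace.re)
          h2.continuousAt h1)
      hconv (Filter.eventually_map.2 (Eventually.of_forall fun k => by
        have h1 := continuous_inv_of_posDef (continuous_trig (1 / 2) (S k + t • idRow m n))
          (hpdk (S k) fun θ => ((hSD k).2 θ).posSemidef)
        exact integrable_of_continuous (Complex.continuous_re.comp h1.matrix_trace)))
    have hint' := (tendsto_map'_iff.1 hint)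
    have hrhs : Tendsto (fun k => (dualVal R (S k) - J) / t + pairing R (idRow m n)) U
        (𝓝 ((J - J) / t + pairing R (idRow m n))) :=
      ((hlimU.sub_const J).div_const t).add_const _
    rw [sub_self, zero_div, zero_add] at hrhs
    simp only [hshift] at hint'
    refine le_of_tendsto_of_tendsto hint' hrhs (Eventually.of_forall fun k => ?_)
    have hk := hpdk (S k) fun θ => ((hSD k).2 θ).posSemidef
    have h1 := dualVal_add_le R (hSD k).2 hk
    have h2 := hJle _ ⟨hadd _ (hSD k).1 _ (hsmul t ht.le _ hid), hk⟩
    simp only [trig_smul, trig_idRow, ip_smul_left, pairing_smul_right, hshift,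
      integral_const_mul] at h1
    simp only [ip_comm 1, ip_one_right] at h1
    simp only [Function.comp]
    rw [← sub_le_iff_le_add, le_div_iff₀ ht]
    linarith
  refine ⟨S₀, hS₀C, hpd₀, fun S' hS' hpd' => ?_⟩
  have h1 := tendsto_dualVal R hpd₀ hconv
    (Filter.eventually_map.2 (Eventually.of_forall fun k => (hSD k).2))
  have h2 : dualVal R S₀ = J := tendsto_nhds_unique (tendsto_map'_iff.1 h1) hlimU
  rw [h2]
  exact hJle _ ⟨hS', hpd'⟩

end Minimization

section Parametrization
variable {m n l : ℕ}

theorem sum_Icc_neg {M : Type*} [AddCommMonoid M] (f : ℤ → M) (n : ℕ) :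
    ∑ j ∈ Finset.Icc (-(n : ℤ)) n, f j =
      f 0 + ∑ i : Fin n, (f ((i : ℕ) + 1) + f (-((i : ℕ) + 1))) := by
  induction n with
  | zero => simp
  | succ n ih =>
    have h1 : Finset.Icc (-((n + 1 : ℕ) : ℤ)) ((n + 1 : ℕ) : ℤ) =
        insert ((n : ℤ) + 1) (insert (-((n : ℤ) + 1)) (Finset.Icc (-(n : ℤ)) n)) := by
      ext x; simp only [Finset.mem_Icc, Finset.mem_insert, Nat.cast_add, Nat.cast_one]; omega
    rw [h1, Finset.sum_insert, Finset.sum_insert, ih, Fin.sum_univ_castSucc]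
    · simp only [Fin.val_castSucc, Fin.val_last]
      rw [← add_assoc, add_comm, add_assoc]
    · simp only [Finset.mem_Icc]; omega
    · simp only [Finset.mem_insert, Finset.mem_Icc]; omega

/-- The block row of a two-sided sequence of coefficients. -/
def foldRow (n : ℕ) (R : ℤ → Matrix (Fin m) (Fin m) ℝ) :
    Fin (n + 1) → Matrix (Fin m) (Fin m) ℝ :=
  fun j => if j = 0 then R 0 else (2 : ℝ) • R (j : ℕ)

theorem pseudoPoly_eq_trig {R : ℤ → Matrix (Fin m) (Fin m) ℝ} (hR : ∀ j, R (-j) = (R j)ᵀ)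
    (θ : Circ) : ∑ j ∈ Finset.Icc (-(n : ℤ)) n, expi (-j) θ • toC (R j) =
      trig (1 / 2) (foldRow n R) θ := by
  ext a b
  rw [sum_Icc_neg, trig_apply]
  simp only [foldRow, if_true, Fin.succ_ne_zero, if_false, neg_zero, expi_zero, one_smul,
    Matrix.add_apply, Matrix.sum_apply, Matrix.smul_apply, toC_apply, hR, transpose_apply,
    neg_neg, Fin.val_succ, smul_eq_mul, Complex.ofReal_mul, Finset.mul_sum, Nat.cast_add,
    Nat.cast_one]
  congr 1
  refine Finset.sum_congr rfl fun i _ => ?_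
  push_cast
  ring

theorem foldRow_mem {R : ℤ → Matrix (Fin m) (Fin m) ℝ} (hR : ∀ j, R (-j) = (R j)ᵀ) :
    foldRow n R ∈ blockRows m n := by
  have := hR 0
  simp only [neg_zero] at this
  simpa [blockRows, foldRow, Matrix.IsSymm] using this.symm

theorem exists_foldRow_eq {S : Fin (n + 1) → Matrix (Fin m) (Fin m) ℝ} (hS : S ∈ blockRows m n) :
    ∃ R : ℤ → Matrix (Fin m) (Fin m) ℝ, (∀ j, R (-j) = (R j)ᵀ) ∧ foldRow n R = S := by
  let e : ℤ → Matrix (Fin m) (Fin m) ℝ := fun j => S (Fin.ofNat (n + 1) j.natAbs)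
  refine ⟨fun j => if j = 0 then S 0 else if 0 < j then (1 / 2 : ℝ) • e j else
    (1 / 2 : ℝ) • (e j)ᵀ, fun j => ?_, ?_⟩
  · have he : e (-j) = e j := by simp [e]
    rcases lt_trichotomy j 0 with h | h | h
    · have h1 : ¬ j = 0 := h.ne
      have h2 : ¬ 0 < j := h.le.not_gt
      have h3 : 0 < -j := by omega
      simp [h1, h2, he, h]
    · subst h
      have h0 : (S 0)ᵀ = S 0 := hS
      simp [h0]
    · have h1 : ¬ j = 0 := h.ne'
      have h2 : ¬ j < 0 := h.le.not_gt
      simp [h1, h2, he, h]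
  · funext j
    by_cases hj : j = 0
    · simp [foldRow, hj]
    · have h1 : (0 : ℤ) < (j : ℕ) := by
        have : (j : ℕ) ≠ 0 := fun h => hj (Fin.ext h)
        omega
      have h2 : Fin.ofNat (n + 1) (j : ℕ) = j := Fin.ext (Nat.mod_eq_of_lt j.2)
      simp only [foldRow, hj, if_false, h1.ne', h1, if_true, e, Int.natAbs_natCast, h2, smul_smul]
      norm_num

theorem mem_pseudoPoly_iff {P : Circ → Matrix (Fin m) (Fin m) ℂ} :
    P ∈ pseudoPoly m n ↔ ∃ S ∈ blockRows m n, P = trig (1 / 2) S := by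
  constructor
  · rintro ⟨R, hR, rfl⟩
    exact ⟨_, foldRow_mem hR, funext fun θ => pseudoPoly_eq_trig hR θ⟩
  · rintro ⟨S, hS, rfl⟩
    obtain ⟨R, hR, rfl⟩ := exists_foldRow_eq hS
    exact ⟨R, hR, funext fun θ => (pseudoPoly_eq_trig hR θ).symm⟩

theorem proj_transpose {E : Set (Fin m × Fin m)} (hE : ∀ k h, (k, h) ∈ E → (h, k) ∈ E)
    (X : Matrix (Fin m) (Fin m) ℝ) : (proj E X)ᵀ = proj E Xᵀ := by
  classical
  ext a b
  have : (b, a) ∈ E ↔ (a, b) ∈ E := ⟨hE b a, hE a b⟩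
  simp [proj_apply, this]

theorem proj_mem_blockRows {E : Set (Fin m × Fin m)} (hE : ∀ k h, (k, h) ∈ E → (h, k) ∈ E)
    {S : Fin (n + 1) → Matrix (Fin m) (Fin m) ℝ} (hS : S ∈ blockRows m n) :
    (fun j => proj E (S j)) ∈ blockRows m n := by
  have h0 : (S 0)ᵀ = S 0 := hS
  simp only [blockRows, Set.mem_ofPred_eq, Matrix.IsSymm]
  rw [proj_transpose hE, h0]

theorem sigmaOf_apply {E : Set (Fin m × Fin m)} (hE : ∀ k h, (k, h) ∈ E → (h, k) ∈ E)
    (S : Fin (n + 1) → Matrix (Fin m) (Fin m) ℝ) (θ : Circ) :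
    sigmaOf E S θ = proj E (trig (1 / 2) S θ) := by
  classical
  ext a b
  have : (b, a) ∈ E ↔ (a, b) ∈ E := ⟨hE b a, hE a b⟩
  rw [sigmaOf_eq, trig_apply, proj_apply]
  simp only [proj_apply, this]
  split_ifs
  · rw [trig_apply]
  · simp

theorem proj_compl_eq_zero_iff {E : Set (Fin m × Fin m)} (X : Matrix (Fin m) (Fin m) ℂ) :
    proj Eᶜ X = 0 ↔ proj E X = X := by
  classical
  rw [← Matrix.ext_iff, ← Matrix.ext_iff]
  refine forall_congr' fun a => forall_congr' fun b => ?_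
  simp only [proj_apply, Set.mem_compl_iff, Matrix.zero_apply]
  by_cases h : (a, b) ∈ E
  · simp [h]
  · simp [h, eq_comm]

theorem proj_proj {K : Type*} [Zero K] (E : Set (Fin m × Fin m)) (X : Matrix (Fin m) (Fin m) K) :
    proj E (proj E X) = proj E X := by
  classical
  ext a b
  simp only [proj_apply]
  split_ifs <;> rfl

theorem VE_eq {E : Set (Fin m × Fin m)} (hE : ∀ k h, (k, h) ∈ E → (h, k) ∈ E) :
    VE n E = sigmaOf E '' blockRows m n := by
  ext P
  constructor
  · rintro ⟨hP, h0⟩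
    obtain ⟨S, hS, rfl⟩ := mem_pseudoPoly_iff.1 hP
    refine ⟨S, hS, funext fun θ => ?_⟩
    rw [sigmaOf_apply hE]
    exact (proj_compl_eq_zero_iff _).1 (h0 θ)
  · rintro ⟨S, hS, rfl⟩
    refine ⟨mem_pseudoPoly_iff.2 ⟨_, proj_mem_blockRows hE hS, sigmaOf_eq E S⟩, fun θ => ?_⟩
    rw [sigmaOf_apply hE, proj_compl_eq_zero_iff, proj_proj]

theorem image_pairOf {E : Set (Fin m × Fin m)} (hE : ∀ k h, (k, h) ∈ E → (h, k) ∈ E)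
    (G : Matrix (Fin l) (BIdx m n) ℝ) :
    pairOf E G '' multipliers m n l = VE n E ×ˢ VGpos G := by
  rw [VE_eq hE]
  ext ⟨P, Q⟩
  constructor
  · rintro ⟨p, ⟨h1, h2⟩, h⟩
    obtain ⟨rfl, rfl⟩ := Prod.mk.inj h
    exact ⟨⟨_, h1, rfl⟩, _, h2, rfl⟩
  · rintro ⟨⟨S, hS, rfl⟩, H, hH, rfl⟩
    exact ⟨(S, H), ⟨hS, hH⟩, rfl⟩

/-- The block row of `Δ X Δ*`. -/
def gramRow (X : Matrix (BIdx m n) (BIdx m n) ℝ) : Fin (n + 1) → Matrix (Fin m) (Fin m) ℝ :=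
  foldRow n fun j => Matrix.of fun a b => ∑ p : Fin (n + 1) × Fin (n + 1),
    if ((p.2 : ℕ) : ℤ) - (p.1 : ℕ) = j then X (p.1, a) (p.2, b) else 0

theorem gramRow_symm {X : Matrix (BIdx m n) (BIdx m n) ℝ} (hX : X.IsSymm) (j : ℤ) :
    (Matrix.of fun a b => ∑ p : Fin (n + 1) × Fin (n + 1),
      if ((p.2 : ℕ) : ℤ) - (p.1 : ℕ) = -j then X (p.1, a) (p.2, b) else 0) =
    (Matrix.of fun a b => ∑ p : Fin (n + 1) × Fin (n + 1),
      if ((p.2 : ℕ) : ℤ) - (p.1 : ℕ) = j then X (p.1, a) (p.2, b) else 0 :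
        Matrix (Fin m) (Fin m) ℝ)ᵀ := by
  ext a b
  simp only [Matrix.of_apply, transpose_apply]
  refine Fintype.sum_equiv (Equiv.prodComm _ _) _ _ fun p => ?_
  have h1 : (((p.2 : ℕ) : ℤ) - (p.1 : ℕ) = -j) ↔ (((p.1 : ℕ) : ℤ) - (p.2 : ℕ) = j) := by omega
  simp only [Equiv.prodComm_apply, Prod.fst_swap, Prod.snd_swap, h1, hX.apply]

theorem gramRow_mem {X : Matrix (BIdx m n) (BIdx m n) ℝ} (hX : X.IsSymm) :
    gramRow X ∈ blockRows m n := foldRow_mem (gramRow_symm hX)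

theorem shift_mul_eq_trig {X : Matrix (BIdx m n) (BIdx m n) ℝ} (hX : X.IsSymm) (θ : Circ) :
    shift m n θ * toC X * (shift m n θ)ᴴ = trig (1 / 2) (gramRow X) θ := by
  rw [gramRow, ← pseudoPoly_eq_trig (gramRow_symm hX)]
  ext a b
  simp only [Matrix.sum_apply, Matrix.smul_apply, toC_apply, Matrix.of_apply, smul_eq_mul,
    Complex.ofReal_sum, Finset.mul_sum]
  rw [Finset.sum_comm]
  have h1 : ∀ p : Fin (n + 1) × Fin (n + 1), ∑ j ∈ Finset.Icc (-(n : ℤ)) n, expi (-j) θ *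
      (((if ((p.2 : ℕ) : ℤ) - (p.1 : ℕ) = j then X (p.1, a) (p.2, b) else 0 : ℝ)) : ℂ) =
      expi (p.1 : ℕ) θ * X (p.1, a) (p.2, b) * expi (-((p.2 : ℕ) : ℤ)) θ := fun p => by
    have hmem : ((p.2 : ℕ) : ℤ) - (p.1 : ℕ) ∈ Finset.Icc (-(n : ℤ)) n := by
      have := p.1.2; have := p.2.2
      simp only [Finset.mem_Icc]; omega
    rw [Finset.sum_eq_single_of_mem _ hmem fun j _ hj => by simp [Ne.symm hj]]
    rw [if_pos rfl, neg_sub, sub_eq_add_neg, expi_add]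
    ring
  rw [Finset.sum_congr rfl fun p _ => h1 p, ← Finset.univ_product_univ, Finset.sum_product_right]
  simp only [Matrix.mul_apply, conjTranspose_apply, shift, Matrix.of_apply,
    Fintype.sum_prod_type, ite_mul, zero_mul, Finset.sum_ite_eq, Finset.mem_univ, if_true,
    apply_ite star, star_zero, mul_ite, mul_zero, RCLike.star_def, conj_expi, toC_apply,
    Finset.sum_mul]

theorem gramRow_add (X Y : Matrix (BIdx m n) (BIdx m n) ℝ) :
    gramRow (X + Y) = gramRow X + gramRow Y := by
  funext j; ext a b
  by_cases hj : j = 0 <;>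
  simp [gramRow, foldRow, hj, ← mul_add, ← Finset.sum_add_distrib, ite_add_ite]

theorem gramRow_smul (c : ℝ) (X : Matrix (BIdx m n) (BIdx m n) ℝ) :
    gramRow (c • X) = c • gramRow X := by
  funext j; ext a b
  by_cases hj : j = 0 <;>
  simp [gramRow, foldRow, hj, Finset.mul_sum, mul_left_comm]

theorem continuous_gramRow : Continuous (gramRow (m := m) (n := n)) := by
  refine continuous_pi fun j => continuous_matrix fun a b => ?_
  have h : ∀ k : ℤ, Continuous fun X : Matrix (BIdx m n) (BIdx m n) ℝ =>
      ∑ p : Fin (n + 1) × Fin (n + 1),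
        if ((p.2 : ℕ) : ℤ) - (p.1 : ℕ) = k then X (p.1, a) (p.2, b) else 0 := fun k => by
    refine continuous_finsetSum _ fun p _ => ?_
    split_ifs
    · exact continuous_id.matrix_elem _ _
    · exact continuous_const
  by_cases hj : j = 0
  · simp only [gramRow, foldRow, hj, if_true, Matrix.of_apply]
    exact h 0
  · simp only [gramRow, foldRow, hj, if_false, Matrix.of_apply, Matrix.smul_apply]
    exact (h _).const_smul (2 : ℝ)

theorem trace_gramRow (X : Matrix (BIdx m n) (BIdx m n) ℝ) :
    (gramRow X 0).trace = X.trace := by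
  simp only [gramRow, foldRow, if_true, Matrix.trace, diag_apply, Matrix.of_apply,
    Fintype.sum_prod_type]
  rw [Finset.sum_comm]
  refine Finset.sum_congr rfl fun h _ => Finset.sum_congr rfl fun a _ => ?_
  have h1 : ∀ k : Fin (n + 1), (((k : ℕ) : ℤ) - (h : ℕ) = 0) ↔ h = k := fun k => by
    rw [Fin.ext_iff]; omega
  simp [h1]

/-- The coefficients of `Σ - Λ` at the multipliers `(S, H)`. -/
noncomputable def coeffs (E : Set (Fin m × Fin m)) (G : Matrix (Fin l) (BIdx m n) ℝ)
    (p : (Fin (n + 1) → Matrix (Fin m) (Fin m) ℝ) × Matrix (Fin l) (Fin l) ℝ) :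
    Fin (n + 1) → Matrix (Fin m) (Fin m) ℝ :=
  (fun j => proj E (p.1 j)) - gramRow (Gᵀ * p.2 * G)

theorem posSemidef_isSymm {ι : Type*} {X : Matrix ι ι ℝ} (hX : X.PosSemidef) : X.IsSymm := by
  have h := hX.1
  rwa [Matrix.IsHermitian, conjTranspose_eq_transpose_of_trivial] at h

theorem posSemidef_congr {ι κ : Type*} [Fintype ι] [Fintype κ] {H : Matrix ι ι ℝ}
    (hH : H.PosSemidef) (G : Matrix ι κ ℝ) : (Gᵀ * H * G).PosSemidef := by
  have := hH.conjTranspose_mul_mul_same G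
  rwa [conjTranspose_eq_transpose_of_trivial] at this

theorem gram_eq_trig (G : Matrix (Fin l) (BIdx m n) ℝ) {H : Matrix (Fin l) (Fin l) ℝ}
    (hH : H.PosSemidef) : gram G H = trig (1 / 2) (gramRow (Gᵀ * H * G)) :=
  funext fun θ => shift_mul_eq_trig (posSemidef_isSymm (posSemidef_congr hH G)) θ

theorem trig_sub (c : ℝ) (S S' : Fin (n + 1) → Matrix (Fin m) (Fin m) ℝ) (θ : Circ) :
    trig c (S - S') θ = trig c S θ - trig c S' θ := by
  rw [eq_sub_iff_add_eq, ← trig_add, sub_add_cancel]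

variable {E : Set (Fin m × Fin m)} {G : Matrix (Fin l) (BIdx m n) ℝ}
  {p q : (Fin (n + 1) → Matrix (Fin m) (Fin m) ℝ) × Matrix (Fin l) (Fin l) ℝ}

theorem pairOf_sub (hp : p ∈ multipliers m n l) (θ : Circ) :
    (pairOf E G p).1 θ - (pairOf E G p).2 θ = trig (1 / 2) (coeffs E G p) θ := by
  rw [coeffs, trig_sub, pairOf, sigmaOf_eq, gram_eq_trig G hp.2]

theorem coeffs_mem (hE : ∀ k h, (k, h) ∈ E → (h, k) ∈ E) (hp : p ∈ multipliers m n l) :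
    coeffs E G p ∈ blockRows m n :=
  Matrix.IsSymm.sub (proj_mem_blockRows hE hp.1)
    (gramRow_mem (posSemidef_isSymm (posSemidef_congr hp.2 G)))

theorem proj_add (E : Set (Fin m × Fin m)) (X Y : Matrix (Fin m) (Fin m) ℝ) :
    proj E (X + Y) = proj E X + proj E Y := by
  classical
  ext a b; simp only [proj_apply, Matrix.add_apply]; split_ifs <;> simp

theorem proj_smul (E : Set (Fin m × Fin m)) (c : ℝ) (X : Matrix (Fin m) (Fin m) ℝ) :
    proj E (c • X) = c • proj E X := by
  classical
  ext a b; simp only [proj_apply, Matrix.smul_apply]; split_ifs <;> simp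

theorem coeffs_add : coeffs E G (p + q) = coeffs E G p + coeffs E G q := by
  have h : (fun j => proj E ((p + q).1 j)) = (fun j => proj E (p.1 j)) + fun j => proj E (q.1 j) :=
    funext fun j => proj_add _ _ _
  rw [coeffs, h, Prod.snd_add, Matrix.mul_add, Matrix.add_mul, gramRow_add, coeffs, coeffs]
  abel

theorem coeffs_smul (c : ℝ) : coeffs E G (c • p) = c • coeffs E G p := by
  have h : (fun j => proj E ((c • p).1 j)) = c • fun j => proj E (p.1 j) :=
    funext fun j => proj_smul _ _ _
  rw [coeffs, h, Prod.smul_snd, Matrix.mul_smul, Matrix.smul_mul, gramRow_smul, coeffs, smul_sub]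

theorem multipliers_add (hp : p ∈ multipliers m n l) (hq : q ∈ multipliers m n l) :
    p + q ∈ multipliers m n l := ⟨blockRows_add hp.1 hq.1, hp.2.add hq.2⟩

theorem multipliers_smul {c : ℝ} (hc : 0 ≤ c) (hp : p ∈ multipliers m n l) :
    c • p ∈ multipliers m n l := ⟨blockRows_smul c hp.1, hp.2.smul hc⟩

theorem idRow_zero_mem : ((idRow m n, 0) :
    (Fin (n + 1) → Matrix (Fin m) (Fin m) ℝ) × Matrix (Fin l) (Fin l) ℝ) ∈ multipliers m n l :=
  ⟨idRow_mem, Matrix.PosSemidef.zero⟩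

theorem coeffs_of_zero (S : Fin (n + 1) → Matrix (Fin m) (Fin m) ℝ) :
    coeffs E G (S, 0) = fun j => proj E (S j) := by
  have h : gramRow (0 : Matrix (BIdx m n) (BIdx m n) ℝ) = 0 := by
    have := gramRow_smul (0 : ℝ) (0 : Matrix (BIdx m n) (BIdx m n) ℝ)
    simpa using this
  simp [coeffs, h]

theorem coeffs_idRow (hE : ∀ k, (k, k) ∈ E) : coeffs E G (idRow m n, 0) = idRow m n := by
  classical
  rw [coeffs_of_zero]
  funext j; ext a b
  rw [proj_apply]
  by_cases hab : a = b
  · subst hab; simp [hE]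
  · by_cases hj : j = 0 <;> simp [idRow, hj, hab]

/-- Every real matrix has a generalized inverse. -/
theorem exists_generalized_inverse {ι κ : Type*} [Fintype ι] [Fintype κ] [DecidableEq ι]
    [DecidableEq κ] (A : Matrix ι κ ℝ) : ∃ B : Matrix κ ι ℝ, A * B * A = A := by
  set f := Matrix.toLin' A with hf
  obtain ⟨s, hs⟩ := LinearMap.exists_rightInverse_of_surjective f.rangeRestrict
    f.range_rangeRestrict
  obtain ⟨π, hπ⟩ := LinearMap.exists_leftInverse_of_injective (LinearMap.range f).subtype
    (LinearMap.range f).ker_subtype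
  refine ⟨LinearMap.toMatrix' (s ∘ₗ π), ?_⟩
  apply Matrix.toLin'.injective
  rw [Matrix.toLin'_mul, Matrix.toLin'_mul, Matrix.toLin'_toMatrix', ← hf]
  ext1 i
  ext1
  simp only [LinearMap.comp_apply]
  have h1 : ∀ y : LinearMap.range f, π y = y := fun y => LinearMap.congr_fun hπ y
  have h2 : ∀ y : LinearMap.range f, f (s y) = y := fun y =>
    congrArg Subtype.val (LinearMap.congr_fun hs y)
  have h3 := h1 ⟨_, LinearMap.mem_range_self f (LinearMap.single ℝ (fun _ => ℝ) i 1)⟩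
  simp only at h3
  rw [h3, h2]

end Parametrization

section Closedness
variable {m n l : ℕ} {E : Set (Fin m × Fin m)} {G : Matrix (Fin l) (BIdx m n) ℝ}

theorem posSemidef_toC {ι : Type*} [Fintype ι] {X : Matrix ι ι ℝ} (hX : X.PosSemidef) :
    (toC X).PosSemidef := by
  obtain ⟨B, rfl⟩ := exists_factor_of_posSemidef hX
  rw [conjTranspose_eq_transpose_of_trivial, toC_mul, ← toC_conjTranspose]
  exact posSemidef_conjTranspose_mul_self _

theorem abs_apply_le_trace_of_posSemidef {ι : Type*} [Fintype ι] {X : Matrix ι ι ℝ}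
    (hX : X.PosSemidef) (a b : ι) : |X a b| ≤ X.trace := by
  obtain ⟨B, rfl⟩ := exists_factor_of_posSemidef hX
  simp only [Matrix.trace, diag_apply, Matrix.mul_apply, conjTranspose_apply, star_trivial]
  have hle : ∀ c, ∑ k, B k c * B k c ≤ ∑ i, ∑ k, B k i * B k i := fun c =>
    Finset.single_le_sum (f := fun i => ∑ k, B k i * B k i)
      (fun i _ => Finset.sum_nonneg fun k _ => mul_self_nonneg _) (Finset.mem_univ c)
  have h1 : |∑ k, B k a * B k b| ≤ ∑ k, |B k a| * |B k b| :=
    (Finset.abs_sum_le_sum_abs _ _).trans (Finset.sum_le_sum fun k _ => (abs_mul _ _).le)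
  have h2 : ∑ k, |B k a| * |B k b| ≤ (∑ k, B k a * B k a + ∑ k, B k b * B k b) / 2 := by
    rw [← Finset.sum_add_distrib, Finset.sum_div]
    exact Finset.sum_le_sum fun k _ => by
      nlinarith [sq_nonneg (|B k a| - |B k b|), abs_mul_abs_self (B k a), abs_mul_abs_self (B k b)]
  have h3 := hle a
  have h4 := hle b
  linarith

theorem isClosed_posSemidef {ι : Type*} [Fintype ι] :
    IsClosed {X : Matrix ι ι ℝ | X.PosSemidef} := by
  have e : {X : Matrix ι ι ℝ | X.PosSemidef} =
      {X | Xᴴ = X} ∩ ⋂ v : ι → ℝ, {X | 0 ≤ star v ⬝ᵥ (X *ᵥ v)} := by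
    ext X
    simp only [Matrix.posSemidef_iff_dotProduct_mulVec, Matrix.IsHermitian, Set.mem_inter_iff,
      Set.mem_iInter, Set.mem_ofPred_eq]
  rw [e]
  refine (isClosed_eq continuous_id.matrix_conjTranspose continuous_id).inter
    (isClosed_iInter fun v => isClosed_le continuous_const ?_)
  exact continuous_const.dotProduct (continuous_id.matrix_mulVec continuous_const)

theorem exists_posSemidef_factor_iff {X : Matrix (BIdx m n) (BIdx m n) ℝ}
    {B : Matrix (BIdx m n) (Fin l) ℝ} (hB : G * B * G = G) :
    (∃ H : Matrix (Fin l) (Fin l) ℝ, H.PosSemidef ∧ Gᵀ * H * G = X) ↔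
      X.PosSemidef ∧ (B * G)ᵀ * X * (B * G) = X := by
  constructor
  · rintro ⟨H, hH, rfl⟩
    refine ⟨posSemidef_congr hH G, ?_⟩
    have h1 : (B * G)ᵀ * Gᵀ = Gᵀ := by
      rw [← transpose_mul, ← Matrix.mul_assoc, hB]
    calc (B * G)ᵀ * (Gᵀ * H * G) * (B * G) = ((B * G)ᵀ * Gᵀ) * H * (G * B * G) := by
          simp only [Matrix.mul_assoc]
      _ = Gᵀ * H * G := by rw [h1, hB]
  · rintro ⟨hX, h⟩
    refine ⟨Bᵀ * X * B, posSemidef_congr hX B, ?_⟩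
    rw [transpose_mul] at h
    simpa only [Matrix.mul_assoc] using h

theorem isClosed_factorable (G : Matrix (Fin l) (BIdx m n) ℝ) :
    IsClosed {X | ∃ H : Matrix (Fin l) (Fin l) ℝ, H.PosSemidef ∧ Gᵀ * H * G = X} := by
  obtain ⟨B, hB⟩ := exists_generalized_inverse G
  simp only [exists_posSemidef_factor_iff hB]
  refine isClosed_posSemidef.inter (isClosed_eq ?_ continuous_id)
  exact (continuous_const.matrix_mul continuous_id).matrix_mul continuous_const

theorem continuous_proj (E : Set (Fin m × Fin m)) :
    Continuous fun X : Matrix (Fin m) (Fin m) ℝ => proj E X := by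
  classical
  refine continuous_matrix fun a b => ?_
  simp only [proj_apply]
  split_ifs
  · exact continuous_id.matrix_elem a b
  · exact continuous_const

theorem isClosed_blockRows : IsClosed (blockRows m n) :=
  isClosed_eq ((continuous_apply _).matrix_transpose) (continuous_apply _)

/-- If `V_E` meets the nonnegative cone of `V_G` only in `0`, the cone of coefficients of
`Σ - Λ` is closed. -/
theorem mem_coeffs_image_of_mem_closure (hE : ∀ k h, (k, h) ∈ E → (h, k) ∈ E)
    (h0 : ∀ L ∈ VE n E ∩ VGpos G, L = 0) {S₀ : Fin (n + 1) → Matrix (Fin m) (Fin m) ℝ}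
    (hS₀ : S₀ ∈ closure (coeffs E G '' multipliers m n l)) :
    S₀ ∈ coeffs E G '' multipliers m n l := by
  obtain ⟨U, hKU, hU⟩ := mem_closure_iff_ultrafilter.1 hS₀
  have hex : ∀ S : Fin (n + 1) → Matrix (Fin m) (Fin m) ℝ, ∃ p : _ × Matrix (Fin l) (Fin l) ℝ,
      p ∈ multipliers m n l ∧ (S ∈ coeffs E G '' multipliers m n l → coeffs E G p = S) := fun S => by
    by_cases hS : S ∈ coeffs E G '' multipliers m n l
    · obtain ⟨p, hp, rfl⟩ := hS
      exact ⟨p, hp, fun _ => rfl⟩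
    · exact ⟨_, idRow_zero_mem, fun h => (hS h).elim⟩
  choose p hp hpS using hex
  let X : (Fin (n + 1) → Matrix (Fin m) (Fin m) ℝ) → Matrix (BIdx m n) (BIdx m n) ℝ :=
    fun S => Gᵀ * (p S).2 * G
  have hX : ∀ S, (X S).PosSemidef := fun S => posSemidef_congr (hp S).2 G
  let ρ : (Fin (n + 1) → Matrix (Fin m) (Fin m) ℝ) → ℝ := fun S => (1 + (X S).trace)⁻¹
  have htr : ∀ S, 0 ≤ (X S).trace := fun S => (hX S).trace_nonneg
  have hρ0 : ∀ S, 0 < ρ S := fun S => inv_pos.2 (by linarith [htr S])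
  have hρ1 : ∀ S, ρ S * (X S).trace = 1 - ρ S := fun S => by
    have : (1 + (X S).trace) ≠ 0 := by linarith [htr S]
    simp only [ρ]; field_simp; ring
  let f : (Fin (n + 1) → Matrix (Fin m) (Fin m) ℝ) → ℝ × Matrix (BIdx m n) (BIdx m n) ℝ :=
    fun S => (ρ S, ρ S • X S)
  have hcomp : IsCompact (Set.Icc (0 : ℝ) 1 ×ˢ
      ((Set.Icc (-1 : ℝ) 1).matrix : Set (Matrix (BIdx m n) (BIdx m n) ℝ))) :=
    isCompact_Icc.prod isCompact_Icc.matrix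
  have hfU : ↑(U.map f) ≤ 𝓟 (Set.Icc (0 : ℝ) 1 ×ˢ
      ((Set.Icc (-1 : ℝ) 1).matrix : Set (Matrix (BIdx m n) (BIdx m n) ℝ))) := by
    rw [le_principal_iff, Ultrafilter.coe_map, Filter.mem_map]
    refine Filter.univ_mem' fun S => ?_
    have hle : ρ S * (X S).trace ≤ 1 := by rw [hρ1]; linarith [hρ0 S]
    refine ⟨⟨(hρ0 S).le, ?_⟩, fun i j => ?_⟩
    · have := mul_nonneg (hρ0 S).le (htr S)
      rw [hρ1] at this
      simpa [f] using this
    · have h1 := abs_apply_le_trace_of_posSemidef (hX S) i j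
      refine abs_le.1 ?_
      simp only [f, Matrix.smul_apply, smul_eq_mul, abs_mul, abs_of_pos (hρ0 S)]
      exact (mul_le_mul_of_nonneg_left h1 (hρ0 S).le).trans hle
  obtain ⟨⟨r, Z⟩, hrZ, hconv⟩ := hcomp.ultrafilter_le_nhds _ hfU
  have hf : Tendsto f U (𝓝 (r, Z)) := hconv
  have hr : Tendsto ρ U (𝓝 r) := (continuous_fst.tendsto (r, Z)).comp hf
  have hZ : Tendsto (fun S => ρ S • X S) U (𝓝 Z) := (continuous_snd.tendsto (r, Z)).comp hf
  have hr0 : 0 ≤ r := hrZ.1.1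
  have hZmem : ∃ H : Matrix (Fin l) (Fin l) ℝ, H.PosSemidef ∧ Gᵀ * H * G = Z :=
    (isClosed_factorable G).mem_of_tendsto hZ (Eventually.of_forall fun S =>
      ⟨ρ S • (p S).2, (hp S).2.smul (hρ0 S).le, by
        simp only [X, Matrix.mul_smul, Matrix.smul_mul]⟩)
  have hZtr : Z.trace = 1 - r := by
    have h1 : Tendsto (fun S => (ρ S • X S).trace) U (𝓝 Z.trace) :=
      ((continuous_id.matrix_trace).tendsto Z).comp hZ
    refine tendsto_nhds_unique h1 ((hr.const_sub 1).congr fun S => ?_)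
    rw [trace_smul, smul_eq_mul, hρ1]
  obtain ⟨H, hH, rfl⟩ := hZmem
  set Y : Fin (n + 1) → Matrix (Fin m) (Fin m) ℝ := r • S₀ + gramRow (Gᵀ * H * G) with hY
  have hid : Tendsto (fun S => S) (U : Filter _) (𝓝 S₀) := hU
  have hYlim : Tendsto (fun S => ρ S • S + gramRow (ρ S • X S)) U (𝓝 Y) :=
    (hr.smul hid).add ((continuous_gramRow.tendsto _).comp hZ)
  have hYeq : ∀ᶠ S in (U : Filter _), ρ S • S + gramRow (ρ S • X S) =
      ρ S • fun j => proj E ((p S).1 j) := by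
    filter_upwards [hKU] with S hS
    have := hpS S hS
    rw [gramRow_smul, ← smul_add]
    congr 1
    exact (sub_eq_iff_eq_add.1 this).symm
  have hYmem : Y ∈ blockRows m n ∩ {Y | (fun j => proj E (Y j)) = Y} := by
    refine IsClosed.mem_of_tendsto (isClosed_blockRows.inter (isClosed_eq ?_ continuous_id)) hYlim
      (hYeq.mono fun S hS => ?_)
    · exact continuous_pi fun j => (continuous_proj E).comp (continuous_apply j)
    · rw [hS]
      refine ⟨blockRows_smul _ (proj_mem_blockRows hE (hp S).1), funext fun j => ?_⟩
      simp only [Pi.smul_apply, proj_smul, proj_proj]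
  have hYproj : (fun j => proj E (Y j)) = Y := hYmem.2
  rcases hr0.eq_or_lt with h | h
  · exfalso
    rw [← h, zero_smul, zero_add] at hY
    have e : gram G H = sigmaOf E Y := by
      rw [sigmaOf_eq, hYproj, hY, gram_eq_trig G hH]
    have hz := h0 (gram G H) ⟨by rw [VE_eq hE]; exact ⟨Y, hYmem.1, e.symm⟩, H, hH, rfl⟩
    rw [gram_eq_trig G hH] at hz
    have h1 := integral_trace_trig (gramRow (Gᵀ * H * G))
    rw [hz, trace_gramRow, hZtr, ← h] at h1
    simp at h1
  · refine ⟨r⁻¹ • (Y, H), multipliers_smul (inv_pos.2 h).le ⟨hYmem.1, hH⟩, ?_⟩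
    rw [coeffs_smul, coeffs]
    simp only [hYproj]
    rw [hY, add_sub_cancel_right, smul_smul, inv_mul_cancel₀ h.ne', one_smul]

end Closedness

section Primal
variable {m n l : ℕ} {E : Set (Fin m × Fin m)} {G : Matrix (Fin l) (BIdx m n) ℝ}
  {R : Fin (n + 1) → Matrix (Fin m) (Fin m) ℝ} {Φ Ψ : Circ → Matrix (Fin m) (Fin m) ℂ}
  {p : (Fin (n + 1) → Matrix (Fin m) (Fin m) ℝ) × Matrix (Fin l) (Fin l) ℝ}

/-- Conjugation symmetry, which characterizes real Fourier coefficients. -/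
def ConjSymm {α β : Type*} (F : Circ → Matrix α β ℂ) : Prop :=
  ∀ θ a b, F (-θ) a b = (starRingEnd ℂ) (F θ a b)

theorem expi_neg_arg (j : ℤ) (θ : Circ) : expi j (-θ) = (starRingEnd ℂ) (expi j θ) := by
  rw [conj_expi]
  simp [expi, fourier_apply]

theorem conjSymm_trig (c : ℝ) (S : Fin (n + 1) → Matrix (Fin m) (Fin m) ℝ) :
    ConjSymm (trig c S) := fun θ a b => by
  simp only [trig_apply, expi_neg_arg, map_add, map_mul, map_sum, Complex.conj_ofReal]

theorem conjSymm_shift : ConjSymm (shift m n) := fun θ a q => by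
  simp only [shift, Matrix.of_apply, expi_neg_arg]
  split_ifs <;> simp

theorem conjSymm_toC {α β : Type*} (X : Matrix α β ℝ) : ConjSymm fun _ => toC X := fun θ a b => by
  simp [toC_apply]

theorem ConjSymm.mul {α β γ : Type*} [Fintype β] {F : Circ → Matrix α β ℂ}
    {F' : Circ → Matrix β γ ℂ} (h : ConjSymm F) (h' : ConjSymm F') :
    ConjSymm fun θ => F θ * F' θ := fun θ a b => by
  simp only [Matrix.mul_apply, h θ, h' θ, map_sum, map_mul]

theorem ConjSymm.conjTranspose {α β : Type*} {F : Circ → Matrix α β ℂ} (h : ConjSymm F) :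
    ConjSymm fun θ => (F θ)ᴴ := fun θ a b => by
  simp only [conjTranspose_apply, h θ, RCLike.star_def]

theorem ConjSymm.inv {F : Circ → Matrix (Fin m) (Fin m) ℂ} (h : ConjSymm F) :
    ConjSymm fun θ => (F θ)⁻¹ := fun θ a b => by
  have h1 : F (-θ) = ((F θ)ᴴ)ᵀ := by
    ext a b; simp [h θ]
  change (F (-θ))⁻¹ a b = (starRingEnd ℂ) ((F θ)⁻¹ a b)
  rw [h1, ← transpose_nonsing_inv, ← conjTranspose_nonsing_inv]
  simp

theorem ConjSymm.exists_matInt_eq {α β : Type*} {F : Circ → Matrix α β ℂ} (h : ConjSymm F) :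
    ∃ B : Matrix α β ℝ, matInt F = toC B := by
  refine ⟨(matInt F).map Complex.re, ?_⟩
  ext a b
  rw [toC_apply, Matrix.map_apply]
  refine (Complex.conj_eq_iff_re.1 ?_).symm
  simp only [matInt, Matrix.of_apply]
  rw [← integral_conj]
  simp only [← h _ a b]
  exact integral_neg_eq_self (fun θ => F θ a b) circMeasure

theorem matInt_isHermitian {ι : Type*} {F : Circ → Matrix ι ι ℂ} (h : ∀ θ, (F θ).IsHermitian) :
    (matInt F).IsHermitian := by
  ext a b
  simp only [conjTranspose_apply, matInt, Matrix.of_apply, RCLike.star_def]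
  rw [← integral_conj]
  exact integral_congr_ae (Eventually.of_forall fun θ => congrFun (congrFun (h θ).eq a) b)

theorem toep_isSymm {R : Fin (n + 1) → Matrix (Fin m) (Fin m) ℝ} (hT : (toep R).PosDef) :
    (toep R)ᵀ = toep R := posSemidef_isSymm hT.posSemidef

theorem lagrangian_coeffs (hR : R ∈ blockRows m n) (hΦ : Φ ∈ specDens m)
    (hp : p ∈ multipliers m n l) : lagrangian E G R Φ p.1 p.2 = entropy Φ -
      ∫ θ, ip (Φ θ) (trig (1 / 2) (coeffs E G p) θ) ∂circMeasure +
      pairing R (coeffs E G p) := by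
  rw [lagrangian_eq E G hR (specDens_mInt hΦ) hΦ.2.1, ← integral_ip_correlogram hR]
  have := fun θ => pairOf_sub (E := E) (G := G) hp θ
  simp only [pairOf] at this
  simp only [this]

theorem gap_identity (hR : R ∈ blockRows m n) (hΦ : Φ ∈ specDens m)
    (hp : p ∈ multipliers m n l) :
    ∑ j, ip (lagGap E R Φ j) (toC (p.1 j)) - ip (covGap G R Φ) (toC p.2) =
      ∫ θ, ip (Φ θ) (trig (1 / 2) (coeffs E G p) θ) ∂circMeasure -
        pairing R (coeffs E G p) := by
  have := lagrangian_coeffs (E := E) (G := G) hR hΦ hp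
  rw [lagrangian] at this
  linarith

theorem integral_ip_le_pairing (hR : R ∈ blockRows m n) (hΦ : Φ ∈ primalFeasible E G R)
    (hp : p ∈ multipliers m n l) :
    ∫ θ, ip (Φ θ) (trig (1 / 2) (coeffs E G p) θ) ∂circMeasure ≤ pairing R (coeffs E G p) := by
  have h := gap_identity (E := E) (G := G) hR hΦ.1 hp
  have h1 := ip_nonneg hΦ.2.2 (posSemidef_toC hp.2)
  simp only [hΦ.2.1, ip_zero_left, Finset.sum_const_zero] at h
  linarith

theorem entropy_le_lagrangian (hR : R ∈ blockRows m n) (hΦ : Φ ∈ primalFeasible E G R)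
    (hp : p ∈ multipliers m n l) : entropy Φ ≤ lagrangian E G R Φ p.1 p.2 := by
  rw [lagrangian_coeffs hR hΦ.1 hp]
  have := integral_ip_le_pairing hR hΦ hp
  linarith

theorem toC_injective {α β : Type*} : Function.Injective (toC : Matrix α β ℝ → Matrix α β ℂ) :=
  fun X Y h => by
    ext a b
    exact Complex.ofReal_injective (congrFun (congrFun h a) b)

theorem proj_toC (E : Set (Fin m × Fin m)) (X : Matrix (Fin m) (Fin m) ℝ) :
    proj E (toC X) = toC (proj E X) := by
  classical
  ext a b; simp only [proj_apply, toC_apply]; split_ifs <;> simp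

/-- A real spectral density satisfying the dual inequalities is feasible. -/
theorem primalFeasible_of_integral_ip_le (hE : ∀ k h, (k, h) ∈ E → (h, k) ∈ E)
    (hR : R ∈ blockRows m n) (hT : (toep R).PosDef) (hΦ : Φ ∈ specDens m) (hs : ConjSymm Φ)
    (h : ∀ p ∈ multipliers m n l,
      ∫ θ, ip (Φ θ) (trig (1 / 2) (coeffs E G p) θ) ∂circMeasure ≤ pairing R (coeffs E G p)) :
    Φ ∈ primalFeasible E G R := by
  have hgap : ∀ p ∈ multipliers m n l,
      ∑ j, ip (lagGap E R Φ j) (toC (p.1 j)) ≤ ip (covGap G R Φ) (toC p.2) := fun p hp => by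
    have h1 := gap_identity (E := E) (G := G) hR hΦ hp
    have h2 := h p hp
    linarith
  have hlag : ∀ j : ℕ, ∃ B : Matrix (Fin m) (Fin m) ℝ, lag Φ j = toC B := fun j =>
    ConjSymm.exists_matInt_eq fun θ a b => by
      simp only [Matrix.smul_apply, smul_eq_mul, map_mul, hs θ, expi_neg_arg]
  choose B hB using hlag
  have hB0 : (B 0)ᵀ = B 0 := by
    apply toC_injective
    rw [← toC_conjTranspose, ← hB 0]
    exact matInt_isHermitian fun θ => by simpa using hΦ.2.1 θ
  set A : Fin (n + 1) → Matrix (Fin m) (Fin m) ℝ := fun j => proj E (B j - R j) with hA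
  have hlagGap : ∀ j, lagGap E R Φ j = toC (A j) := fun j => by
    rw [lagGap, hB, ← toC_sub, proj_toC]
  have hAmem : A ∈ blockRows m n := by
    have : (B ((0 : Fin (n + 1)) : ℕ) - R 0)ᵀ = B ((0 : Fin (n + 1)) : ℕ) - R 0 := by
      rw [transpose_sub, Fin.val_zero, hB0, show (R 0)ᵀ = R 0 from hR]
    simp only [blockRows, Set.mem_ofPred_eq, hA, Matrix.IsSymm]
    rw [proj_transpose hE, this]
  refine ⟨hΦ, fun j => ?_, ?_⟩
  · have h1 := hgap (A, 0) ⟨hAmem, Matrix.PosSemidef.zero⟩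
    have h2 : toC (0 : Matrix (Fin l) (Fin l) ℝ) = 0 := by ext; simp [toC_apply]
    simp only [h2, ip_zero_right, hlagGap] at h1
    have h3 := (Finset.sum_eq_zero_iff_of_nonneg fun j _ => ip_self_nonneg (toC (A j))).1
      (le_antisymm h1 (Finset.sum_nonneg fun j _ => ip_self_nonneg _)) j (Finset.mem_univ _)
    rw [hlagGap]
    exact eq_zero_of_ip_self _ h3
  · have hcs : ConjSymm fun θ => toC G * (shift m n θ)ᴴ * Φ θ * shift m n θ * (toC G)ᵀ :=
      ((((conjSymm_toC G).mul conjSymm_shift.conjTranspose).mul hs).mul conjSymm_shift).mul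
        (conjSymm_toC Gᵀ)
    obtain ⟨D, hD⟩ := hcs.exists_matInt_eq
    have hDs : Dᵀ = D := by
      apply toC_injective
      rw [← toC_conjTranspose, ← hD]
      refine matInt_isHermitian fun θ => ?_
      have := isHermitian_mul_mul_conjTranspose (toC G * (shift m n θ)ᴴ) (hΦ.2.1 θ)
      rw [conjTranspose_mul, conjTranspose_conjTranspose, toC_conjTranspose] at this
      simpa only [Matrix.mul_assoc, toC_transpose] using this
    set C := D - G * toep R * Gᵀ with hC
    have hcov : covGap G R Φ = toC C := by rw [covGap, hD, hC, toC_sub]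
    have hCs : C.IsHermitian := by
      rw [Matrix.IsHermitian, conjTranspose_eq_transpose_of_trivial, hC, transpose_sub, hDs,
        transpose_mul, transpose_mul, transpose_transpose, toep_isSymm hT, Matrix.mul_assoc]
    rw [hcov]
    refine posSemidef_toC (Matrix.PosSemidef.of_dotProduct_mulVec_nonneg hCs fun x => ?_)
    have hxx : (vecMulVec x (star x)).PosSemidef := posSemidef_vecMulVec_self_star x
    have h1 := hgap (0, vecMulVec x (star x)) ⟨by simp [blockRows, Matrix.IsSymm], hxx⟩
    have h2 : toC (0 : Matrix (Fin m) (Fin m) ℝ) = 0 := by ext; simp [toC_apply]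
    simp only [Pi.zero_apply, h2, ip_zero_right, Finset.sum_const_zero, hcov, ip_toC] at h1
    refine h1.trans (le_of_eq ?_)
    simp only [vecMulVec_apply, dotProduct, mulVec, Finset.mul_sum, Pi.star_apply, star_trivial]
    refine Finset.sum_congr rfl fun a _ => Finset.sum_congr rfl fun b _ => ?_
    ring

/-- The integrated Gibbs inequality. -/
theorem entropy_sub_integral_ip_le {T : Circ → Matrix (Fin m) (Fin m) ℂ} (hT : Continuous T)
    (hpd : ∀ θ, (T θ).PosDef) (hΦ : Φ ∈ specDens m) :
    entropy Φ - ∫ θ, ip (Φ θ) (T θ) ∂circMeasure ≤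
      -(∫ θ, Real.log (T θ).det.re ∂circMeasure) - m := by
  have h1 := specDens_integrable_log_det hΦ
  have h2 := (specDens_mInt hΦ).integrable_ip hT
  have h3 : Integrable (fun θ => -Real.log (T θ).det.re) circMeasure :=
    (integrable_log_det hT hpd).neg
  have h : ∫ θ, (Real.log (Φ θ).det.re - ip (Φ θ) (T θ)) ∂circMeasure ≤
      ∫ θ, (-Real.log (T θ).det.re - (m : ℝ)) ∂circMeasure := by
    refine integral_mono (h1.sub h2) (h3.sub (integrable_const _)) fun θ => ?_
    have := log_det_sub_ip_le (hpd θ) (specDens_posDef hΦ θ)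
    simpa using this
  rw [integral_sub h1 h2, integral_sub h3 (integrable_const _), integral_neg,
    integral_const, probReal_univ, one_smul] at h
  exact h

theorem ae_eq_inv_of_entropy_eq {T : Circ → Matrix (Fin m) (Fin m) ℂ} (hT : Continuous T)
    (hpd : ∀ θ, (T θ).PosDef) (hΦ : Φ ∈ specDens m)
    (h : -(∫ θ, Real.log (T θ).det.re ∂circMeasure) - m ≤
      entropy Φ - ∫ θ, ip (Φ θ) (T θ) ∂circMeasure) :
    ∀ᵐ θ ∂circMeasure, Φ θ = (T θ)⁻¹ := by
  have h1 := specDens_integrable_log_det hΦ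
  have h2 := (specDens_mInt hΦ).integrable_ip hT
  have h3 : Integrable (fun θ => -Real.log (T θ).det.re) circMeasure :=
    (integrable_log_det hT hpd).neg
  set f : Circ → ℝ := fun θ => (-Real.log (T θ).det.re - (m : ℝ)) -
    (Real.log (Φ θ).det.re - ip (Φ θ) (T θ)) with hf
  have hi1 : Integrable (fun θ => -Real.log (T θ).det.re - (m : ℝ)) circMeasure :=
    h3.sub (integrable_const _)
  have hi2 : Integrable (fun θ => Real.log (Φ θ).det.re - ip (Φ θ) (T θ)) circMeasure :=
    h1.sub h2
  have hnn : 0 ≤ f := fun θ => by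
    have := log_det_sub_ip_le (hpd θ) (specDens_posDef hΦ θ)
    rw [Fintype.card_fin] at this
    exact sub_nonneg.2 this
  have hint : ∫ θ, f θ ∂circMeasure ≤ 0 := by
    rw [hf, integral_sub hi1 hi2, integral_sub h1 h2,
      integral_sub h3 (integrable_const _), integral_neg, integral_const, probReal_univ,
      one_smul]
    rw [entropy] at h
    linarith
  have hz := (integral_eq_zero_iff_of_nonneg hnn (hi1.sub hi2)).1
    (le_antisymm hint (integral_nonneg hnn))
  filter_upwards [hz] with θ hθ
  refine eq_inv_of_log_det_sub_ip_eq (hpd θ) (specDens_posDef hΦ θ) ?_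
  rw [Fintype.card_fin]
  exact (sub_eq_zero.1 hθ).symm

theorem inv_mem_specDens {T : Circ → Matrix (Fin m) (Fin m) ℂ} (hT : Continuous T)
    (hpd : ∀ θ, (T θ).PosDef) : (fun θ => (T θ)⁻¹) ∈ specDens m :=
  specDens_of_continuous (continuous_inv_of_posDef hT hpd) fun θ => (hpd θ).inv

theorem entropy_inv {T : Circ → Matrix (Fin m) (Fin m) ℂ} (hpd : ∀ θ, (T θ).PosDef) :
    entropy (fun θ => (T θ)⁻¹) = -(∫ θ, Real.log (T θ).det.re ∂circMeasure) := by
  rw [entropy, ← integral_neg]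
  exact integral_congr_ae (Eventually.of_forall fun θ => log_det_inv (hpd θ))

theorem integral_ip_inv_self {T : Circ → Matrix (Fin m) (Fin m) ℂ} (hpd : ∀ θ, (T θ).PosDef) :
    ∫ θ, ip (T θ)⁻¹ (T θ) ∂circMeasure = m := by
  simp only [ip_inv_self (hpd _)]
  simp

theorem lagrangian_inv (hR : R ∈ blockRows m n) (hp : p ∈ multipliers m n l)
    (hpd : ∀ θ, (trig (1 / 2) (coeffs E G p) θ).PosDef) :
    lagrangian E G R (fun θ => (trig (1 / 2) (coeffs E G p) θ)⁻¹) p.1 p.2 =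
      dualVal R (coeffs E G p) - m := by
  rw [lagrangian_coeffs hR (inv_mem_specDens (continuous_trig _ _) hpd) hp, entropy_inv hpd,
    integral_ip_inv_self hpd, dualVal]
  ring

theorem lagrangian_le (hR : R ∈ blockRows m n) (hp : p ∈ multipliers m n l)
    (hpd : ∀ θ, (trig (1 / 2) (coeffs E G p) θ).PosDef) (hΦ : Φ ∈ specDens m) :
    lagrangian E G R Φ p.1 p.2 ≤ dualVal R (coeffs E G p) - m := by
  rw [lagrangian_coeffs hR hΦ hp, dualVal]
  have := entropy_sub_integral_ip_le (continuous_trig _ _) hpd hΦ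
  linarith

theorem le_dualFun (hΦ : Φ ∈ specDens m) :
    ((lagrangian E G R Φ p.1 p.2 : ℝ) : EReal) ≤ dualFun E G R p :=
  le_iSup₂_of_le Φ hΦ le_rfl

theorem dualFun_eq (hR : R ∈ blockRows m n) (hp : p ∈ multipliers m n l)
    (hpd : ∀ θ, (trig (1 / 2) (coeffs E G p) θ).PosDef) :
    dualFun E G R p = ((dualVal R (coeffs E G p) - m : ℝ) : EReal) := by
  refine le_antisymm (iSup₂_le fun Φ hΦ => EReal.coe_le_coe (lagrangian_le hR hp hpd hΦ)) ?_
  rw [← lagrangian_inv hR hp hpd]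
  exact le_dualFun (inv_mem_specDens (continuous_trig _ _) hpd)

theorem ae_eq_of_lagrangian_ge (hR : R ∈ blockRows m n) (hp : p ∈ multipliers m n l)
    (hpd : ∀ θ, (trig (1 / 2) (coeffs E G p) θ).PosDef) (hΦ : Φ ∈ specDens m)
    (h : dualVal R (coeffs E G p) - m ≤ lagrangian E G R Φ p.1 p.2) :
    ∀ᵐ θ ∂circMeasure, Φ θ = (trig (1 / 2) (coeffs E G p) θ)⁻¹ := by
  refine ae_eq_inv_of_entropy_eq (continuous_trig _ _) hpd hΦ ?_
  rw [lagrangian_coeffs hR hΦ hp, dualVal] at h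
  linarith

theorem lagrangian_congr_ae (hR : R ∈ blockRows m n) (hp : p ∈ multipliers m n l)
    (hΦ : Φ ∈ specDens m) (hΨ : Ψ ∈ specDens m) (h : ∀ᵐ θ ∂circMeasure, Φ θ = Ψ θ) :
    lagrangian E G R Φ p.1 p.2 = lagrangian E G R Ψ p.1 p.2 := by
  rw [lagrangian_coeffs hR hΦ hp, lagrangian_coeffs hR hΨ hp, entropy, entropy]
  congr 2
  · exact integral_congr_ae (h.mono fun θ hθ => by simp only [hθ])
  · exact integral_congr_ae (h.mono fun θ hθ => by simp only [hθ])

theorem dualObj_eq (hR : R ∈ blockRows m n) (hp : p ∈ multipliers m n l)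
    (hpd : ∀ θ, (trig (1 / 2) (coeffs E G p) θ).PosDef) :
    dualObj R (pairOf E G p).1 (pairOf E G p).2 = dualVal R (coeffs E G p) := by
  rw [dualObj, dualVal, ← integral_ip_correlogram hR, ← integral_neg]
  simp only [pairOf_sub hp]
  have hc : MInt (correlogram R) := by
    rw [correlogram_eq]; exact MInt.of_continuous (continuous_trig 1 R)
  simp only [ip_comm (trig _ _ _)]
  exact integral_add (integrable_log_det (continuous_trig _ _) hpd).neg
    (hc.integrable_ip (continuous_trig _ _))

/-- The dual function is infinite where `Σ - Λ` has a negative direction. -/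
theorem dualFun_eq_top (hE : ∀ k h, (k, h) ∈ E → (h, k) ∈ E) (hR : R ∈ blockRows m n)
    (hp : p ∈ multipliers m n l) {θ₀ : Circ}
    (h : ¬ (trig (1 / 2) (coeffs E G p) θ₀).PosSemidef) : dualFun E G R p = ⊤ := by
  set T := trig (1 / 2) (coeffs E G p) with hTdef
  have hTc : Continuous T := continuous_trig _ _
  have hTh : ∀ θ, (T θ).IsHermitian := trig_isHermitian _ (coeffs_mem hE hp)
  obtain ⟨v, hv⟩ : ∃ v : Fin m → ℂ, (star v ⬝ᵥ (T θ₀ *ᵥ v)).re < 0 := by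
    by_contra hcon
    push Not at hcon
    exact h (Matrix.PosSemidef.of_dotProduct_mulVec_nonneg (hTh θ₀) fun v =>
      Complex.le_def.2 ⟨hcon v, ((hTh θ₀).im_star_dotProduct_mulVec_self v).symm⟩)
  have hqc : Continuous fun θ => (star v ⬝ᵥ (T θ *ᵥ v)).re :=
    Complex.continuous_re.comp (continuous_const.dotProduct (hTc.matrix_mulVec continuous_const))
  set δ := -(star v ⬝ᵥ (T θ₀ *ᵥ v)).re / 2 with hδ
  have hδ0 : 0 < δ := by rw [hδ]; linarith
  set U := {θ | (star v ⬝ᵥ (T θ *ᵥ v)).re < -δ} with hU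
  have hUo : IsOpen U := isOpen_lt hqc continuous_const
  have hUpos : 0 < circMeasure.real U := by
    rw [measureReal_def]
    refine ENNReal.toReal_pos (hUo.measure_pos circMeasure ⟨θ₀, ?_⟩).ne' (measure_ne_top _ _)
    rw [hU, Set.mem_ofPred_eq, hδ]; linarith
  set N : Matrix (Fin m) (Fin m) ℂ := vecMulVec v (star v) with hN
  have hNp : N.PosSemidef := posSemidef_vecMulVec_self_star v
  let χ : ℝ → Circ → ℝ := fun t => U.indicator fun _ => t
  let F : ℝ → Circ → Matrix (Fin m) (Fin m) ℂ := fun t θ => 1 + (χ t θ : ℂ) • N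
  have hF : ∀ t, 0 ≤ t → F t ∈ specDens m := fun t ht => by
    have hχ0 : ∀ θ, 0 ≤ χ t θ := fun θ => Set.indicator_nonneg (fun _ _ => ht) θ
    have hχt : ∀ θ, χ t θ ≤ t := fun θ => Set.indicator_le_self' (fun _ _ => ht) θ
    have hs : ∀ r : ℝ, 0 ≤ r → ((r : ℂ) • N).PosSemidef := fun r hr =>
      hNp.smul (Complex.zero_le_real.2 hr)
    obtain ⟨-, -, c₁, c₂, -, h2, hc⟩ := specDens_of_continuous
      (F := fun _ => 1 + (t : ℂ) • N) continuous_const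
      (fun _ => Matrix.PosDef.one.add_posSemidef (hs t ht))
    refine ⟨fun a b => ?_, fun θ => ?_, 1, c₂, one_pos, h2, fun θ => ⟨?_, ?_⟩⟩
    · have hm : Measurable (χ t) := measurable_const.indicator hUo.measurableSet
      simp only [F, Matrix.add_apply, Matrix.smul_apply, smul_eq_mul]
      exact measurable_const.add ((Complex.measurable_ofReal.comp hm).mul_const _)
    · exact (Matrix.PosSemidef.one.add (hs _ (hχ0 θ))).1
    · simpa [F] using hs _ (hχ0 θ)
    · have h3 := (hc θ).2.add (hs (t - χ t θ) (sub_nonneg.2 (hχt θ)))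
      convert h3 using 1
      simp only [F, Complex.ofReal_sub, sub_smul]
      abel
  have hlow : ∀ t, 0 ≤ t → t * (δ * circMeasure.real U) -
      ∫ θ, (T θ).trace.re ∂circMeasure + pairing R (coeffs E G p) ≤
        lagrangian E G R (F t) p.1 p.2 := fun t ht => by
    rw [lagrangian_coeffs hR (hF t ht) hp]
    have hent : 0 ≤ entropy (F t) := integral_nonneg fun θ => by
      have hs : (F t θ - ((1 : ℝ) : ℂ) • 1).PosSemidef := by
        have := hNp.smul (Complex.zero_le_real.2
          (Set.indicator_nonneg (s := U) (f := fun _ => t) (fun _ _ => ht) θ))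
        simpa [F, χ] using this
      simpa using log_det_ge one_pos hs
    have hti : Integrable (fun θ => (T θ).trace.re) circMeasure :=
      integrable_of_continuous (Complex.continuous_re.comp hTc.matrix_trace)
    have hind : Integrable (U.indicator fun _ => t * δ) circMeasure :=
      (integrable_const _).indicator hUo.measurableSet
    have hip : ∫ θ, ip (F t θ) (T θ) ∂circMeasure ≤
        ∫ θ, ((T θ).trace.re - U.indicator (fun _ => t * δ) θ) ∂circMeasure := by
      refine integral_mono ((specDens_mInt (hF t ht)).integrable_ip hTc) (hti.sub hind) fun θ => ?_
      have e : ip (F t θ) (T θ) = (T θ).trace.re + χ t θ * (star v ⬝ᵥ (T θ *ᵥ v)).re := by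
        simp only [F]
        rw [ip_add_left, Complex.coe_smul, ip_smul_left, ip_comm 1, ip_one_right, ip_comm N, hN,
          ip_vecMulVec]
      simp only [e]
      by_cases hθ : θ ∈ U
      · simp only [χ, Set.indicator_of_mem hθ]
        have h4 : (star v ⬝ᵥ (T θ *ᵥ v)).re < -δ := hθ
        nlinarith
      · simp [χ, Set.indicator_of_notMem hθ]
    rw [integral_sub hti hind, integral_indicator_const _ hUo.measurableSet, smul_eq_mul] at hip
    linarith
  rw [EReal.eq_top_iff_forall_lt]
  intro y
  have hk : 0 < δ * circMeasure.real U := mul_pos hδ0 hUpos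
  set c := pairing R (coeffs E G p) - ∫ θ, (T θ).trace.re ∂circMeasure with hc
  set t := (|y - c| + 1) / (δ * circMeasure.real U) with ht
  have ht0 : 0 ≤ t := by positivity
  refine lt_of_lt_of_le (EReal.coe_lt_coe ?_) (le_dualFun (hF t ht0))
  refine lt_of_lt_of_le ?_ (hlow t ht0)
  rw [ht, div_mul_cancel₀ _ hk.ne']
  have := le_abs_self (y - c)
  linarith

end Primal

section Main
variable {m n l : ℕ} {E : Set (Fin m × Fin m)} {G : Matrix (Fin l) (BIdx m n) ℝ}
  {R : Fin (n + 1) → Matrix (Fin m) (Fin m) ℝ} {Φ Ψ : Circ → Matrix (Fin m) (Fin m) ℂ}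
  {p : (Fin (n + 1) → Matrix (Fin m) (Fin m) ℝ) × Matrix (Fin l) (Fin l) ℝ}

theorem convex_primalFeasible : Convex ℝ (primalFeasible E G R) := by
  intro Φ hΦ Ψ hΨ a b ha hb hab
  have iΦ := specDens_mInt hΦ.1
  have iΨ := specDens_mInt hΨ.1
  have hmat : ∀ {α β : Type} (A : Circ → Matrix α (Fin m) ℂ) (B : Circ → Matrix (Fin m) β ℂ),
      Continuous A → Continuous B → matInt (fun θ => A θ * (a • Φ + b • Ψ) θ * B θ) =
        a • matInt (fun θ => A θ * Φ θ * B θ) + b • matInt (fun θ => A θ * Ψ θ * B θ) :=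
    fun A B hA hB => by
      rw [← matInt_smul, ← matInt_smul, ← matInt_add (((iΦ.mul_left hA).mul_right hB).smul a)
        (((iΨ.mul_left hA).mul_right hB).smul b)]
      congr 1
      funext θ
      simp [Matrix.mul_add, Matrix.add_mul]
  refine ⟨specDens_convex_comb hΦ.1 hΨ.1 ha hb hab, fun j => ?_, ?_⟩
  · classical
    have hlag : lag (a • Φ + b • Ψ) j = a • lag Φ j + b • lag Ψ j := by
      have h := hmat (fun θ => expi (j : ℕ) θ • (1 : Matrix (Fin m) (Fin m) ℂ)) (fun _ => (1 : Matrix (Fin m) (Fin m) ℂ))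
        ((continuous_expi _).smul continuous_const) continuous_const
      simpa [lag] using h
    ext c d
    have h1 := congrFun (congrFun (hΦ.2.1 j) c) d
    have h2 := congrFun (congrFun (hΨ.2.1 j) c) d
    simp only [lagGap, proj_apply, Matrix.sub_apply, Matrix.zero_apply] at h1 h2 ⊢
    split_ifs with hcd
    · rw [if_pos hcd, sub_eq_zero] at h1 h2
      rw [hlag, Matrix.add_apply, Matrix.smul_apply, Matrix.smul_apply, h1, h2, ← add_smul, hab,
        one_smul, sub_self]
    · rfl
  · have hcov : covGap G R (a • Φ + b • Ψ) = a • covGap G R Φ + b • covGap G R Ψ := by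
      have h := hmat (fun θ => toC G * (shift m n θ)ᴴ) (fun θ => shift m n θ * (toC G)ᵀ)
        (continuous_const.matrix_mul continuous_shift.matrix_conjTranspose)
        (continuous_shift.matrix_mul continuous_const)
      simp only [← Matrix.mul_assoc] at h
      simp only [covGap]
      rw [h, smul_sub, smul_sub, sub_add_sub_comm, ← add_smul, hab, one_smul]
    have hsm : ∀ {r : ℝ} {A : Matrix (Fin l) (Fin l) ℂ}, 0 ≤ r → A.PosSemidef →
        (r • A).PosSemidef := fun {r A} hr hA => by
      rw [← Complex.coe_smul]; exact hA.smul (Complex.zero_le_real.2 hr)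
    rw [hcov]
    exact (hsm ha hΦ.2.2).add (hsm hb hΨ.2.2)

theorem concaveOn_entropy : ConcaveOn ℝ (primalFeasible E G R) entropy := by
  refine ⟨convex_primalFeasible, fun Φ hΦ Ψ hΨ a b ha hb hab => ?_⟩
  have hM := specDens_convex_comb hΦ.1 hΨ.1 ha hb hab
  have i1 := specDens_integrable_log_det hΦ.1
  have i2 := specDens_integrable_log_det hΨ.1
  rw [smul_eq_mul, smul_eq_mul, entropy, entropy, ← integral_const_mul, ← integral_const_mul,
    ← integral_add (i1.const_mul a) (i2.const_mul b)]
  refine integral_mono ((i1.const_mul a).add (i2.const_mul b))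
    (specDens_integrable_log_det hM) fun θ => ?_
  have hpd := specDens_posDef hM θ
  have h1 := log_det_le_tangent hpd (specDens_posDef hΦ.1 θ)
  have h2 := log_det_le_tangent hpd (specDens_posDef hΨ.1 θ)
  have h3 : a * ip (Φ θ - (a • Φ + b • Ψ) θ) ((a • Φ + b • Ψ) θ)⁻¹ +
      b * ip (Ψ θ - (a • Φ + b • Ψ) θ) ((a • Φ + b • Ψ) θ)⁻¹ = 0 := by
    rw [← ip_smul_left, ← ip_smul_left, ← ip_add_left, smul_sub, smul_sub, sub_add_sub_comm,
      ← add_smul, hab, one_smul]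
    simp
  have h4 := mul_le_mul_of_nonneg_left h1 ha
  have h5 := mul_le_mul_of_nonneg_left h2 hb
  simp only
  have h6 : (a + b) * Real.log ((a • Φ + b • Ψ) θ).det.re =
    Real.log ((a • Φ + b • Ψ) θ).det.re := by rw [hab, one_mul]
  nlinarith

/-- The data of the optimal spectral density: the inverse of a trigonometric polynomial in the
closure of the cone of all `Σ - Λ`. -/
theorem exists_optimal (hd : ∀ k, (k, k) ∈ E) (hE : ∀ k h, (k, h) ∈ E → (h, k) ∈ E)
    (hR : R ∈ blockRows m n) (hT : (toep R).PosDef) :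
    ∃ S₀ ∈ closure (coeffs E G '' multipliers m n l), (∀ θ, (trig (1 / 2) S₀ θ).PosDef) ∧
      (fun θ => (trig (1 / 2) S₀ θ)⁻¹) ∈ primalFeasible E G R ∧ pairing R S₀ = m ∧
      ∀ p ∈ multipliers m n l, (∀ θ, (trig (1 / 2) (coeffs E G p) θ).PosDef) →
        dualVal R S₀ ≤ dualVal R (coeffs E G p) := by
  set K := coeffs E G '' multipliers m n l with hK
  have hKb : closure K ⊆ blockRows m n := closure_minimal
    (by rintro _ ⟨p, hp, rfl⟩; exact coeffs_mem hE hp) isClosed_blockRows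
  have hadd : ∀ S ∈ closure K, ∀ S' ∈ closure K, S + S' ∈ closure K := fun S hS S' hS' =>
    map_mem_closure₂ continuous_add hS hS' (by
      rintro _ ⟨p, hp, rfl⟩ _ ⟨q, hq, rfl⟩
      exact ⟨p + q, multipliers_add hp hq, coeffs_add⟩)
  have hsmul : ∀ c : ℝ, 0 ≤ c → ∀ S ∈ closure K, c • S ∈ closure K := fun c hc S hS =>
    map_mem_closure (continuous_const_smul c) hS (by
      rintro _ ⟨p, hp, rfl⟩
      exact ⟨c • p, multipliers_smul hc hp, coeffs_smul c⟩)
  have hid : idRow m n ∈ closure K :=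
    subset_closure ⟨_, idRow_zero_mem, coeffs_idRow hd⟩
  obtain ⟨S₀, hS₀, hpd, hmin⟩ := exists_minimizer hT isClosed_closure hadd hsmul hid
  have hkkt : ∀ S ∈ closure K,
      ∫ θ, ip (trig (1 / 2) S θ) (trig (1 / 2) S₀ θ)⁻¹ ∂circMeasure ≤ pairing R S := fun S hS =>
    integral_ip_inv_le_of_minimal hKb hpd hmin fun s hs _ => hadd _ hS₀ _ (hsmul s hs.le _ hS)
  have hself : ∫ θ, ip (trig (1 / 2) S₀ θ) (trig (1 / 2) S₀ θ)⁻¹ ∂circMeasure = m := by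
    rw [← integral_ip_inv_self hpd]
    simp only [ip_comm (trig (1 / 2) S₀ _)]
  refine ⟨S₀, hS₀, hpd, ?_, le_antisymm ?_ ?_, fun p hp hp' =>
    hmin _ (subset_closure ⟨p, hp, rfl⟩) hp'⟩
  · refine primalFeasible_of_integral_ip_le hE hR hT
      (inv_mem_specDens (continuous_trig _ _) hpd) (conjSymm_trig _ S₀).inv fun p hp => ?_
    simp only [ip_comm (trig (1 / 2) S₀ _)⁻¹]
    exact hkkt _ (subset_closure ⟨p, hp, rfl⟩)
  · have h := integral_ip_inv_le_of_minimal (D := (-1 : ℝ) • S₀) hKb hpd hmin fun s hs hs1 => by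
      have e : S₀ + s • (-1 : ℝ) • S₀ = (1 - s) • S₀ := by
        rw [smul_smul, sub_smul, one_smul, mul_neg_one, neg_smul, sub_eq_add_neg]
      rw [e]
      exact hsmul _ (by linarith) _ hS₀
    simp only [trig_smul, ip_smul_left, integral_const_mul, pairing_smul_right, hself] at h
    linarith
  · rw [← hself]
    exact hkkt _ hS₀

theorem integral_ip_le_pairing_of_mem_closure (hR : R ∈ blockRows m n)
    (hΦ : Φ ∈ primalFeasible E G R) {S : Fin (n + 1) → Matrix (Fin m) (Fin m) ℝ}
    (hS : S ∈ closure (coeffs E G '' multipliers m n l)) :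
    ∫ θ, ip (Φ θ) (trig (1 / 2) S θ) ∂circMeasure ≤ pairing R S := by
  have hc : Continuous fun S : Fin (n + 1) → Matrix (Fin m) (Fin m) ℝ =>
      ∑ j : Fin (n + 1), ip (lag Φ j) (toC (S j)) := by
    simp only [ip_eq_sum, toC_apply]
    refine continuous_finsetSum _ fun j _ => continuous_finsetSum _ fun a _ =>
      continuous_finsetSum _ fun b _ => Complex.continuous_re.comp (continuous_const.mul
        (Complex.continuous_conj.comp (Complex.continuous_ofReal.comp
          ((continuous_apply j).matrix_elem a b))))
  have hcl : IsClosed {S : Fin (n + 1) → Matrix (Fin m) (Fin m) ℝ |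
      ∑ j : Fin (n + 1), ip (lag Φ j) (toC (S j)) ≤ pairing R S} :=
    isClosed_le hc (continuous_pairing R)
  have h := closure_minimal (s := coeffs E G '' multipliers m n l) (by
    rintro _ ⟨p, hp, rfl⟩
    have := integral_ip_le_pairing hR hΦ hp
    rwa [integral_ip_trig (specDens_mInt hΦ.1) hΦ.1.2.1] at this) hcl hS
  rw [integral_ip_trig (specDens_mInt hΦ.1) hΦ.1.2.1]
  exact h

theorem mem_dualFeasible_iff (hE : ∀ k h, (k, h) ∈ E → (h, k) ∈ E)
    (hp : p ∈ multipliers m n l) :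
    pairOf E G p ∈ dualFeasible E G ↔ ∀ θ, (trig (1 / 2) (coeffs E G p) θ).PosDef := by
  have h : pairOf E G p ∈ VE n E ×ˢ VGpos G := by
    rw [← image_pairOf hE G]; exact ⟨p, hp, rfl⟩
  simp only [dualFeasible, Set.mem_ofPred_eq, pairOf_sub hp]
  exact ⟨fun h' => h'.1, fun h' => ⟨h', h⟩⟩

theorem exists_multiplier_of_mem_dualFeasible (hE : ∀ k h, (k, h) ∈ E → (h, k) ∈ E)
    {q : (Circ → Matrix (Fin m) (Fin m) ℂ) × (Circ → Matrix (Fin m) (Fin m) ℂ)}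
    (hq : q ∈ dualFeasible E G) : ∃ p ∈ multipliers m n l, pairOf E G p = q ∧
      ∀ θ, (trig (1 / 2) (coeffs E G p) θ).PosDef := by
  have h : q ∈ VE n E ×ˢ VGpos G := hq.2
  rw [← image_pairOf hE G] at h
  obtain ⟨p, hp, rfl⟩ := h
  exact ⟨p, hp, rfl, (mem_dualFeasible_iff hE hp).1 hq⟩

theorem isDualSolution_iff (hE : ∀ k h, (k, h) ∈ E → (h, k) ∈ E) (hR : R ∈ blockRows m n)
    (hp : p ∈ multipliers m n l) : IsDualSolution E G R (pairOf E G p) ↔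
      (∀ θ, (trig (1 / 2) (coeffs E G p) θ).PosDef) ∧ ∀ p' ∈ multipliers m n l,
        (∀ θ, (trig (1 / 2) (coeffs E G p') θ).PosDef) →
          dualVal R (coeffs E G p) ≤ dualVal R (coeffs E G p') := by
  rw [IsDualSolution, mem_dualFeasible_iff hE hp]
  refine and_congr_right fun hpd => ⟨fun h p' hp' hpd' => ?_, fun h q hq => ?_⟩
  · rw [← dualObj_eq hR hp hpd, ← dualObj_eq hR hp' hpd']
    exact h _ ((mem_dualFeasible_iff hE hp').2 hpd')
  · obtain ⟨p', hp', rfl, hpd'⟩ := exists_multiplier_of_mem_dualFeasible hE hq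
    rw [dualObj_eq hR hp hpd, dualObj_eq hR hp' hpd']
    exact h p' hp' hpd'

/-- Multipliers minimizing the dual function give a nonsingular `Σ - Λ`. -/
theorem posDef_of_dualFun_minimal (hd : ∀ k, (k, k) ∈ E) (hE : ∀ k h, (k, h) ∈ E → (h, k) ∈ E)
    (hR : R ∈ blockRows m n) (hp : p ∈ multipliers m n l)
    (hmin : ∀ p' ∈ multipliers m n l, dualFun E G R p ≤ dualFun E G R p') (θ : Circ) :
    (trig (1 / 2) (coeffs E G p) θ).PosDef := by
  have hid : ∀ θ, (trig (1 / 2) (coeffs E G (idRow m n, 0)) θ).PosDef := fun θ => by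
    rw [coeffs_idRow hd, trig_idRow]; exact Matrix.PosDef.one
  have hpsd : ∀ θ, (trig (1 / 2) (coeffs E G p) θ).PosSemidef := fun θ => by
    by_contra hcon
    have h1 := hmin _ idRow_zero_mem
    rw [dualFun_eq_top hE hR hp hcon, dualFun_eq hR idRow_zero_mem hid, top_le_iff] at h1
    exact EReal.coe_ne_top _ h1
  refine posDef_of_integral_trace_inv_le (C := pairing R (idRow m n)) hpsd (fun t ht => ?_) θ
  set q : (Fin (n + 1) → Matrix (Fin m) (Fin m) ℝ) × Matrix (Fin l) (Fin l) ℝ :=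
    p + t • (idRow m n, 0) with hq
  have hqm : q ∈ multipliers m n l := multipliers_add hp (multipliers_smul ht.le idRow_zero_mem)
  have hqc : coeffs E G q = coeffs E G p + t • idRow m n := by
    rw [hq, coeffs_add, coeffs_smul, coeffs_idRow hd]
  have hshift : ∀ θ, trig (1 / 2) (coeffs E G q) θ =
      trig (1 / 2) (coeffs E G p) θ + (t : ℂ) • 1 := fun θ => by
    rw [hqc, trig_add, trig_smul, trig_idRow, Complex.coe_smul]
  have hqpd : ∀ θ, (trig (1 / 2) (coeffs E G q) θ).PosDef := fun θ => by
    rw [hshift]; exact posDef_add_smul_one (hpsd θ) ht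
  set F : Circ → Matrix (Fin m) (Fin m) ℂ := fun θ => (trig (1 / 2) (coeffs E G q) θ)⁻¹ with hF
  have hFs : F ∈ specDens m := inv_mem_specDens (continuous_trig _ _) hqpd
  have h1 := (le_dualFun (p := p) (E := E) (G := G) (R := R) hFs).trans (hmin q hqm)
  rw [dualFun_eq hR hqm hqpd, EReal.coe_le_coe_iff, ← lagrangian_inv hR hqm hqpd,
    lagrangian_coeffs hR hFs hp, lagrangian_coeffs hR hFs hqm] at h1
  have hti : Integrable (fun θ => (F θ).trace.re) circMeasure :=
    integrable_of_continuous (Complex.continuous_re.comp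
      (continuous_inv_of_posDef (continuous_trig _ _) hqpd).matrix_trace)
  have h2 : ∫ θ, ip (F θ) (trig (1 / 2) (coeffs E G q) θ) ∂circMeasure =
      ∫ θ, ip (F θ) (trig (1 / 2) (coeffs E G p) θ) ∂circMeasure +
        t * ∫ θ, (F θ).trace.re ∂circMeasure := by
    rw [← integral_const_mul, ← integral_add
      ((specDens_mInt hFs).integrable_ip (continuous_trig _ _)) (hti.const_mul t)]
    refine integral_congr_ae (Eventually.of_forall fun θ => ?_)
    simp only
    rw [hshift, ip_add_right, Complex.coe_smul, ip_smul_right, ip_one_right]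
  have h3 : pairing R (coeffs E G q) = pairing R (coeffs E G p) + t * pairing R (idRow m n) := by
    rw [hqc, pairing_add_right, pairing_smul_right]
  rw [h2, h3] at h1
  have h4 : t * ∫ θ, (F θ).trace.re ∂circMeasure ≤ t * pairing R (idRow m n) := by linarith
  have h5 := le_of_mul_le_mul_left h4 ht
  simpa only [hF, hshift] using h5

end Main

section Duality
variable {m n l : ℕ} {E : Set (Fin m × Fin m)} {G : Matrix (Fin l) (BIdx m n) ℝ}
  {R : Fin (n + 1) → Matrix (Fin m) (Fin m) ℝ} {Φ Ψ : Circ → Matrix (Fin m) (Fin m) ℂ}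
  {p : (Fin (n + 1) → Matrix (Fin m) (Fin m) ℝ) × Matrix (Fin l) (Fin l) ℝ}
  {S₀ : Fin (n + 1) → Matrix (Fin m) (Fin m) ℝ}

/-- The objective at a limit of the cone is approximated from within the cone. -/
theorem exists_dualVal_lt (hE : ∀ k h, (k, h) ∈ E → (h, k) ∈ E)
    (hS₀ : S₀ ∈ closure (coeffs E G '' multipliers m n l))
    (hpd : ∀ θ, (trig (1 / 2) S₀ θ).PosDef) {c : ℝ} (hc : dualVal R S₀ < c) :
    ∃ p ∈ multipliers m n l, (∀ θ, (trig (1 / 2) (coeffs E G p) θ).PosDef) ∧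
      dualVal R (coeffs E G p) < c := by
  have := mem_closure_iff_nhdsWithin_neBot.1 hS₀
  have hmem : ∀ᶠ S in 𝓝[coeffs E G '' multipliers m n l] S₀,
      S ∈ coeffs E G '' multipliers m n l := self_mem_nhdsWithin
  have hev : ∀ᶠ S in 𝓝[coeffs E G '' multipliers m n l] S₀,
      ∀ θ, (trig (1 / 2) S θ).PosDef := by
    have h1 := eventually_posDef (M := fun S θ => trig (1 / 2) S θ)
      (continuous_trig_uncurry (m := m) (n := n) (1 / 2)) hpd
    filter_upwards [h1.filter_mono nhdsWithin_le_nhds, hmem] with S hS hSm θ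
    obtain ⟨p, hp, rfl⟩ := hSm
    exact hS θ (trig_isHermitian _ (coeffs_mem hE hp) θ)
  have hlt := (tendsto_dualVal R hpd nhdsWithin_le_nhds hev).eventually_lt_const hc
  obtain ⟨_, ⟨p, hp, rfl⟩, h2, h3⟩ := (hmem.and (hev.and hlt)).exists
  exact ⟨p, hp, h2, h3⟩

/-- The inverse of a positive definite limit of the cone solves the covariance extension problem
as soon as it is feasible and complementary slackness holds. -/
theorem isPrimalSolution_inv (hR : R ∈ blockRows m n)
    (hS₀ : S₀ ∈ closure (coeffs E G '' multipliers m n l))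
    (hpd : ∀ θ, (trig (1 / 2) S₀ θ).PosDef)
    (hfeas : (fun θ => (trig (1 / 2) S₀ θ)⁻¹) ∈ primalFeasible E G R)
    (hpair : pairing R S₀ = m) : IsPrimalSolution E G R fun θ => (trig (1 / 2) S₀ θ)⁻¹ := by
  refine ⟨hfeas, fun Ψ hΨ => ?_⟩
  have h1 := integral_ip_le_pairing_of_mem_closure hR hΨ hS₀
  have h2 := entropy_sub_integral_ip_le (continuous_trig (1 / 2) S₀) hpd hΨ.1
  rw [entropy_inv hpd]
  linarith

theorem ae_eq_of_isPrimalSolution (hR : R ∈ blockRows m n)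
    (hS₀ : S₀ ∈ closure (coeffs E G '' multipliers m n l))
    (hpd : ∀ θ, (trig (1 / 2) S₀ θ).PosDef)
    (hfeas : (fun θ => (trig (1 / 2) S₀ θ)⁻¹) ∈ primalFeasible E G R)
    (hpair : pairing R S₀ = m) (hΨ : IsPrimalSolution E G R Ψ) :
    ∀ᵐ θ ∂circMeasure, Ψ θ = (trig (1 / 2) S₀ θ)⁻¹ := by
  refine ae_eq_inv_of_entropy_eq (continuous_trig (1 / 2) S₀) hpd hΨ.1.1 ?_
  have h1 := integral_ip_le_pairing_of_mem_closure hR hΨ.1 hS₀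
  have h2 := hΨ.2 _ hfeas
  rw [entropy_inv hpd] at h2
  linarith

theorem lagrangian_eq_dualFun_iff (hR : R ∈ blockRows m n) (hp : p ∈ multipliers m n l)
    (hpd : ∀ θ, (trig (1 / 2) (coeffs E G p) θ).PosDef) (hΦ : Φ ∈ specDens m) :
    ((lagrangian E G R Φ p.1 p.2 : ℝ) : EReal) = dualFun E G R p ↔
      ∀ᵐ θ ∂circMeasure, Φ θ = (trig (1 / 2) (coeffs E G p) θ)⁻¹ := by
  rw [dualFun_eq hR hp hpd, EReal.coe_eq_coe_iff]
  refine ⟨fun h => ae_eq_of_lagrangian_ge hR hp hpd hΦ h.ge, fun h => ?_⟩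
  rw [← lagrangian_inv hR hp hpd]
  exact lagrangian_congr_ae hR hp hΦ (inv_mem_specDens (continuous_trig _ _) hpd) h

/-- Zero duality gap, with the optimal value attained by the primal problem. -/
theorem dualVal_eq_of_isDualSolution (hE : ∀ k h, (k, h) ∈ E → (h, k) ∈ E)
    (hR : R ∈ blockRows m n) (hS₀ : S₀ ∈ closure (coeffs E G '' multipliers m n l))
    (hpd : ∀ θ, (trig (1 / 2) S₀ θ).PosDef)
    (hmin : ∀ p ∈ multipliers m n l, (∀ θ, (trig (1 / 2) (coeffs E G p) θ).PosDef) →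
      dualVal R S₀ ≤ dualVal R (coeffs E G p))
    (hp : p ∈ multipliers m n l) (h : IsDualSolution E G R (pairOf E G p)) :
    dualVal R (coeffs E G p) = dualVal R S₀ := by
  obtain ⟨h1, h2⟩ := (isDualSolution_iff hE hR hp).1 h
  refine le_antisymm (le_of_not_gt fun hlt => ?_) (hmin p hp h1)
  obtain ⟨p', hp', hpd', hlt'⟩ := exists_dualVal_lt (R := R) hE hS₀ hpd hlt
  exact absurd (h2 p' hp' hpd') hlt'.not_ge

/-- A dual solution has the coefficients' inverse equal to the optimal spectral density. -/
theorem inv_eq_of_isDualSolution (hE : ∀ k h, (k, h) ∈ E → (h, k) ∈ E)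
    (hR : R ∈ blockRows m n) (hS₀ : S₀ ∈ closure (coeffs E G '' multipliers m n l))
    (hpd : ∀ θ, (trig (1 / 2) S₀ θ).PosDef)
    (hfeas : (fun θ => (trig (1 / 2) S₀ θ)⁻¹) ∈ primalFeasible E G R)
    (hpair : pairing R S₀ = m)
    (hmin : ∀ p ∈ multipliers m n l, (∀ θ, (trig (1 / 2) (coeffs E G p) θ).PosDef) →
      dualVal R S₀ ≤ dualVal R (coeffs E G p))
    (hp : p ∈ multipliers m n l) (h : IsDualSolution E G R (pairOf E G p)) :
    (fun θ => (trig (1 / 2) S₀ θ)⁻¹) = fun θ => (trig (1 / 2) (coeffs E G p) θ)⁻¹ := by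
  have hpd' := ((isDualSolution_iff hE hR hp).1 h).1
  have hae := ae_eq_of_lagrangian_ge hR hp hpd' hfeas.1 (by
    refine le_trans (le_of_eq ?_) (entropy_le_lagrangian hR hfeas hp)
    rw [dualVal_eq_of_isDualSolution hE hR hS₀ hpd hmin hp h, entropy_inv hpd, dualVal, hpair]
    ring)
  exact (Continuous.ae_eq_iff_eq circMeasure
    (continuous_inv_of_posDef (continuous_trig _ _) hpd)
    (continuous_inv_of_posDef (continuous_trig _ _) hpd')).1 hae

theorem gram_posSemidef (G : Matrix (Fin l) (BIdx m n) ℝ) {H : Matrix (Fin l) (Fin l) ℝ}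
    (hH : H.PosSemidef) (θ : Circ) : (gram G H θ).PosSemidef :=
  (posSemidef_toC (posSemidef_congr hH G)).mul_mul_conjTranspose_same _

end Duality
end ARLatent

theorem mainTheorem1 (m n l : ℕ) (E : Set (Fin m × Fin m))
    (hE_diag : ∀ k, (k, k) ∈ E) (hE_symm : ∀ k h, (k, h) ∈ E → (h, k) ∈ E)
    (G : Matrix (Fin l) (ARLatent.BIdx m n) ℝ)
    (R : Fin (n + 1) → Matrix (Fin m) (Fin m) ℝ) (hR : R ∈ ARLatent.blockRows m n)
    (hT : (ARLatent.toep R).PosDef) :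
    -- the covariance extension problem is a convex optimization problem
    ConcaveOn ℝ (ARLatent.primalFeasible E G R) ARLatent.entropy ∧
    -- the multipliers parametrize the pairs `(Σ, Λ)` with `Σ ∈ V_E` and `Λ` in the cone of `V_G`
    ARLatent.pairOf E G '' ARLatent.multipliers m n l =
      ARLatent.VE n E ×ˢ ARLatent.VGpos G ∧
    -- where `Σ - Λ ≻ 0`, the Lagrangian has the unique maximum point `(Σ - Λ)⁻¹`, and the dual
    -- function is the objective of the identification problem up to a constant
    (∀ p ∈ ARLatent.multipliers m n l, ARLatent.pairOf E G p ∈ ARLatent.dualFeasible E G →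
      ((fun θ => ((ARLatent.pairOf E G p).1 θ - (ARLatent.pairOf E G p).2 θ)⁻¹) ∈
          ARLatent.specDens m ∧
        (∀ Φ ∈ ARLatent.specDens m,
          ((ARLatent.lagrangian E G R Φ p.1 p.2 : ℝ) : EReal) = ARLatent.dualFun E G R p ↔
            ∀ᵐ θ ∂ARLatent.circMeasure,
              Φ θ = ((ARLatent.pairOf E G p).1 θ - (ARLatent.pairOf E G p).2 θ)⁻¹) ∧
        ARLatent.dualFun E G R p =
          ((ARLatent.dualObj R (ARLatent.pairOf E G p).1 (ARLatent.pairOf E G p).2 - m : ℝ) :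
            EReal))) ∧
    -- where `Σ - Λ` is not positive semidefinite, the dual function is infinite
    (∀ p ∈ ARLatent.multipliers m n l,
      (∃ θ, ¬ ((ARLatent.pairOf E G p).1 θ - (ARLatent.pairOf E G p).2 θ).PosSemidef) →
        ARLatent.dualFun E G R p = ⊤) ∧
    -- the Lagrange dual and the identification problem have the same solutions
    (∀ p ∈ ARLatent.multipliers m n l,
      (∀ p' ∈ ARLatent.multipliers m n l,
          ARLatent.dualFun E G R p ≤ ARLatent.dualFun E G R p') ↔
        ARLatent.IsDualSolution E G R (ARLatent.pairOf E G p)) ∧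
    -- strong duality; the optimal spectral density exists and is unique
    (∃ Φ, ARLatent.IsPrimalSolution E G R Φ ∧
      (∀ Ψ, ARLatent.IsPrimalSolution E G R Ψ → ∀ᵐ θ ∂ARLatent.circMeasure, Ψ θ = Φ θ) ∧
      (⨅ p ∈ ARLatent.multipliers m n l, ARLatent.dualFun E G R p) =
        ((ARLatent.entropy Φ : ℝ) : EReal) ∧
      IsGLB ((fun q => ARLatent.dualObj R q.1 q.2 - m) '' ARLatent.dualFeasible E G)
        (ARLatent.entropy Φ)) ∧
    -- each solution `(Σ, Λ)` of the identification problem gives the optimal spectral density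
    (∀ q, ARLatent.IsDualSolution E G R q →
      ARLatent.IsPrimalSolution E G R (fun θ => (q.1 θ - q.2 θ)⁻¹)) ∧
    -- form of the optimal spectral density
    ((∀ L ∈ ARLatent.VE n E ∩ ARLatent.VGpos G, L = 0) →
      ∃ P L, ARLatent.IsDualSolution E G R (P, L) ∧ P ∈ ARLatent.VE n E ∧ L ∈ ARLatent.VG G ∧
        (∀ θ, (L θ).PosSemidef) ∧ (∀ θ, (P θ - L θ).PosDef) ∧
        ARLatent.IsPrimalSolution E G R (fun θ => (P θ - L θ)⁻¹)) := by
  obtain ⟨S₀, hS₀, hpd, hfeas, hpair, hmin⟩ := ARLatent.exists_optimal (G := G) hE_diag hE_symm hR hT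
  have hval : ARLatent.entropy (fun θ => (ARLatent.trig (1 / 2) S₀ θ)⁻¹) =
      ARLatent.dualVal R S₀ - m := by
    rw [ARLatent.entropy_inv hpd, ARLatent.dualVal, hpair]; ring
  have hweak : ∀ p ∈ ARLatent.multipliers m n l,
      ((ARLatent.dualVal R S₀ - m : ℝ) : EReal) ≤ ARLatent.dualFun E G R p := fun p hp => by
    rw [← hval]
    exact (EReal.coe_le_coe (ARLatent.entropy_le_lagrangian hR hfeas hp)).trans
      (ARLatent.le_dualFun hfeas.1)
  have hprimal : ∀ q, ARLatent.IsDualSolution E G R q →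
      ARLatent.IsPrimalSolution E G R (fun θ => (q.1 θ - q.2 θ)⁻¹) := fun q hq => by
    obtain ⟨p, hp, rfl, -⟩ := ARLatent.exists_multiplier_of_mem_dualFeasible hE_symm hq.1
    simp only [ARLatent.pairOf_sub hp]
    rw [← ARLatent.inv_eq_of_isDualSolution hE_symm hR hS₀ hpd hfeas hpair hmin hp hq]
    exact ARLatent.isPrimalSolution_inv hR hS₀ hpd hfeas hpair
  refine ⟨ARLatent.concaveOn_entropy, ARLatent.image_pairOf hE_symm G, fun p hp hq => ?_,
    fun p hp ⟨θ, hθ⟩ => ?_, fun p hp => ⟨fun h => ?_, fun h p' hp' => ?_⟩,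
    ⟨_, ARLatent.isPrimalSolution_inv hR hS₀ hpd hfeas hpair,
      fun Ψ hΨ => ARLatent.ae_eq_of_isPrimalSolution hR hS₀ hpd hfeas hpair hΨ, ?_, ?_, ?_⟩,
    hprimal, fun h0 => ?_⟩
  · have hq' := (ARLatent.mem_dualFeasible_iff hE_symm hp).1 hq
    simp only [ARLatent.pairOf_sub hp]
    refine ⟨ARLatent.inv_mem_specDens (ARLatent.continuous_trig _ _) hq',
      fun Φ hΦ => ARLatent.lagrangian_eq_dualFun_iff hR hp hq' hΦ, ?_⟩
    rw [ARLatent.dualFun_eq hR hp hq', ARLatent.dualObj_eq hR hp hq']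
  · rw [ARLatent.pairOf_sub hp] at hθ
    exact ARLatent.dualFun_eq_top hE_symm hR hp hθ
  · have hq := ARLatent.posDef_of_dualFun_minimal hE_diag hE_symm hR hp h
    refine (ARLatent.isDualSolution_iff hE_symm hR hp).2 ⟨hq, fun p' hp' hq' => ?_⟩
    have h1 := h p' hp'
    rw [ARLatent.dualFun_eq hR hp hq, ARLatent.dualFun_eq hR hp' hq', EReal.coe_le_coe_iff] at h1
    linarith
  · rw [ARLatent.dualFun_eq hR hp ((ARLatent.isDualSolution_iff hE_symm hR hp).1 h).1,
      ARLatent.dualVal_eq_of_isDualSolution hE_symm hR hS₀ hpd hmin hp h]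
    exact hweak p' hp'
  · rw [hval]
    refine le_antisymm (le_of_forall_gt fun c hc => ?_) (le_iInf₂ hweak)
    obtain ⟨r, hr1, hr2⟩ := EReal.lt_iff_exists_real_btwn.1 hc
    rw [EReal.coe_lt_coe_iff] at hr1
    obtain ⟨p, hp, hq, hlt⟩ := ARLatent.exists_dualVal_lt (R := R) hE_symm hS₀ hpd
      (c := r + m) (by linarith)
    refine (iInf₂_le p hp).trans_lt (lt_trans ?_ hr2)
    rw [ARLatent.dualFun_eq hR hp hq, EReal.coe_lt_coe_iff]
    linarith
  · rintro _ ⟨q, hq, rfl⟩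
    obtain ⟨p, hp, rfl, hq'⟩ := ARLatent.exists_multiplier_of_mem_dualFeasible hE_symm hq
    simp only [hval, ARLatent.dualObj_eq hR hp hq']
    linarith [hmin p hp hq']
  · intro b hb
    rw [hval]
    refine le_of_forall_gt_imp_ge_of_dense fun c hc => ?_
    obtain ⟨p, hp, hq, hlt⟩ := ARLatent.exists_dualVal_lt (R := R) hE_symm hS₀ hpd
      (c := c + m) (by linarith)
    have := hb ⟨_, (ARLatent.mem_dualFeasible_iff hE_symm hp).2 hq, rfl⟩
    simp only [ARLatent.dualObj_eq hR hp hq] at this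
    linarith
  · obtain ⟨p, hp, rfl⟩ := ARLatent.mem_coeffs_image_of_mem_closure hE_symm h0 hS₀
    have hsol := (ARLatent.isDualSolution_iff hE_symm hR hp).2 ⟨hpd, hmin⟩
    exact ⟨ARLatent.sigmaOf E p.1, ARLatent.gram G p.2, hsol, hsol.1.2.1,
      ⟨p.2, ARLatent.posSemidef_isSymm hp.2, rfl⟩, fun θ => ARLatent.gram_posSemidef G hp.2 θ,
      hsol.1.1, hprimal (ARLatent.pairOf E G p) hsol⟩
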